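/- Let $\phi(t)=\left(\frac{X(t)}{W(t)},\frac{Y(t)}{W(t)}\right)$, with $X,Y,W\in\mathbb{Q}[t]$, $W\neq 0$, $\gcd(X,Y,W)=1$, be a rational parametrization of a plane curve $\mathcal{C}\subset\mathbb{C}^2$ (the Zariski closure of the image of $\phi$) that is neither a line nor a circle, and let $n$ be its tracing index, i.e. all but finitely many points of $\mathcal{C}$ are of the form $\phi(t)$ for exactly $n$ values $t\in\mathbb{C}$. Let $d>0$ be real and put $U=X'W-XW'$, $V=Y'W-YW'$. The offset $\mathcal{O}_d(\mathcal{C})\subset\mathbb{C}^2$ is the Zariski closure of the set of all points $$q=\left(\frac{X(t)}{W(t)}\pm d\,\frac{V(t)}{\sqrt{U(t)^2+V(t)^2}},\ \frac{Y(t)}{W(t)}\mp d\,\frac{U(t)}{\sqrt{U(t)^2+V(t)^2}}\right),\qquad t\in\mathbb{C},\ W(t)\neq 0,\ U(t)^2+V(t)^2\neq 0;$$ such a $q$ is said to be generated by the point $\phi(t)$. An irreducible component of $\mathcal{O}_d(\mathcal{C})$ is simple if all but finitely many of its points are generated by exactly one point of $\mathcal{C}$, and special otherwise. Let $P,Q\in\mathbb{C}[x,y,t]$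 be obtained from $$\tilde P=U\,(Wx-X)+V\,(Wy-Y),\qquad \tilde Q=(Wx-X)^2+(Wy-Y)^2-d^2W^2$$ by dividing by their contents in $\mathbb{C}[t]$ (the greatest common divisor of the coefficients of the polynomial regarded as a polynomial in $x,y$ over $\mathbb{C}[t]$), and let $H(x,y)=\operatorname{Res}_t(P,Q)$. Then $H$ can be written as $H=F\cdot G$, where $F=0$ defines the set $\mathcal{O}_d(\mathcal{C})$ and $G$ is a (possibly empty) product of linear polynomials in $\mathbb{C}[x,y]$. Moreover, $\mathcal{O}_d(\mathcal{C})$ has at most two irreducible components and at most one special component; there are $f_1,f_2\in\mathbb{C}[x,y]$ such that $\mathcal{O}_d(\mathcal{C})=\{f_1=0\}\cup\{f_2=0\}$, $f_1$ is irreducible, $f_2$ is irreducible or $f_2=1$, $\{f_1=0\}\neq\{f_2=0\}$, and $f_2=0$ defines the special component if there is one. For every such $F,G$ and every such $f_1,f_2$, up to a nonzero constant factor: 1. if $\mathcal{O}_d(\mathcal{C})$ does not have any special component, then $F(x,y)=f_1(x,y)^n\cdot f_2(x,y)^n$; 2. if $\mathcal{O}_d(\mathcal{C})$ has a special component, then $F(x,y)=f_1(x,y)^n\cdot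 f_2(x,y)^{2n}$. -/

import Mathlib

/-- A rational parametrization `t ↦ (X(t)/W(t), Y(t)/W(t))` with rational coefficients, written
with a common denominator and in lowest terms: `gcd(X, Y, W) = 1`. -/
structure RatParam where
  X : Polynomial ℚ
  Y : Polynomial ℚ
  W : Polynomial ℚ
  W_ne_zero : W ≠ 0
  gcd_eq_one : ∀ a : Polynomial ℚ, a ∣ X → a ∣ Y → a ∣ W → IsUnit a

/-- The ring `ℂ[x, y]`; the variable `0` is `x` and the variable `1` is `y`. -/
abbrev PolyXY : Type := MvPolynomial (Fin 2) ℂ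

/-- The Zariski closure of a subset of the affine plane `ℂ²`. -/
def zariskiClosure (S : Set (Fin 2 → ℂ)) : Set (Fin 2 → ℂ) :=
  MvPolynomial.zeroLocus ℂ (MvPolynomial.vanishingIdeal ℂ S)

/-- The plane algebraic set `{f = 0} ⊆ ℂ²`. -/
def planeCurve (f : PolyXY) : Set (Fin 2 → ℂ) :=
  {p | MvPolynomial.eval p f = 0}

/-- `V` is an irreducible component of `S`: a maximal irreducible Zariski closed subset of `S`. -/
def IsIrredComponent (S V : Set (Fin 2 → ℂ)) : Prop :=
  Maximal (fun Z : Set (Fin 2 → ℂ) =>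
    zariskiClosure Z = Z ∧ (MvPolynomial.vanishingIdeal ℂ Z).IsPrime ∧ Z ⊆ S) V

/-- `p` is the primitive part, with respect to `t`, of `p₀ ∈ ℂ[x, y][t]`: it is `p₀` divided by
its content, the greatest common divisor in `ℂ[t]` of the coefficients of `p₀` regarded as a
polynomial in `x, y`. (A polynomial `a ∈ ℂ[t]` divides all those coefficients iff `a ∣ p₀`.) -/
def IsPrimitivePartT (p₀ p : Polynomial PolyXY) : Prop :=
  (∃ c : Polynomial ℂ, p₀ = c.map MvPolynomial.C * p) ∧
    ∀ a : Polynomial ℂ, a.map MvPolynomial.C ∣ p → IsUnit a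

namespace RatParam

noncomputable section

/-- `U = X' W - X W'`. -/
def U (φ : RatParam) : Polynomial ℚ :=
  Polynomial.derivative φ.X * φ.W - φ.X * Polynomial.derivative φ.W

/-- `V = Y' W - Y W'`. -/
def V (φ : RatParam) : Polynomial ℚ :=
  Polynomial.derivative φ.Y * φ.W - φ.Y * Polynomial.derivative φ.W

/-- The point `φ(t) ∈ ℂ²`; meaningful when `W(t) ≠ 0`. -/
def point (φ : RatParam) (t : ℂ) : Fin 2 → ℂ :=
  ![Polynomial.aeval t φ.X / Polynomial.aeval t φ.W,
    Polynomial.aeval t φ.Y / Polynomial.aeval t φ.W]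

/-- The algebraic set parametrized by `φ`. -/
def curve (φ : RatParam) : Set (Fin 2 → ℂ) :=
  zariskiClosure {p | ∃ t : ℂ, Polynomial.aeval t φ.W ≠ 0 ∧ p = φ.point t}

/-- The parameter values at which `φ` passes through `p`. -/
def fibre (φ : RatParam) (p : Fin 2 → ℂ) : Set ℂ :=
  {t | Polynomial.aeval t φ.W ≠ 0 ∧ φ.point t = p}

/-- `φ` has tracing index `n`: all but finitely many points of the curve are reached by exactly
`n` values of the parameter. -/
def HasTracingIndex (φ : RatParam) (n : ℕ) : Prop :=
  {p | p ∈ φ.curve ∧ (φ.fibre p).encard ≠ n}.Finite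

/-- `φ` parametrizes a (non-degenerate) curve that is neither a line nor a circle. -/
def IsAdmissible (φ : RatParam) : Prop :=
  φ.curve.Infinite ∧
  (∀ a b c : ℝ, (a ≠ 0 ∨ b ≠ 0) →
    φ.curve ≠ {p | (a : ℂ) * p 0 + (b : ℂ) * p 1 + (c : ℂ) = 0}) ∧
  (∀ a b r : ℝ, 0 < r →
    φ.curve ≠ {p | (p 0 - (a : ℂ)) ^ 2 + (p 1 - (b : ℂ)) ^ 2 = (r : ℂ) ^ 2})

/-- `t` generates `q` at distance `d`: `q = φ(t) + d (V, -U) / s`, where `s` is one of the two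
square roots of `U² + V² ≠ 0` at `t`. -/
def ParamGenerates (φ : RatParam) (d : ℝ) (t : ℂ) (q : Fin 2 → ℂ) : Prop :=
  Polynomial.aeval t φ.W ≠ 0 ∧
  ∃ s : ℂ, s ≠ 0 ∧
    s ^ 2 = Polynomial.aeval t φ.U ^ 2 + Polynomial.aeval t φ.V ^ 2 ∧
    q = ![φ.point t 0 + d * Polynomial.aeval t φ.V / s,
          φ.point t 1 - d * Polynomial.aeval t φ.U / s]

/-- The offset to the curve at distance `d`. -/
def offset (φ : RatParam) (d : ℝ) : Set (Fin 2 → ℂ) :=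
  zariskiClosure {q | ∃ t : ℂ, φ.ParamGenerates d t q}

/-- The points `φ(t)` of the curve that generate `q`. -/
def generators (φ : RatParam) (d : ℝ) (q : Fin 2 → ℂ) : Set (Fin 2 → ℂ) :=
  {p | ∃ t : ℂ, φ.ParamGenerates d t q ∧ p = φ.point t}

/-- A simple component of the offset: almost every point is generated by just one point. -/
def IsSimpleComponent (φ : RatParam) (d : ℝ) (Z : Set (Fin 2 → ℂ)) : Prop :=
  IsIrredComponent (φ.offset d) Z ∧ {q | q ∈ Z ∧ (φ.generators d q).encard ≠ 1}.Finite

/-- A special component of the offset: a component that is not simple. -/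
def IsSpecialComponent (φ : RatParam) (d : ℝ) (Z : Set (Fin 2 → ℂ)) : Prop :=
  IsIrredComponent (φ.offset d) Z ∧ ¬ φ.IsSimpleComponent d Z

/-- The offset has a special component. -/
def HasSpecialComponent (φ : RatParam) (d : ℝ) : Prop :=
  ∃ Z, φ.IsSpecialComponent d Z

/-- A polynomial in `t` with rational coefficients, as an element of `ℂ[x, y][t]`. -/
def liftT (a : Polynomial ℚ) : Polynomial PolyXY :=
  a.map (algebraMap ℚ PolyXY)

/-- The variable `x` in `ℂ[x, y][t]`. -/
def xT : Polynomial PolyXY := Polynomial.C (MvPolynomial.X 0)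

/-- The variable `y` in `ℂ[x, y][t]`. -/
def yT : Polynomial PolyXY := Polynomial.C (MvPolynomial.X 1)

/-- The normal line at `φ(t)`: `U (W x - X) + V (W y - Y)`. -/
def normalPoly (φ : RatParam) : Polynomial PolyXY :=
  liftT φ.U * (liftT φ.W * xT - liftT φ.X) + liftT φ.V * (liftT φ.W * yT - liftT φ.Y)

/-- The circle of radius `d` centred at `φ(t)`: `(W x - X)² + (W y - Y)² - d² W²`. -/
def circlePoly (φ : RatParam) (d : ℝ) : Polynomial PolyXY :=
  (liftT φ.W * xT - liftT φ.X) ^ 2 + (liftT φ.W * yT - liftT φ.Y) ^ 2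
    - Polynomial.C (MvPolynomial.C ((d : ℂ) ^ 2)) * liftT φ.W ^ 2

/-- `H = F * G`, where `{F = 0}` is the offset and `G` is a product of linear factors. -/
def IsOffsetFactorization (φ : RatParam) (d : ℝ) (H F G : PolyXY) : Prop :=
  H = F * G ∧ planeCurve F = φ.offset d ∧
    ∃ L : Multiset PolyXY, (∀ l ∈ L, l.totalDegree = 1) ∧ G = L.prod

/-- `f₁`, `f₂` are irreducible equations of the components of the offset. If there is only one
component, then `f₂ = 1`; if there is a special component, it is represented by `f₂`. -/
def AreComponentEquations (φ : RatParam) (d : ℝ) (f₁ f₂ : PolyXY) : Prop :=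
  Irreducible f₁ ∧ (Irreducible f₂ ∨ f₂ = 1) ∧ planeCurve f₁ ≠ planeCurve f₂ ∧
    planeCurve f₁ ∪ planeCurve f₂ = φ.offset d ∧
    ∀ Z, φ.IsSpecialComponent d Z → planeCurve f₂ = Z

end

end RatParam

/-!
The offset points are parametrized by the points `(t, s)` of the double cover `s² = U² + V²` of
the parameter line: `(t, s)` generates `φ(t) + d (V, -U) / s`. A point lies on the normal line and
on the circle of a general parameter `t` exactly when it is one of the two points generated over
`t`, so the factors of `H = Res_t(P, Q)` that are not linear are the equations of curves containing
infinitely many generated points. Each such factor vanishes at one of the two points generated over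
almost every `t`, while two different factors have only finitely many common zeros, so there are at
most two of them.

The multiplicity of a factor `f` is found by restricting `H` to a transversal line through a general
point `p` of `f = 0`. Over the power series ring of that line, every parameter generating `p` lifts
to a simple root of `P`, at which `Q` vanishes to order one; hence the multiplicity is the number
of parameters generating `p`, that is, `n` times the number of points of the curve generating `p`.
Two points generating `p` have opposite unit normals, so this number is 1 or 2. If it were 2 on both
factors, translation by a fixed nonzero multiple of a unit normal would act on the finitely many
points of the curve that have a given unit normal, which is absurd.
-/

open MvPolynomial
open scoped Topology

section GeneralPolynomials

theorem isCoprime_map_fractionRing_of_irreducible {R : Type*} [CommRing R] [IsDomain R]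
    [UniqueFactorizationMonoid R] {f g : Polynomial R} (hf : Irreducible f)
    (hdeg : f.natDegree ≠ 0) (hfg : ¬ f ∣ g) :
    IsCoprime (f.map (algebraMap R (FractionRing R))) (g.map (algebraMap R (FractionRing R))) := by
  have hinj := IsFractionRing.injective R (FractionRing R)
  rw [((hf.isPrimitive hdeg).irreducible_iff_irreducible_map_fraction_map.1 hf).coprime_iff_not_dvd]
  rintro ⟨h, hh⟩
  obtain ⟨b, hb, hbh⟩ := IsLocalization.integerNormalization_spec (nonZeroDivisors R) h
  have hb0 : b ≠ 0 := nonZeroDivisors.ne_zero hb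
  have hbg : Polynomial.C b * g
      = f * IsLocalization.integerNormalization (nonZeroDivisors R) h := by
    apply Polynomial.map_injective _ hinj
    rw [Polynomial.map_mul, Polynomial.map_mul, hbh, hh, Polynomial.map_C, Algebra.smul_def,
      Polynomial.algebraMap_apply]
    ring
  rcases hf.prime.dvd_or_dvd ⟨_, hbg⟩ with hfb | hfg'
  · exact hdeg (by simpa using Polynomial.natDegree_le_of_dvd hfb (by simpa using hb0))
  · exact hfg hfg'

theorem resultant_ne_zero_of_irreducible {R : Type*} [CommRing R] [IsDomain R]
    [UniqueFactorizationMonoid R] {f g : Polynomial R} (hf : Irreducible f)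
    (hdeg : f.natDegree ≠ 0) (hfg : ¬ f ∣ g) : f.resultant g ≠ 0 := by
  intro h
  have hinj := IsFractionRing.injective R (FractionRing R)
  have hmap := Polynomial.resultant_map_map f g f.natDegree g.natDegree
    (algebraMap R (FractionRing R))
  rw [h, map_zero] at hmap
  refine (Polynomial.resultant_eq_zero_iff.1 ?_).2
    (isCoprime_map_fractionRing_of_irreducible hf hdeg hfg)
  rw [Polynomial.natDegree_map_eq_of_injective hinj, Polynomial.natDegree_map_eq_of_injective hinj,
    hmap]

theorem exists_mul_add_mul_eq_C_of_irreducible {R : Type*} [CommRing R] [IsDomain R]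
    [UniqueFactorizationMonoid R] {f g : Polynomial R} (hf : Irreducible f) (hfg : ¬ f ∣ g) :
    ∃ (a b : Polynomial R) (r : R), r ≠ 0 ∧ f * a + g * b = Polynomial.C r := by
  rcases eq_or_ne f.natDegree 0 with hdeg | hdeg
  · obtain ⟨r, rfl⟩ := Polynomial.natDegree_eq_zero.1 hdeg
    exact ⟨1, 0, r, by simpa using hf.ne_zero, by simp⟩
  · obtain ⟨a, b, -, -, h⟩ := Polynomial.exists_mul_add_mul_eq_C_resultant f g le_rfl le_rfl
      (Or.inl hdeg)
    exact ⟨a, b, _, resultant_ne_zero_of_irreducible hf hdeg hfg, h⟩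

theorem finite_zeros_of_unique {σ K : Type*} [Unique σ] [Field K] {r : MvPolynomial σ K}
    (hr : r ≠ 0) : {p : σ → K | eval p r = 0}.Finite := by
  have heval : ∀ p : σ → K, (Polynomial.aeval (p default)).comp
      (uniqueAlgEquiv K σ : MvPolynomial σ K →ₐ[K] Polynomial K) = aeval p := fun p =>
    algHom_ext fun i => by simp [X, Unique.eq_default i, eval_monomial]
  have hr' : uniqueAlgEquiv K σ r ≠ 0 := (map_ne_zero_iff _ (uniqueAlgEquiv K σ).injective).2 hr
  refine ((uniqueAlgEquiv K σ r).rootSet_finite K).preimage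
    (f := fun p : σ → K => p default) (fun p _ q _ h => ?_) |>.subset fun p hp => ?_
  · exact funext fun i => Unique.eq_default i ▸ h
  · exact Polynomial.mem_rootSet.2 ⟨hr', (DFunLike.congr_fun (heval p) r).trans hp⟩

variable {K : Type*} [Field K] {f g : MvPolynomial (Fin 2) K}

theorem finite_tail_image_common_zeros (hf : Irreducible f) (hfg : ¬ f ∣ g) :
    (Fin.tail '' {p : Fin 2 → K | eval p f = 0 ∧ eval p g = 0}).Finite := by
  let e := finSuccEquiv K 1
  obtain ⟨a, b, r, hr, hab⟩ := exists_mul_add_mul_eq_C_of_irreducible (f := e f) (g := e g)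
    ((MulEquiv.irreducible_iff e).2 hf) (by rwa [map_dvd_iff])
  refine (finite_zeros_of_unique hr).subset ?_
  rintro _ ⟨p, ⟨hpf, hpg⟩, rfl⟩
  have heval : ∀ h, eval p h = Polynomial.eval (p 0) ((e h).map (eval (Fin.tail p))) := by
    intro h
    rw [← eval_eq_eval_mv_eval', Fin.cons_self_tail]
  rw [heval] at hpf hpg
  simpa [hpf, hpg] using
    (congrArg (fun q => Polynomial.eval (p 0) (q.map (eval (Fin.tail p)))) hab).symm

theorem finite_common_zeros (hf : Irreducible f) (hfg : ¬ f ∣ g) :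
    {p : Fin 2 → K | eval p f = 0 ∧ eval p g = 0}.Finite := by
  let swap : MvPolynomial (Fin 2) K ≃ₐ[K] _ := renameEquiv K (Equiv.swap (0 : Fin 2) 1)
  have hy := finite_tail_image_common_zeros hf hfg
  have hx := finite_tail_image_common_zeros (f := swap f) (g := swap g)
    ((MulEquiv.irreducible_iff swap).2 hf) (by rwa [map_dvd_iff])
  refine Set.Finite.subset ((hx.prod hy).preimage (f := fun p : Fin 2 → K =>
    (Fin.tail (p ∘ Equiv.swap (0 : Fin 2) 1), Fin.tail p)) fun p _ q _ hpq => ?_)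
    fun p hp => ⟨⟨p ∘ Equiv.swap (0 : Fin 2) 1, ?_, rfl⟩, ⟨p, hp, rfl⟩⟩
  rotate_left
  · have hinv : (p ∘ Equiv.swap (0 : Fin 2) 1) ∘ Equiv.swap (0 : Fin 2) 1 = p := by
      ext i
      simp
    simpa only [swap, renameEquiv_apply, Set.mem_ofPred_eq, eval_rename, hinv] using hp
  · obtain ⟨h0, h1⟩ := Prod.mk.inj hpq
    ext i
    fin_cases i
    · simpa [Fin.tail] using congrFun h0 0
    · simpa [Fin.tail] using congrFun h1 0

theorem dvd_of_infinite_common_zeros (hf : Irreducible f)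
    (h : {p : Fin 2 → K | eval p f = 0 ∧ eval p g = 0}.Infinite) : f ∣ g :=
  not_not.1 fun hfg => h (finite_common_zeros hf hfg)

end GeneralPolynomials

section PartialDerivatives

variable {σ R : Type*} [CommSemiring R]

theorem totalDegree_pderiv_lt (i : σ) {f : MvPolynomial σ R} (h : pderiv i f ≠ 0) :
    (pderiv i f).totalDegree < f.totalDegree := by
  obtain ⟨m, hm, hdeg⟩ := Finset.exists_mem_eq_sup (pderiv i f).support
    (support_nonempty.2 h) (fun s => s.sum fun _ e => e)
  have hdeg' : (pderiv i f).totalDegree = m.sum fun _ e => e := hdeg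
  rw [mem_support_iff, coeff_pderiv] at hm
  have hle := le_totalDegree (mem_support_iff.2 (left_ne_zero_of_mul hm))
  rw [Finsupp.sum_add_index' (by simp) (by simp), Finsupp.sum_single_index rfl] at hle
  omega

theorem eq_C_of_forall_pderiv_eq_zero [NoZeroDivisors R] [CharZero R] {f : MvPolynomial σ R}
    (h : ∀ i, pderiv i f = 0) : f = C (coeff 0 f) := by
  classical
  ext m
  rw [coeff_C]
  split_ifs with hm
  · rw [hm]
  · obtain ⟨i, hi⟩ := Finsupp.ne_iff.1 (Ne.symm hm)
    have hmi : Finsupp.single i 1 ≤ m :=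
      Finsupp.single_le_iff.2 (Nat.one_le_iff_ne_zero.2 hi)
    have hcoeff := coeff_pderiv (i := i) f (m - Finsupp.single i 1)
    rw [h i, coeff_zero, tsub_add_cancel_of_le hmi] at hcoeff
    exact (mul_eq_zero.1 hcoeff.symm).resolve_right (by norm_cast)

theorem exists_not_dvd_pderiv {K : Type*} [Field K] [CharZero K] {f : MvPolynomial σ K}
    (hf : Irreducible f) : ∃ i, ¬ f ∣ pderiv i f := by
  by_contra! h
  have hzero : ∀ i, pderiv i f = 0 := fun i => by
    by_contra hne
    exact (totalDegree_pderiv_lt i hne).not_ge (totalDegree_le_of_dvd_of_isDomain (h i) hne)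
  have hC := eq_C_of_forall_pderiv_eq_zero hzero
  refine hf.not_isUnit (hC ▸ (isUnit_iff_ne_zero.2 fun h0 => hf.ne_zero ?_).map C)
  rw [hC, h0, map_zero]

end PartialDerivatives

/-! ### Plane curves -/

section PlaneCurves

variable {f g : PolyXY} {S Z : Set (Fin 2 → ℂ)}

theorem mem_zariskiClosure {p : Fin 2 → ℂ} :
    p ∈ zariskiClosure S ↔ ∀ g : PolyXY, (∀ z ∈ S, eval z g = 0) → eval p g = 0 :=
  Iff.rfl

theorem subset_zariskiClosure (S : Set (Fin 2 → ℂ)) : S ⊆ zariskiClosure S :=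
  fun _ hp _ hg => hg _ hp

theorem zariskiClosure_subset_planeCurve (h : S ⊆ planeCurve f) :
    zariskiClosure S ⊆ planeCurve f :=
  fun _ hp => mem_zariskiClosure.1 hp f fun _ hz => h hz

theorem zariskiClosure_planeCurve (f : PolyXY) : zariskiClosure (planeCurve f) = planeCurve f :=
  (zariskiClosure_subset_planeCurve subset_rfl).antisymm (subset_zariskiClosure _)

theorem zariskiClosure_finite (h : S.Finite) : (zariskiClosure S).Finite := by
  refine (Set.Finite.pi fun i : Fin 2 => h.image fun p => p i).subset fun p hp i _ => ?_
  have hprod := mem_zariskiClosure.1 hp (∏ q ∈ h.toFinset, (X i - C (q i))) fun z hz => by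
    rw [map_prod]
    exact Finset.prod_eq_zero (h.mem_toFinset.2 hz) (by simp)
  rw [map_prod, Finset.prod_eq_zero_iff] at hprod
  obtain ⟨q, hq, hqp⟩ := hprod
  exact ⟨q, h.mem_toFinset.1 hq, (sub_eq_zero.1 (by simpa using hqp)).symm⟩

theorem planeCurve_mul (f g : PolyXY) : planeCurve (f * g) = planeCurve f ∪ planeCurve g := by
  ext p
  simp [planeCurve]

theorem planeCurve_one : planeCurve 1 = ∅ := by
  ext p
  simp [planeCurve]

theorem planeCurve_C_mul {c : ℂ} (hc : c ≠ 0) (f : PolyXY) :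
    planeCurve (C c * f) = planeCurve f := by
  ext p
  simp [planeCurve, hc]

theorem planeCurve_pow (f : PolyXY) {n : ℕ} (hn : n ≠ 0) :
    planeCurve (f ^ n) = planeCurve f := by
  ext p
  simp [planeCurve, hn]

theorem planeCurve_subset_of_dvd (h : f ∣ g) : planeCurve f ⊆ planeCurve g := by
  obtain ⟨k, rfl⟩ := h
  rw [planeCurve_mul]
  exact Set.subset_union_left

theorem vanishingIdeal_planeCurve (hf : Irreducible f) :
    vanishingIdeal ℂ (planeCurve f) = Ideal.span {f} := by
  have hzero : planeCurve f = zeroLocus ℂ (Ideal.span {f}) := by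
    ext p
    simp [planeCurve, zeroLocus_span, aeval_eq_eval]
  rw [hzero, vanishingIdeal_zeroLocus_eq_radical]
  exact ((Ideal.span_singleton_prime hf.ne_zero).2 hf.prime).radical

theorem vanishingIdeal_planeCurve_isPrime (hf : Irreducible f) :
    (vanishingIdeal ℂ (planeCurve f)).IsPrime := by
  rw [vanishingIdeal_planeCurve hf, Ideal.span_singleton_prime hf.ne_zero]
  exact hf.prime

theorem dvd_of_planeCurve_subset (hf : Irreducible f) (h : planeCurve f ⊆ planeCurve g) :
    f ∣ g := by
  rw [← Ideal.mem_span_singleton, ← vanishingIdeal_planeCurve hf]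
  exact fun p hp => h hp

theorem associated_iff_planeCurve_eq (hf : Irreducible f) (hg : Irreducible g) :
    Associated f g ↔ planeCurve f = planeCurve g :=
  ⟨fun h => (planeCurve_subset_of_dvd h.dvd).antisymm (planeCurve_subset_of_dvd h.symm.dvd),
    fun h => hf.associated_of_dvd hg (dvd_of_planeCurve_subset hf h.subset)⟩

theorem irreducible_X_zero_sub_C (a : ℂ) : Irreducible (X 0 - C a : PolyXY) := by
  have heq : finSuccEquiv ℂ 1 (X 0 - C a) = Polynomial.X - Polynomial.C (C a) := by
    rw [map_sub, finSuccEquiv_X_zero]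
    exact congrArg _ ((finSuccEquiv ℂ 1).commutes a)
  rw [← MulEquiv.irreducible_iff (finSuccEquiv ℂ 1), heq]
  exact Polynomial.irreducible_X_sub_C _

theorem planeCurve_infinite (hf : Irreducible f) : (planeCurve f).Infinite := by
  intro hfin
  have hdvd : f ∣ ∏ p ∈ hfin.toFinset, (X 0 - C (p 0)) :=
    dvd_of_planeCurve_subset hf fun p hp => by
      rw [planeCurve, Set.mem_ofPred_eq, map_prod]
      exact Finset.prod_eq_zero (hfin.mem_toFinset.2 hp) (by simp)
  obtain ⟨p, -, hp⟩ := (hf.prime.dvd_finsetProd_iff _).1 hdvd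
  have hline := irreducible_X_zero_sub_C (p 0)
  rw [(associated_iff_planeCurve_eq hf hline).1 (hf.associated_of_dvd hline hp)] at hfin
  refine Set.infinite_of_injective_forall_mem (f := fun y : ℂ => ![p 0, y]) ?_ ?_ hfin
  · exact fun y z h => by simpa using congrFun h 1
  · exact fun y => by simp [planeCurve]

theorem planeCurve_subset_zariskiClosure (hf : Irreducible f) (h : (planeCurve f ∩ S).Infinite) :
    planeCurve f ⊆ zariskiClosure S := fun _ hp => mem_zariskiClosure.2 fun _ hg =>
  planeCurve_subset_of_dvd
    (dvd_of_infinite_common_zeros hf (h.mono fun z hz => ⟨hz.1, hg z hz.2⟩)) hp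

theorem finite_singular_points (hf : Irreducible f) :
    {p | p ∈ planeCurve f ∧ ∀ i, eval p (pderiv i f) = 0}.Finite := by
  obtain ⟨i, hi⟩ := exists_not_dvd_pderiv hf
  exact (finite_common_zeros hf hi).subset fun p hp => ⟨hp.1, hp.2 i⟩

theorem exists_irreducible_factor_mem_vanishingIdeal (hg : g ≠ 0)
    (hprime : (vanishingIdeal ℂ Z).IsPrime) (hZ : Z ⊆ planeCurve g) :
    ∃ f, Irreducible f ∧ f ∣ g ∧ Z ⊆ planeCurve f := by
  obtain ⟨F, hF, hFg⟩ := UniqueFactorizationMonoid.exists_prime_factors g hg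
  have hmem : F.prod ∈ vanishingIdeal ℂ Z :=
    (vanishingIdeal ℂ Z).mem_of_dvd hFg.symm.dvd fun p hp => hZ hp
  rw [hprime.multiset_prod_mem_iff_exists_mem] at hmem
  obtain ⟨f, hf, hfZ⟩ := hmem
  exact ⟨f, (hF f hf).irreducible, (Multiset.dvd_prod hf).trans hFg.dvd, fun p hp => hfZ p hp⟩

theorem isIrredComponent_planeCurve (hf : Irreducible f) (hg : g ≠ 0) (hfg : f ∣ g) :
    IsIrredComponent (planeCurve g) (planeCurve f) := by
  refine ⟨⟨zariskiClosure_planeCurve f, vanishingIdeal_planeCurve_isPrime hf,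
    planeCurve_subset_of_dvd hfg⟩, ?_⟩
  rintro Z ⟨-, hprime, hZg⟩ hfZ
  obtain ⟨h, hh, -, hZh⟩ := exists_irreducible_factor_mem_vanishingIdeal hg hprime hZg
  have hass := hf.associated_of_dvd hh (dvd_of_planeCurve_subset hf (hfZ.trans hZh))
  exact hZh.trans ((associated_iff_planeCurve_eq hf hh).1 hass).superset

theorem IsIrredComponent.exists_irreducible_factor (hg : g ≠ 0)
    (hZ : IsIrredComponent (planeCurve g) Z) :
    ∃ f, Irreducible f ∧ f ∣ g ∧ Z = planeCurve f := by
  obtain ⟨⟨-, hprime, hsub⟩, hmax⟩ := hZ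
  obtain ⟨f, hf, hfg, hZf⟩ := exists_irreducible_factor_mem_vanishingIdeal hg hprime hsub
  exact ⟨f, hf, hfg, hZf.antisymm (hmax ⟨zariskiClosure_planeCurve f,
    vanishingIdeal_planeCurve_isPrime hf, planeCurve_subset_of_dvd hfg⟩ hZf)⟩

end PlaneCurves

section CommonRoots

theorem resultant_eq_zero_iff_exists_common_root {K : Type*} [Field K] [IsAlgClosed K]
    {f g : Polynomial K} (hf : f ≠ 0) {n : ℕ} (hg : g.natDegree ≤ n) :
    Polynomial.resultant f g f.natDegree n = 0 ↔ ∃ z, f.eval z = 0 ∧ g.eval z = 0 := by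
  rw [Polynomial.resultant_eq_prod_eval f g n hg (IsAlgClosed.splits f), mul_eq_zero,
    or_iff_right (pow_ne_zero _ (Polynomial.leadingCoeff_ne_zero.2 hf)), Multiset.prod_eq_zero_iff,
    Multiset.mem_map]
  simp only [Polynomial.mem_roots hf, Polynomial.IsRoot.def]

theorem exists_eq_C_mul_of_wronskian_eq_zero {K : Type*} [Field K] [CharZero K]
    {p q : Polynomial K} (hq : q ≠ 0) (h : Polynomial.wronskian p q = 0) :
    ∃ c : K, p = Polynomial.C c * q := by
  obtain ⟨a, b, g, hab, rfl, rfl⟩ := UniqueFactorizationMonoid.exists_reduced_factors' p q hq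
  have hg : g ≠ 0 := left_ne_zero_of_mul hq
  have hcoprime : IsCoprime a b := hab.isCoprime
  have hfactor : Polynomial.wronskian (g * a) (g * b) = g ^ 2 * Polynomial.wronskian a b := by
    simp only [Polynomial.wronskian, Polynomial.derivative_mul]
    ring
  obtain ⟨ha, hb⟩ := hcoprime.wronskian_eq_zero_iff.1
    ((mul_eq_zero.1 (hfactor.symm.trans h)).resolve_left (pow_ne_zero 2 hg))
  obtain ⟨α, rfl⟩ := Polynomial.natDegree_eq_zero.1 (Polynomial.derivative_eq_zero.1 ha)
  obtain ⟨β, rfl⟩ := Polynomial.natDegree_eq_zero.1 (Polynomial.derivative_eq_zero.1 hb)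
  have hβ : β ≠ 0 := Polynomial.C_ne_zero.1 (right_ne_zero_of_mul hq)
  refine ⟨α / β, ?_⟩
  rw [mul_left_comm, ← Polynomial.C_mul, div_mul_cancel₀ _ hβ]

end CommonRoots

/-! ### Resultants over power series -/

section PowerSeriesResultant

variable {K : Type*} [Field K]

theorem constantCoeff_eval_C (p : Polynomial (PowerSeries K)) (z : K) :
    PowerSeries.constantCoeff (p.eval (PowerSeries.C z)) =
      (p.map PowerSeries.constantCoeff).eval z := by
  rw [Polynomial.eval_map, ← Polynomial.eval₂_id, Polynomial.hom_eval₂, RingHom.comp_id,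
    PowerSeries.constantCoeff_C]

theorem isUnit_powerSeries_iff {a : PowerSeries K} :
    IsUnit a ↔ PowerSeries.constantCoeff a ≠ 0 :=
  PowerSeries.isUnit_iff_constantCoeff.trans isUnit_iff_ne_zero

theorem exists_powerSeries_root_lift {p : Polynomial (PowerSeries K)}
    (hlc : PowerSeries.constantCoeff p.leadingCoeff ≠ 0) {z : K}
    (hz : (p.map PowerSeries.constantCoeff).eval z = 0)
    (hz' : (p.derivative.map PowerSeries.constantCoeff).eval z ≠ 0) :
    ∃ τ : PowerSeries K, PowerSeries.constantCoeff τ = z ∧ p.eval τ = 0 := by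
  obtain ⟨u, hu⟩ : IsUnit p.leadingCoeff := isUnit_powerSeries_iff.2 hlc
  have hmonic : (Polynomial.C (↑u⁻¹ : PowerSeries K) * p).Monic :=
    Polynomial.monic_C_mul_of_mul_leadingCoeff_eq_one (by rw [← hu, Units.inv_mul])
  obtain ⟨τ, hτ, hτz⟩ := HenselianRing.is_henselian
    (I := Ideal.span {(PowerSeries.X : PowerSeries K)}) _ hmonic (PowerSeries.C z)
    (by rw [Ideal.mem_span_singleton, PowerSeries.X_dvd_iff, Polynomial.eval_mul, map_mul,
      constantCoeff_eval_C p, hz, mul_zero])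
    (by
      rw [Polynomial.derivative_C_mul, Polynomial.eval_mul, Polynomial.eval_C]
      refine (u⁻¹.isUnit.mul (isUnit_powerSeries_iff.2 ?_)).map _
      rwa [constantCoeff_eval_C])
  refine ⟨τ, ?_, ?_⟩
  · rw [Ideal.mem_span_singleton, PowerSeries.X_dvd_iff, map_sub,
      PowerSeries.constantCoeff_C] at hτz
    exact sub_eq_zero.1 hτz
  · rw [Polynomial.IsRoot.def, Polynomial.eval_mul, Polynomial.eval_C] at hτ
    exact (Units.mul_right_eq_zero _).1 hτ

theorem prod_X_sub_C_dvd_of_constantCoeff_injOn {ι : Type*} {s : Finset ι}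
    {τ : ι → PowerSeries K} {p : Polynomial (PowerSeries K)}
    (hinj : Set.InjOn (fun i => PowerSeries.constantCoeff (τ i)) s)
    (hroot : ∀ i ∈ s, p.eval (τ i) = 0) :
    (∏ i ∈ s, (Polynomial.X - Polynomial.C (τ i))) ∣ p := by
  refine Finset.prod_dvd_of_coprime (fun i hi j hj hij => ?_)
    fun i hi => Polynomial.dvd_iff_isRoot.2 (hroot i hi)
  refine Polynomial.isCoprime_X_sub_C_of_isUnit_sub (isUnit_powerSeries_iff.2 ?_)
  rw [map_sub, sub_ne_zero]
  exact fun h => hij (hinj hi hj h)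

theorem order_resultant_prod_X_sub_C {ι : Type*} (s : Finset ι) (τ : ι → PowerSeries K)
    {q : Polynomial (PowerSeries K)} {k : ℕ} (hq : q.natDegree ≤ k) :
    (Polynomial.resultant (∏ i ∈ s, (Polynomial.X - Polynomial.C (τ i))) q
      (∏ i ∈ s, (Polynomial.X - Polynomial.C (τ i))).natDegree k).order =
      ∑ i ∈ s, (q.eval (τ i)).order := by
  rw [Polynomial.resultant_prod_left _ _ _ _ (by simp) hq, PowerSeries.order_prod]
  exact Finset.sum_congr rfl fun i _ => by
    rw [Polynomial.natDegree_X_sub_C, Polynomial.resultant_X_sub_C_left _ _ _ hq]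

theorem constantCoeff_resultant_ne_zero [IsAlgClosed K] {p q : Polynomial (PowerSeries K)} {k : ℕ}
    (hlc : PowerSeries.constantCoeff p.leadingCoeff ≠ 0) (hq : q.natDegree ≤ k)
    (hroot : ∀ z, (p.map PowerSeries.constantCoeff).eval z = 0 →
      (q.map PowerSeries.constantCoeff).eval z ≠ 0) :
    PowerSeries.constantCoeff (Polynomial.resultant p q p.natDegree k) ≠ 0 := by
  have hdeg : (p.map (PowerSeries.constantCoeff (R := K))).natDegree = p.natDegree :=
    Polynomial.natDegree_map_of_leadingCoeff_ne_zero _ hlc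
  have hmap : p.map (PowerSeries.constantCoeff (R := K)) ≠ 0 := fun h =>
    hlc (by simpa using congrArg (fun r => Polynomial.coeff r p.natDegree) h)
  rw [← Polynomial.resultant_map_map, ← hdeg, Ne,
    resultant_eq_zero_iff_exists_common_root hmap (Polynomial.natDegree_map_le.trans hq)]
  exact fun ⟨z, hp, hq⟩ => hroot z hp hq

theorem order_resultant_eq_card [IsAlgClosed K] {p q : Polynomial (PowerSeries K)} {k : ℕ}
    (hlc : PowerSeries.constantCoeff p.leadingCoeff ≠ 0) (hq : q.natDegree ≤ k) (Z : Finset K)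
    (hZ : ∀ z, z ∈ Z ↔ (p.map PowerSeries.constantCoeff).eval z = 0 ∧
      (q.map PowerSeries.constantCoeff).eval z = 0)
    (hsimple : ∀ z ∈ Z, (p.derivative.map PowerSeries.constantCoeff).eval z ≠ 0)
    (horder : ∀ z ∈ Z, ∀ τ : PowerSeries K, PowerSeries.constantCoeff τ = z → p.eval τ = 0 →
      (q.eval τ).order = 1) :
    (Polynomial.resultant p q p.natDegree k).order = Z.card := by
  choose! τ hτz hτ using fun z (hz : z ∈ Z) =>
    exists_powerSeries_root_lift hlc ((hZ z).1 hz).1 (hsimple z hz)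
  obtain ⟨b, hb⟩ := prod_X_sub_C_dvd_of_constantCoeff_injOn
    (fun z hz w hw h => (hτz z hz).symm.trans (h.trans (hτz w hw))) hτ
  set A := ∏ z ∈ Z, (Polynomial.X - Polynomial.C (τ z)) with hA
  have hAmonic : A.Monic := Polynomial.monic_prod_of_monic _ _ fun z _ =>
    Polynomial.monic_X_sub_C _
  have hlcb : PowerSeries.constantCoeff b.leadingCoeff ≠ 0 := by
    rwa [hb, Polynomial.leadingCoeff_mul, hAmonic.leadingCoeff, one_mul] at hlc
  have hb0 : b ≠ 0 := by
    rintro rfl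
    simp at hlcb
  have hbq : ∀ z, (b.map PowerSeries.constantCoeff).eval z = 0 →
      (q.map PowerSeries.constantCoeff).eval z ≠ 0 := by
    intro z hbz hqz
    have hzZ : z ∈ Z := (hZ z).2 ⟨by simp [hb, hbz], hqz⟩
    have hAz : (A.map (PowerSeries.constantCoeff (R := K))).eval z = 0 := by
      rw [hA, Polynomial.map_prod, Polynomial.eval_prod]
      exact Finset.prod_eq_zero hzZ (by simp [hτz z hzZ])
    exact hsimple z hzZ (by simp [hb, Polynomial.derivative_mul, hbz, hAz])
  have hunit := PowerSeries.order_zero_of_unit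
    (isUnit_powerSeries_iff.2 (constantCoeff_resultant_ne_zero hlcb hq hbq))
  rw [hb, Polynomial.natDegree_mul hAmonic.ne_zero hb0, Polynomial.resultant_mul_left _ _ _ _ hq,
    PowerSeries.order_mul, hunit, add_zero, order_resultant_prod_X_sub_C _ _ hq,
    Finset.sum_congr rfl fun z hz => horder z hz _ (hτz z hz) (hτ z hz)]
  simp

end PowerSeriesResultant

section Evaluation

/-- The value at the point `(p, t)` of a polynomial in the coordinates of the plane and `t`, the
latter being the outer variable as in `ℂ[x, y][t]`. -/
noncomputable def evalXYT {σ R : Type*} [CommSemiring R] (g : Polynomial (MvPolynomial σ R))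
    (p : σ → R) (t : R) : R :=
  (g.map (eval p)).eval t

variable {σ R : Type*} [CommSemiring R] (g h : Polynomial (MvPolynomial σ R)) (p : σ → R) (t : R)

theorem evalXYT_add : evalXYT (g + h) p t = evalXYT g p t + evalXYT h p t := by
  simp only [evalXYT, Polynomial.map_add, Polynomial.eval_add]

theorem evalXYT_mul : evalXYT (g * h) p t = evalXYT g p t * evalXYT h p t := by
  simp only [evalXYT, Polynomial.map_mul, Polynomial.eval_mul]

theorem evalXYT_C (f : MvPolynomial σ R) : evalXYT (Polynomial.C f) p t = eval p f := by
  simp only [evalXYT, Polynomial.map_C, Polynomial.eval_C]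

end Evaluation

/-- A complex rational parametrization `(X / W, Y / W)` together with a distance `d`, whose image
lies on no line and on no circle of radius `d`. -/
structure OffsetData where
  X : Polynomial ℂ
  Y : Polynomial ℂ
  W : Polynomial ℂ
  d : ℂ
  W_ne_zero : W ≠ 0
  d_ne_zero : d ≠ 0
  no_line : ∀ a b c : ℂ, Polynomial.C a * X + Polynomial.C b * Y = Polynomial.C c * W →
    a = 0 ∧ b = 0
  no_circle : ∀ a b : ℂ, (X - Polynomial.C a * W) ^ 2 + (Y - Polynomial.C b * W) ^ 2 ≠
    Polynomial.C (d ^ 2) * W ^ 2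

namespace OffsetData

noncomputable section

variable (D : OffsetData)

/-- `U = X' W - X W'`, the first component of the velocity `(X / W, Y / W)'` times `W²`. -/
def U : Polynomial ℂ :=
  Polynomial.derivative D.X * D.W - D.X * Polynomial.derivative D.W

/-- `V = Y' W - Y W'`, the second component of the velocity `(X / W, Y / W)'` times `W²`. -/
def V : Polynomial ℂ :=
  Polynomial.derivative D.Y * D.W - D.Y * Polynomial.derivative D.W

/-- `S = U² + V²`, the squared speed times `W⁴`. -/
def S : Polynomial ℂ := D.U ^ 2 + D.V ^ 2

/-- `(t, s)` is a point of the double cover `s² = U² + V²` of the parameter line at which the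
offset point is defined: `s` chooses one of the two normal directions at `t`. -/
def IsCoverPoint (t s : ℂ) : Prop :=
  D.W.eval t ≠ 0 ∧ s ≠ 0 ∧ s ^ 2 = D.S.eval t

/-- The first coordinate of the offset point of `(t, s)`. -/
def offsetX (t s : ℂ) : ℂ := D.X.eval t / D.W.eval t + D.d * D.V.eval t / s

/-- The second coordinate of the offset point of `(t, s)`. -/
def offsetY (t s : ℂ) : ℂ := D.Y.eval t / D.W.eval t - D.d * D.U.eval t / s

/-- The offset point of the cover point `(t, s)`. -/
def offsetPoint (t s : ℂ) : Fin 2 → ℂ := ![D.offsetX t s, D.offsetY t s]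

/-- The point of the parametrized curve with parameter `t`, meaningful when `W(t) ≠ 0`. -/
def point (t : ℂ) : Fin 2 → ℂ := ![D.X.eval t / D.W.eval t, D.Y.eval t / D.W.eval t]

theorem eq_zero_of_C_mul_U_add_C_mul_V_eq_zero {a b : ℂ}
    (h : Polynomial.C a * D.U + Polynomial.C b * D.V = 0) : a = 0 ∧ b = 0 := by
  obtain ⟨c, hc⟩ := exists_eq_C_mul_of_wronskian_eq_zero
    (p := Polynomial.C a * D.X + Polynomial.C b * D.Y) D.W_ne_zero (by
      simp only [Polynomial.wronskian, Polynomial.derivative_add, Polynomial.derivative_mul,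
        Polynomial.derivative_C]
      simp only [U, V] at h
      linear_combination -h)
  exact D.no_line a b c hc

theorem S_ne_zero : D.S ≠ 0 := by
  intro h
  have hI : Polynomial.C Complex.I ^ 2 = (-1 : Polynomial ℂ) := by
    rw [← Polynomial.C_pow, Complex.I_sq, Polynomial.C_neg, Polynomial.C_1]
  have hfactor : (D.U + Polynomial.C Complex.I * D.V) *
      (D.U + Polynomial.C (-Complex.I) * D.V) = 0 := by
    rw [S] at h
    rw [Polynomial.C_neg]
    linear_combination h - D.V ^ 2 * hI
  have hne : ∀ b, D.U + Polynomial.C b * D.V ≠ 0 := fun b h => one_ne_zero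
    (D.eq_zero_of_C_mul_U_add_C_mul_V_eq_zero (a := 1) (b := b) (by simpa using h)).1
  exact mul_ne_zero (hne _) (hne _) hfactor

section CoverPoints

variable {D} {t s : ℂ}

theorem IsCoverPoint.eval_S_ne_zero (h : D.IsCoverPoint t s) : D.S.eval t ≠ 0 := by
  rw [← h.2.2]
  exact pow_ne_zero 2 h.2.1

theorem IsCoverPoint.neg (h : D.IsCoverPoint t s) : D.IsCoverPoint t (-s) :=
  ⟨h.1, neg_ne_zero.2 h.2.1, by rw [neg_sq, h.2.2]⟩

theorem IsCoverPoint.sq (h : D.IsCoverPoint t s) :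
    s ^ 2 = D.U.eval t ^ 2 + D.V.eval t ^ 2 := by
  rw [h.2.2, S, Polynomial.eval_add, Polynomial.eval_pow, Polynomial.eval_pow]

variable (D)

theorem exists_isCoverPoint (hW : D.W.eval t ≠ 0) (hS : D.S.eval t ≠ 0) :
    ∃ s, D.IsCoverPoint t s := by
  obtain ⟨s, hs⟩ := IsAlgClosed.exists_pow_nat_eq (D.S.eval t) two_pos
  refine ⟨s, hW, ?_, hs⟩
  rintro rfl
  exact hS (by rw [← hs, zero_pow two_ne_zero])

theorem finite_not_exists_isCoverPoint : {t : ℂ | ¬ ∃ s, D.IsCoverPoint t s}.Finite := by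
  refine (Polynomial.finite_setOfPred_isRoot (mul_ne_zero D.W_ne_zero D.S_ne_zero)).subset
    fun t ht => ?_
  by_contra h
  rw [Set.mem_ofPred_eq, Polynomial.IsRoot.def, Polynomial.eval_mul, mul_eq_zero, not_or] at h
  exact ht (D.exists_isCoverPoint h.1 h.2)

theorem exists_isCoverPoint_notMem {T : Set ℂ} (hT : T.Finite) :
    ∃ t s, t ∉ T ∧ D.IsCoverPoint t s := by
  obtain ⟨t, ht⟩ := (hT.union D.finite_not_exists_isCoverPoint).infinite_compl.nonempty
  obtain ⟨htT, htD⟩ := not_or.1 ht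
  obtain ⟨s, hs⟩ := not_not.1 htD
  exact ⟨t, s, htT, hs⟩

-- A parameter that reaches `p` is a root of the equation putting the curve on the circle of
-- radius `d` about `p`.
theorem finite_offsetPoint_eq (p : Fin 2 → ℂ) :
    {t | ∃ s, D.IsCoverPoint t s ∧ D.offsetPoint t s = p}.Finite := by
  refine (Polynomial.finite_setOfPred_isRoot (sub_ne_zero.2 (D.no_circle (p 0) (p 1)))).subset ?_
  rintro t ⟨s, hs, rfl⟩
  have hsq := hs.sq
  obtain ⟨hW, hs0, -⟩ := hs
  simp only [offsetPoint, offsetX, offsetY, Set.mem_ofPred_eq, Polynomial.IsRoot.def,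
    Matrix.cons_val_zero, Matrix.cons_val_one, Polynomial.eval_sub, Polynomial.eval_add,
    Polynomial.eval_mul, Polynomial.eval_pow, Polynomial.eval_C]
  field_simp
  linear_combination (- D.d ^ 2 * D.W.eval t ^ 2) * hsq

theorem finite_offsetPoint_mem {T : Set (Fin 2 → ℂ)} (hT : T.Finite) :
    {t | ∃ s, D.IsCoverPoint t s ∧ D.offsetPoint t s ∈ T}.Finite := by
  refine (hT.biUnion fun p _ => D.finite_offsetPoint_eq p).subset ?_
  rintro t ⟨s, hs, h⟩
  exact Set.mem_biUnion h ⟨s, hs, rfl⟩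

end CoverPoints

section CoverForms

/-- On the double cover, the polynomial `g ∈ ℂ[x, y][t]` becomes `A + B s` after its denominators
are cleared by a power of `W S`. -/
def HasCoverForm (g : Polynomial PolyXY) (A B : Polynomial ℂ) (k : ℕ) : Prop :=
  ∀ t s, D.IsCoverPoint t s →
    (D.W.eval t * D.S.eval t) ^ k * evalXYT g (D.offsetPoint t s) t = A.eval t + B.eval t * s

variable {D} {g h : Polynomial PolyXY} {A B A' B' : Polynomial ℂ} {k l : ℕ}

theorem HasCoverForm.mul (hg : D.HasCoverForm g A B k) (hh : D.HasCoverForm h A' B' l) :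
    D.HasCoverForm (g * h) (A * A' + B * B' * D.S) (A * B' + A' * B) (k + l) := by
  intro t s hs
  simp only [evalXYT_mul, Polynomial.eval_mul, Polynomial.eval_add, pow_add]
  linear_combination (D.W.eval t * D.S.eval t) ^ l * evalXYT h (D.offsetPoint t s) t * hg t s hs +
    (A.eval t + B.eval t * s) * hh t s hs + B.eval t * B'.eval t * hs.2.2

theorem HasCoverForm.add (hg : D.HasCoverForm g A B k) (hh : D.HasCoverForm h A' B' l) :
    D.HasCoverForm (g + h) ((D.W * D.S) ^ l * A + (D.W * D.S) ^ k * A')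
      ((D.W * D.S) ^ l * B + (D.W * D.S) ^ k * B') (k + l) := by
  intro t s hs
  simp only [evalXYT_add, Polynomial.eval_mul, Polynomial.eval_add, Polynomial.eval_pow, pow_add]
  linear_combination (D.W.eval t * D.S.eval t) ^ l * hg t s hs +
    (D.W.eval t * D.S.eval t) ^ k * hh t s hs

variable (D)

theorem hasCoverForm_C_X_zero :
    D.HasCoverForm (Polynomial.C (MvPolynomial.X 0)) (D.X * D.S)
      (Polynomial.C D.d * D.V * D.W) 1 := by
  rintro t s ⟨hW, hs0, hs2⟩
  simp only [evalXYT_C, offsetPoint, offsetX, ← hs2, Polynomial.eval_C, Polynomial.eval_mul,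
    eval_X, Matrix.cons_val_zero]
  field_simp

theorem hasCoverForm_C_X_one :
    D.HasCoverForm (Polynomial.C (MvPolynomial.X 1)) (D.Y * D.S)
      (-Polynomial.C D.d * D.U * D.W) 1 := by
  rintro t s ⟨hW, hs0, hs2⟩
  simp only [evalXYT_C, offsetPoint, offsetY, ← hs2, Polynomial.eval_C, Polynomial.eval_mul,
    eval_X, Matrix.cons_val_one, Matrix.cons_val_fin_one, Polynomial.eval_neg]
  field_simp
  ring

theorem exists_hasCoverForm_C (f : PolyXY) :
    ∃ A B k, D.HasCoverForm (Polynomial.C f) A B k := by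
  induction f using MvPolynomial.induction_on with
  | C a => exact ⟨Polynomial.C a, 0, 0, fun t s _ => by simp [evalXYT_C]⟩
  | add f g hf hg =>
    obtain ⟨A, B, k, hf⟩ := hf
    obtain ⟨A', B', l, hg⟩ := hg
    rw [Polynomial.C_add]
    exact ⟨_, _, _, hf.add hg⟩
  | mul_X f i hf =>
    obtain ⟨A, B, k, hf⟩ := hf
    rw [Polynomial.C_mul]
    fin_cases i
    · exact ⟨_, _, _, hf.mul D.hasCoverForm_C_X_zero⟩
    · exact ⟨_, _, _, hf.mul D.hasCoverForm_C_X_one⟩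

theorem exists_hasCoverForm (g : Polynomial PolyXY) : ∃ A B k, D.HasCoverForm g A B k := by
  induction g using Polynomial.induction_on' with
  | add g h hg hh =>
    obtain ⟨A, B, k, hg⟩ := hg
    obtain ⟨A', B', l, hh⟩ := hh
    exact ⟨_, _, _, hg.add hh⟩
  | monomial n f =>
    obtain ⟨A, B, k, hf⟩ := D.exists_hasCoverForm_C f
    have hX : D.HasCoverForm (Polynomial.X ^ n) (Polynomial.X ^ n) 0 0 :=
      fun t s _ => by simp [evalXYT]
    rw [← Polynomial.C_mul_X_pow_eq_monomial]
    exact ⟨_, _, _, hf.mul hX⟩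

variable {D}

theorem HasCoverForm.eval_eq_zero_iff (hg : D.HasCoverForm g A B k) {t s : ℂ}
    (hs : D.IsCoverPoint t s) :
    evalXYT g (D.offsetPoint t s) t = 0 ↔ A.eval t + B.eval t * s = 0 := by
  rw [← hg t s hs, mul_eq_zero,
    or_iff_right (pow_ne_zero _ (mul_ne_zero hs.1 hs.eval_S_ne_zero))]

theorem HasCoverForm.norm_eq_zero (hg : D.HasCoverForm g A B k)
    (h : {t | ∃ s, D.IsCoverPoint t s ∧ evalXYT g (D.offsetPoint t s) t = 0}.Infinite) :
    A ^ 2 - B ^ 2 * D.S = 0 := by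
  refine Polynomial.eq_zero_of_infinite_isRoot _ (h.mono ?_)
  rintro t ⟨s, hs, hzero⟩
  rw [hg.eval_eq_zero_iff hs] at hzero
  simp only [Set.mem_ofPred_eq, Polynomial.IsRoot.def, Polynomial.eval_sub, Polynomial.eval_mul,
    Polynomial.eval_pow, ← hs.2.2]
  linear_combination (A.eval t - B.eval t * s) * hzero

theorem evalXYT_eq_zero_or_neg_of_infinite {t s : ℂ}
    (h : {t | ∃ s, D.IsCoverPoint t s ∧ evalXYT g (D.offsetPoint t s) t = 0}.Infinite)
    (hs : D.IsCoverPoint t s) :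
    evalXYT g (D.offsetPoint t s) t = 0 ∨ evalXYT g (D.offsetPoint t (-s)) t = 0 := by
  obtain ⟨A, B, k, hg⟩ := D.exists_hasCoverForm g
  have hnorm := congrArg (Polynomial.eval t) (hg.norm_eq_zero h)
  simp only [Polynomial.eval_sub, Polynomial.eval_mul, Polynomial.eval_pow, ← hs.2.2,
    Polynomial.eval_zero] at hnorm
  rw [hg.eval_eq_zero_iff hs, hg.eval_eq_zero_iff hs.neg, ← mul_eq_zero]
  linear_combination hnorm

theorem evalXYT_eq_zero_of_finite_ne_zero {t s : ℂ}
    (h : {t | ∃ s, D.IsCoverPoint t s ∧ evalXYT g (D.offsetPoint t s) t ≠ 0}.Finite)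
    (hs : D.IsCoverPoint t s) : evalXYT g (D.offsetPoint t s) t = 0 := by
  obtain ⟨A, B, k, hg⟩ := D.exists_hasCoverForm g
  have hAB : {t | A.eval t = 0 ∧ B.eval t = 0}.Infinite := by
    refine (h.union D.finite_not_exists_isCoverPoint).infinite_compl.mono fun t ht => ?_
    obtain ⟨hzero, hcover⟩ := not_or.1 ht
    obtain ⟨s, hs⟩ := not_not.1 hcover
    have hform : ∀ s, D.IsCoverPoint t s → A.eval t + B.eval t * s = 0 := fun s hs =>
      (hg.eval_eq_zero_iff hs).1 (not_not.1 fun hne => hzero ⟨s, hs, hne⟩)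
    refine ⟨by linear_combination (hform s hs + hform _ hs.neg) / 2,
      (mul_eq_zero.1 ?_).resolve_right hs.2.1⟩
    linear_combination (hform s hs - hform _ hs.neg) / 2
  have hA : A = 0 := Polynomial.eq_zero_of_infinite_isRoot _ (hAB.mono fun _ h => h.1)
  have hB : B = 0 := Polynomial.eq_zero_of_infinite_isRoot _ (hAB.mono fun _ h => h.2)
  simp only [hg.eval_eq_zero_iff hs, hA, hB, Polynomial.eval_zero, zero_mul, add_zero]

end CoverForms

end

end OffsetData

/-! ### Local branches of the offset -/

section PlanePolynomials

theorem hasDerivAt_eval_mvPolynomial (f : PolyXY) {x y : ℂ → ℂ} {x' y' t : ℂ}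
    (hx : HasDerivAt x x' t) (hy : HasDerivAt y y' t) :
    HasDerivAt (fun u => eval ![x u, y u] f)
      (eval ![x t, y t] (pderiv 0 f) * x' + eval ![x t, y t] (pderiv 1 f) * y') t := by
  induction f using MvPolynomial.induction_on with
  | C a => simpa using hasDerivAt_const t a
  | add p q hp hq =>
    simp only [map_add]
    exact (hp.fun_add hq).congr_deriv (by ring)
  | mul_X p i hp =>
    fin_cases i
    · simp only [map_mul, Derivation.leibniz, smul_eq_mul, map_add, eval_X, Fin.zero_eta,
        Matrix.cons_val_zero]
      exact (hp.fun_mul hx).congr_deriv (by simp; ring)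
    · simp only [map_mul, Derivation.leibniz, smul_eq_mul, map_add, eval_X, Fin.mk_one,
        Matrix.cons_val_one]
      exact (hp.fun_mul hy).congr_deriv (by simp; ring)

variable {σ R : Type*}

theorem exists_pderiv_eq_C_of_totalDegree_le_one [CommSemiring R] {l : MvPolynomial σ R}
    (hl : l.totalDegree ≤ 1) (i : σ) : ∃ c, pderiv i l = C c := by
  refine ⟨coeff 0 (pderiv i l), totalDegree_eq_zero_iff_eq_C.1 ?_⟩
  by_cases h : pderiv i l = 0
  · rw [h, totalDegree_zero]
  · exact Nat.lt_one_iff.1 ((totalDegree_pderiv_lt i h).trans_le hl)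

theorem map_eval_map_C [CommSemiring R] (a : Polynomial R) (p : σ → R) :
    (a.map (C (σ := σ))).map (eval p) = a := by
  rw [Polynomial.map_map, show (eval p).comp C = RingHom.id R from RingHom.ext (eval_C (f := p)),
    Polynomial.map_id]

end PlanePolynomials

namespace OffsetData

noncomputable section

variable (D : OffsetData)

/-- The normal line at the point with parameter `t`: `U (W x - X) + V (W y - Y)`. -/
def normalPoly : Polynomial PolyXY :=
  D.U.map C * (D.W.map C * RatParam.xT - D.X.map C) +
    D.V.map C * (D.W.map C * RatParam.yT - D.Y.map C)

/-- The circle of radius `d` about the point with parameter `t`: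
`(W x - X)² + (W y - Y)² - d² W²`. -/
def circlePoly : Polynomial PolyXY :=
  (D.W.map C * RatParam.xT - D.X.map C) ^ 2 + (D.W.map C * RatParam.yT - D.Y.map C) ^ 2
    - Polynomial.C (C (D.d ^ 2)) * D.W.map C ^ 2

theorem map_eval_normalPoly (p : Fin 2 → ℂ) : D.normalPoly.map (eval p) =
    D.U * (D.W * Polynomial.C (p 0) - D.X) + D.V * (D.W * Polynomial.C (p 1) - D.Y) := by
  simp [normalPoly, map_eval_map_C, RatParam.xT, RatParam.yT]

theorem map_eval_circlePoly (p : Fin 2 → ℂ) : D.circlePoly.map (eval p) =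
    (D.W * Polynomial.C (p 0) - D.X) ^ 2 + (D.W * Polynomial.C (p 1) - D.Y) ^ 2 -
      Polynomial.C (D.d ^ 2) * D.W ^ 2 := by
  simp [circlePoly, map_eval_map_C, RatParam.xT, RatParam.yT]

theorem evalXYT_normalPoly (p : Fin 2 → ℂ) (t : ℂ) : evalXYT D.normalPoly p t =
    D.U.eval t * (D.W.eval t * p 0 - D.X.eval t) +
      D.V.eval t * (D.W.eval t * p 1 - D.Y.eval t) := by
  simp [evalXYT, map_eval_normalPoly]

theorem evalXYT_circlePoly (p : Fin 2 → ℂ) (t : ℂ) : evalXYT D.circlePoly p t =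
    (D.W.eval t * p 0 - D.X.eval t) ^ 2 + (D.W.eval t * p 1 - D.Y.eval t) ^ 2 -
      D.d ^ 2 * D.W.eval t ^ 2 := by
  simp [evalXYT, map_eval_circlePoly]

theorem evalXYT_derivative_normalPoly (p : Fin 2 → ℂ) (t : ℂ) :
    evalXYT (Polynomial.derivative D.normalPoly) p t =
      D.U.derivative.eval t * (D.W.eval t * p 0 - D.X.eval t) +
      D.U.eval t * (D.W.derivative.eval t * p 0 - D.X.derivative.eval t) +
      (D.V.derivative.eval t * (D.W.eval t * p 1 - D.Y.eval t) +
      D.V.eval t * (D.W.derivative.eval t * p 1 - D.Y.derivative.eval t)) := by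
  rw [evalXYT, ← Polynomial.derivative_map, map_eval_normalPoly]
  simp

theorem eval_U (t : ℂ) : D.U.eval t =
    D.X.derivative.eval t * D.W.eval t - D.X.eval t * D.W.derivative.eval t := by
  simp only [U, Polynomial.eval_sub, Polynomial.eval_mul]

theorem eval_V (t : ℂ) : D.V.eval t =
    D.Y.derivative.eval t * D.W.eval t - D.Y.eval t * D.W.derivative.eval t := by
  simp only [V, Polynomial.eval_sub, Polynomial.eval_mul]

/-- The factor by which `(U, V)` is multiplied in the velocity of the offset curve at `(t, s)`: the
offset curve is parallel to the original one. -/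
def offsetSpeed (t s : ℂ) : ℂ :=
  1 / D.W.eval t ^ 2 +
    D.d * (D.U.eval t * D.V.derivative.eval t - D.V.eval t * D.U.derivative.eval t) / s ^ 3

/-- The parametrization of the offset has zero velocity at the cover point `(t, s)`. -/
def IsCritical (t s : ℂ) : Prop := D.offsetSpeed t s = 0

variable {D} {t t₀ s s₀ : ℂ} {σ : ℂ → ℂ}

theorem IsCoverPoint.evalXYT_derivative_normalPoly (h : D.IsCoverPoint t s) :
    evalXYT (Polynomial.derivative D.normalPoly) (D.offsetPoint t s) t =
      -(D.W.eval t * D.S.eval t * D.offsetSpeed t s) := by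
  have hsq := h.sq
  obtain ⟨hW, hs0, hs2⟩ := h
  have hX' : D.X.derivative.eval t =
      (D.U.eval t + D.X.eval t * D.W.derivative.eval t) / D.W.eval t := by
    rw [eq_div_iff hW, eval_U]
    ring
  have hY' : D.Y.derivative.eval t =
      (D.V.eval t + D.Y.eval t * D.W.derivative.eval t) / D.W.eval t := by
    rw [eq_div_iff hW, eval_V]
    ring
  rw [OffsetData.evalXYT_derivative_normalPoly, hX', hY', ← hs2]
  simp only [offsetPoint, offsetX, offsetY, offsetSpeed, Matrix.cons_val_zero, Matrix.cons_val_one]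
  field_simp
  linear_combination s * hsq

theorem IsCoverPoint.isCritical_iff (h : D.IsCoverPoint t s) : D.IsCritical t s ↔
    evalXYT (Polynomial.derivative D.normalPoly) (D.offsetPoint t s) t = 0 := by
  rw [h.evalXYT_derivative_normalPoly, neg_eq_zero, mul_eq_zero,
    or_iff_right (mul_ne_zero h.1 h.eval_S_ne_zero), IsCritical]

section Branches

variable (D) in
/-- `t ↦ (t, σ t)` is a local analytic section of the double cover near `t₀`. -/
def IsBranch (σ : ℂ → ℂ) (t₀ : ℂ) : Prop :=
  AnalyticAt ℂ σ t₀ ∧ ∀ᶠ t in 𝓝 t₀, D.IsCoverPoint t (σ t)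

theorem IsBranch.isCoverPoint (h : D.IsBranch σ t₀) : D.IsCoverPoint t₀ (σ t₀) :=
  h.2.self_of_nhds

theorem IsBranch.neg (h : D.IsBranch σ t₀) : D.IsBranch (-σ) t₀ :=
  ⟨h.1.neg, h.2.mono fun _ ht => ht.neg⟩

theorem IsBranch.eventually (h : D.IsBranch σ t₀) : ∀ᶠ t in 𝓝 t₀, D.IsBranch σ t :=
  h.1.eventually_analyticAt.and h.2.eventually_nhds

theorem IsCoverPoint.exists_isBranch (h : D.IsCoverPoint t₀ s₀) :
    ∃ σ, D.IsBranch σ t₀ ∧ σ t₀ = s₀ := by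
  have hS := h.eval_S_ne_zero
  have hone : D.S.eval t₀ / D.S.eval t₀ = 1 := div_self hS
  have hquot : AnalyticAt ℂ (fun t => D.S.eval t / D.S.eval t₀) t₀ :=
    (D.S.differentiable.analyticAt t₀).div analyticAt_const hS
  refine ⟨fun t => s₀ * (D.S.eval t / D.S.eval t₀) ^ (1 / 2 : ℂ),
    ⟨analyticAt_const.mul (hquot.cpow analyticAt_const (hone ▸ Complex.one_mem_slitPlane)), ?_⟩,
    by simp [hone]⟩
  filter_upwards [D.W.continuous.continuousAt.eventually_ne h.1,
    D.S.continuous.continuousAt.eventually_ne hS] with t htW htS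
  refine ⟨htW, mul_ne_zero h.2.1 ?_, ?_⟩
  · rw [Ne, Complex.cpow_eq_zero_iff, not_and_or]
    exact Or.inl (div_ne_zero htS hS)
  · rw [mul_pow, h.2.2, ← Complex.cpow_nat_mul, Nat.cast_ofNat, mul_one_div_cancel two_ne_zero,
      Complex.cpow_one, mul_div_cancel₀ _ hS]

theorem IsBranch.mul_deriv (h : D.IsBranch σ t) : σ t * deriv σ t =
    D.U.eval t * D.U.derivative.eval t + D.V.eval t * D.V.derivative.eval t := by
  have hpow := h.1.differentiableAt.hasDerivAt.fun_pow 2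
  have hS : HasDerivAt (fun u => σ u ^ 2) (D.S.derivative.eval t) t :=
    (D.S.hasDerivAt t).congr_of_eventuallyEq (h.2.mono fun _ hu => hu.2.2)
  have heq := hpow.unique hS
  simp only [S, Polynomial.derivative_add, Polynomial.derivative_sq, Polynomial.eval_add,
    Polynomial.eval_mul, Polynomial.eval_C, Nat.cast_ofNat, pow_one, Nat.add_one_sub_one] at heq
  linear_combination heq / 2

theorem IsBranch.hasDerivAt_offsetX (h : D.IsBranch σ t) :
    HasDerivAt (fun u => D.offsetX u (σ u)) (D.U.eval t * D.offsetSpeed t (σ t)) t := by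
  have hrel := h.mul_deriv
  have hsq := h.isCoverPoint.sq
  obtain ⟨hW, hs0, -⟩ := h.isCoverPoint
  refine (((D.X.hasDerivAt t).div (D.W.hasDerivAt t) hW).add (((D.V.hasDerivAt t).const_mul D.d).div
    h.1.differentiableAt.hasDerivAt hs0)).congr_deriv ?_
  rw [offsetSpeed, ← eval_U]
  field_simp
  linear_combination D.d * D.W.eval t ^ 2 * (D.V.derivative.eval t * hsq - D.V.eval t * hrel)

theorem IsBranch.hasDerivAt_offsetY (h : D.IsBranch σ t) :
    HasDerivAt (fun u => D.offsetY u (σ u)) (D.V.eval t * D.offsetSpeed t (σ t)) t := by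
  have hrel := h.mul_deriv
  have hsq := h.isCoverPoint.sq
  obtain ⟨hW, hs0, -⟩ := h.isCoverPoint
  refine (((D.Y.hasDerivAt t).div (D.W.hasDerivAt t) hW).sub (((D.U.hasDerivAt t).const_mul D.d).div
    h.1.differentiableAt.hasDerivAt hs0)).congr_deriv ?_
  rw [offsetSpeed, ← eval_V]
  field_simp
  linear_combination -D.d * D.W.eval t ^ 2 * (D.U.derivative.eval t * hsq - D.U.eval t * hrel)

theorem IsBranch.gradient_normal (h : D.IsBranch σ t) {f : PolyXY}
    (hf : ∀ᶠ u in 𝓝 t, eval (D.offsetPoint u (σ u)) f = 0) (hcrit : ¬ D.IsCritical t (σ t)) :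
    eval (D.offsetPoint t (σ t)) (pderiv 0 f) * D.U.eval t +
      eval (D.offsetPoint t (σ t)) (pderiv 1 f) * D.V.eval t = 0 := by
  have hderiv := hasDerivAt_eval_mvPolynomial f h.hasDerivAt_offsetX h.hasDerivAt_offsetY
  have heq := hderiv.unique ((hasDerivAt_const t (0 : ℂ)).congr_of_eventuallyEq hf)
  refine (mul_eq_zero.1 ?_).resolve_right hcrit
  rw [offsetPoint]
  linear_combination heq

variable (D)

-- On a branch the norm `A² - B² S` factors as `(A + B σ) (A - B σ)`, so one of the two factors
-- vanishes identically there.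
theorem exists_isBranch_evalXYT_eq_zero {g : Polynomial PolyXY}
    (h : {t | ∃ s, D.IsCoverPoint t s ∧ evalXYT g (D.offsetPoint t s) t = 0}.Infinite) :
    ∃ t₀ σ, D.IsBranch σ t₀ ∧ ∀ᶠ t in 𝓝 t₀, evalXYT g (D.offsetPoint t (σ t)) t = 0 := by
  obtain ⟨A, B, k, hg⟩ := D.exists_hasCoverForm g
  obtain ⟨t₀, s₀, -, hs₀⟩ := D.exists_isCoverPoint_notMem Set.finite_empty
  obtain ⟨σ, hσ, -⟩ := hs₀.exists_isBranch
  have hvanish : ∀ ρ, D.IsBranch ρ t₀ → (∃ᶠ t in 𝓝[≠] t₀, A.eval t + B.eval t * ρ t = 0) →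
      ∀ᶠ t in 𝓝 t₀, evalXYT g (D.offsetPoint t (ρ t)) t = 0 := by
    intro ρ hρ hfreq
    have han : AnalyticAt ℂ (fun t => A.eval t + B.eval t * ρ t) t₀ :=
      (A.differentiable.analyticAt t₀).add ((B.differentiable.analyticAt t₀).mul hρ.1)
    filter_upwards [hρ.2, han.frequently_zero_iff_eventually_zero.1 hfreq] with t ht hzero
    exact (hg.eval_eq_zero_iff ht).2 hzero
  have hor : ∃ᶠ t in 𝓝[≠] t₀, A.eval t + B.eval t * σ t = 0 ∨ A.eval t + B.eval t * (-σ) t = 0 := by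
    refine ((hσ.2.filter_mono nhdsWithin_le_nhds).mono fun t ht => ?_).frequently
    have hnorm := congrArg (Polynomial.eval t) (hg.norm_eq_zero h)
    simp only [Polynomial.eval_sub, Polynomial.eval_mul, Polynomial.eval_pow, ← ht.2.2,
      Polynomial.eval_zero] at hnorm
    rw [← mul_eq_zero, Pi.neg_apply]
    linear_combination hnorm
  rcases Filter.frequently_or_distrib.1 hor with hpos | hneg
  · exact ⟨t₀, σ, hσ, hvanish σ hσ hpos⟩
  · exact ⟨t₀, -σ, hσ.neg, hvanish _ hσ.neg hneg⟩

-- Otherwise the offset parametrization would be constant along a branch.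
theorem finite_isCritical : {t | ∃ s, D.IsCoverPoint t s ∧ D.IsCritical t s}.Finite := by
  by_contra hinf
  obtain ⟨t₀, σ, hσ, hzero⟩ := D.exists_isBranch_evalXYT_eq_zero
    (g := Polynomial.derivative D.normalPoly) fun hfin => hinf
      (hfin.subset fun t ⟨s, hs, hcrit⟩ => ⟨s, hs, hs.isCritical_iff.1 hcrit⟩)
  obtain ⟨r, hr, hball⟩ := Metric.eventually_nhds_iff_ball.1 (hσ.eventually.and hzero)
  have hspeed : ∀ t ∈ Metric.ball t₀ r, D.offsetSpeed t (σ t) = 0 := fun t ht =>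
    (hball t ht).1.isCoverPoint.isCritical_iff.2 (hball t ht).2
  have hconst : ∀ f : ℂ → ℂ, (∀ t ∈ Metric.ball t₀ r, HasDerivAt f 0 t) →
      ∀ t ∈ Metric.ball t₀ r, f t = f t₀ := fun f hf t ht =>
    Metric.isOpen_ball.is_const_of_deriv_eq_zero (convex_ball t₀ r).isPreconnected
      (fun u hu => (hf u hu).differentiableAt.differentiableWithinAt) (fun u hu => (hf u hu).deriv)
      ht (Metric.mem_ball_self hr)
  have hx := hconst _ fun t ht => (hball t ht).1.hasDerivAt_offsetX.congr_deriv
    (by rw [hspeed t ht, mul_zero])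
  have hy := hconst _ fun t ht => (hball t ht).1.hasDerivAt_offsetY.congr_deriv
    (by rw [hspeed t ht, mul_zero])
  refine infinite_of_mem_nhds t₀ (Metric.ball_mem_nhds t₀ hr)
    ((D.finite_offsetPoint_eq (D.offsetPoint t₀ (σ t₀))).subset fun t ht =>
      ⟨σ t, (hball t ht).1.isCoverPoint, ?_⟩)
  rw [offsetPoint, offsetPoint, hx t ht, hy t ht]

theorem finite_eval_offsetPoint_eq_zero_of_totalDegree_eq_one {l : PolyXY}
    (hl : l.totalDegree = 1) :
    {t | ∃ s, D.IsCoverPoint t s ∧ eval (D.offsetPoint t s) l = 0}.Finite := by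
  by_contra hinf
  obtain ⟨t₀, σ, hσ, hzero⟩ := D.exists_isBranch_evalXYT_eq_zero (g := Polynomial.C l)
    (by simpa only [evalXYT_C, ← Set.not_infinite, not_not] using hinf)
  simp only [evalXYT_C] at hzero
  obtain ⟨a, ha⟩ := exists_pderiv_eq_C_of_totalDegree_le_one hl.le 0
  obtain ⟨b, hb⟩ := exists_pderiv_eq_C_of_totalDegree_le_one hl.le 1
  have hcomb : Polynomial.C a * D.U + Polynomial.C b * D.V = 0 := by
    refine Polynomial.eq_zero_of_infinite_isRoot _ (((infinite_of_mem_nhds t₀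
      (hσ.eventually.and hzero.eventually_nhds)).sdiff D.finite_isCritical).mono ?_)
    rintro t ⟨⟨ht, hline⟩, hcrit⟩
    have hnormal := ht.gradient_normal hline fun hc => hcrit ⟨σ t, ht.isCoverPoint, hc⟩
    simpa [ha, hb] using hnormal
  obtain ⟨rfl, rfl⟩ := D.eq_zero_of_C_mul_U_add_C_mul_V_eq_zero hcomb
  have hconst : l = C (coeff 0 l) :=
    eq_C_of_forall_pderiv_eq_zero fun i => by fin_cases i <;> simp [ha, hb]
  rw [hconst, totalDegree_C] at hl
  exact zero_ne_one hl

end Branches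

end

end OffsetData

/-! ### The resultant and its factors -/

section PrimitiveParts

variable {σ R : Type*} [CommRing R]

theorem evalXYT_map_C (c : Polynomial R) (p : σ → R) (t : R) :
    evalXYT (c.map C) p t = c.eval t := by
  rw [evalXYT, map_eval_map_C]

theorem eval_eval_C (g : Polynomial (MvPolynomial σ R)) (p : σ → R) (t : R) :
    eval p (g.eval (C t)) = evalXYT g p t := by
  rw [evalXYT, Polynomial.eval_map, ← Polynomial.eval₂_id, Polynomial.hom_eval₂, RingHom.comp_id,
    eval_C]

theorem exists_forall_coeff_eq_coeff_coeff (g : Polynomial (MvPolynomial σ R)) (m : σ →₀ ℕ) :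
    ∃ r : Polynomial R, ∀ k, r.coeff k = coeff m (g.coeff k) := by
  refine ⟨∑ k ∈ g.support, Polynomial.monomial k (coeff m (g.coeff k)), fun k => ?_⟩
  simp only [Polynomial.finsetSum_coeff, Polynomial.coeff_monomial, Finset.sum_ite_eq',
    ite_eq_left_iff]
  intro hk
  rw [Polynomial.notMem_support_iff.1 hk, coeff_zero]

theorem totalDegree_coeff_le_of_map_C_mul [IsDomain R] {g : Polynomial (MvPolynomial σ R)}
    {c : Polynomial R} (hc : c ≠ 0) {n : ℕ} (hn : ∀ k, ((c.map C * g).coeff k).totalDegree ≤ n)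
    (k : ℕ) : (g.coeff k).totalDegree ≤ n := by
  refine Finset.sup_le fun m hm => ?_
  by_contra! hlt
  obtain ⟨r, hr⟩ := exists_forall_coeff_eq_coeff_coeff g m
  have hcr : c * r = 0 := by
    ext j
    have hzero := coeff_eq_zero_of_totalDegree_lt ((hn j).trans_lt hlt)
    simpa only [Polynomial.coeff_mul, Polynomial.coeff_map, coeff_sum, coeff_C_mul, ← hr,
      Polynomial.coeff_zero] using hzero
  refine mem_support_iff.1 hm ?_
  rw [← hr, (mul_eq_zero.1 hcr).resolve_left hc, Polynomial.coeff_zero]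

theorem totalDegree_eval_C_le {g : Polynomial (MvPolynomial σ R)} {n : ℕ}
    (hn : ∀ k, (g.coeff k).totalDegree ≤ n) (t : R) : (g.eval (C t)).totalDegree ≤ n := by
  rw [Polynomial.eval_eq_sum_range]
  refine totalDegree_finsetSum_le fun k _ => ?_
  rw [← C_pow, mul_comm]
  exact (totalDegree_mul _ _).trans (by rw [totalDegree_C, zero_add]; exact hn k)

theorem totalDegree_pos_of_not_isUnit {K : Type*} [Field K] {f : MvPolynomial σ K} (hf : f ≠ 0)
    (hunit : ¬ IsUnit f) : 0 < f.totalDegree := by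
  rw [Nat.pos_iff_ne_zero, Ne, totalDegree_eq_zero_iff_eq_C]
  intro hconst
  have hne : coeff 0 f ≠ 0 := fun h0 => hf (by rw [hconst, h0, map_zero])
  exact hunit (hconst ▸ hne.isUnit.map C)

theorem not_dvd_of_totalDegree_le_one {K : Type*} [Field K] {f g : MvPolynomial σ K}
    (hf : Irreducible f) (hf1 : f.totalDegree ≠ 1) (hg : g ≠ 0) (hg1 : g.totalDegree ≤ 1) :
    ¬ f ∣ g := by
  intro h
  have hle := totalDegree_le_of_dvd_of_isDomain h hg
  have hpos := totalDegree_pos_of_not_isUnit hf.ne_zero hf.not_isUnit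
  omega

theorem eval_content_ne_zero {p₀ g : Polynomial PolyXY} {c : Polynomial ℂ}
    (h : p₀ = c.map C * g) {p : Fin 2 → ℂ} {t : ℂ} (ht : evalXYT p₀ p t ≠ 0) : c.eval t ≠ 0 := by
  rw [h, evalXYT_mul, evalXYT_map_C] at ht
  exact left_ne_zero_of_mul ht

namespace IsPrimitivePartT

variable {p₀ g : Polynomial PolyXY}

theorem eval_C_ne_zero (h : IsPrimitivePartT p₀ g) (t : ℂ) : g.eval (C t) ≠ 0 := fun h0 =>
  Polynomial.not_isUnit_X_sub_C t
    (h.2 (Polynomial.X - Polynomial.C t) (by simpa using Polynomial.dvd_iff_isRoot.2 h0))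

theorem ne_zero (h : IsPrimitivePartT p₀ g) : g ≠ 0 := by
  rintro rfl
  exact h.eval_C_ne_zero 0 Polynomial.eval_zero

theorem totalDegree_coeff_le (h : IsPrimitivePartT p₀ g) (hp₀ : p₀ ≠ 0) {n : ℕ}
    (hn : ∀ k, (p₀.coeff k).totalDegree ≤ n) (k : ℕ) : (g.coeff k).totalDegree ≤ n := by
  obtain ⟨⟨c, rfl⟩, -⟩ := h
  refine totalDegree_coeff_le_of_map_C_mul (c := c) ?_ hn k
  rintro rfl
  exact hp₀ (by rw [Polynomial.map_zero, zero_mul])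

theorem evalXYT_eq_zero_iff (h : IsPrimitivePartT p₀ g) {t : ℂ} (ht : ∃ p, evalXYT p₀ p t ≠ 0)
    (p : Fin 2 → ℂ) : evalXYT g p t = 0 ↔ evalXYT p₀ p t = 0 := by
  obtain ⟨⟨c, hc⟩, -⟩ := h
  obtain ⟨q, hq⟩ := ht
  rw [hc, evalXYT_mul, evalXYT_map_C, mul_eq_zero, or_iff_right (eval_content_ne_zero hc hq)]

end IsPrimitivePartT

end PrimitiveParts

theorem exists_eq_mul_of_add_mul_eq_zero {K : Type*} [Field K] {u v a b : K}
    (huv : u ^ 2 + v ^ 2 ≠ 0) (h : u * a + v * b = 0) : ∃ l, a = l * v ∧ b = -l * u := by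
  refine ⟨(a * v - b * u) / (u ^ 2 + v ^ 2), ?_, ?_⟩
  · field_simp
    linear_combination u * h
  · field_simp
    linear_combination v * h

namespace OffsetData

noncomputable section

variable (D : OffsetData)

theorem totalDegree_coeff_normalPoly_le (k : ℕ) : (D.normalPoly.coeff k).totalDegree ≤ 1 := by
  have hnormal : D.normalPoly =
      (D.U * D.W).map C * RatParam.xT + (D.V * D.W).map C * RatParam.yT -
        (D.U * D.X + D.V * D.Y).map C := by
    simp only [normalPoly, Polynomial.map_mul, Polynomial.map_add]
    ring
  have hmul (a : ℂ) (i : Fin 2) : (C a * MvPolynomial.X i : PolyXY).totalDegree ≤ 1 :=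
    (totalDegree_mul _ _).trans (by simp)
  rw [hnormal, Polynomial.coeff_sub, Polynomial.coeff_add, RatParam.xT, RatParam.yT,
    Polynomial.coeff_mul_C, Polynomial.coeff_mul_C, Polynomial.coeff_map, Polynomial.coeff_map,
    Polynomial.coeff_map]
  exact (totalDegree_sub_C_le _ _).trans
    ((totalDegree_add _ _).trans (max_le (hmul _ _) (hmul _ _)))

variable {D} {t s : ℂ}

theorem IsCoverPoint.exists_evalXYT_normalPoly_ne_zero (h : D.IsCoverPoint t s) :
    ∃ p, evalXYT D.normalPoly p t ≠ 0 := by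
  refine ⟨![(D.X.eval t + D.U.eval t) / D.W.eval t, (D.Y.eval t + D.V.eval t) / D.W.eval t], ?_⟩
  have hS := h.eval_S_ne_zero
  rw [← h.2.2, h.sq] at hS
  simp only [evalXYT_normalPoly, Matrix.cons_val_zero, Matrix.cons_val_one,
    mul_div_cancel₀ _ h.1]
  convert hS using 1
  ring

theorem IsCoverPoint.exists_evalXYT_circlePoly_ne_zero (h : D.IsCoverPoint t s) :
    ∃ p, evalXYT D.circlePoly p t ≠ 0 := by
  refine ⟨D.point t, ?_⟩
  simp [evalXYT_circlePoly, point, mul_div_cancel₀ _ h.1, D.d_ne_zero, h.1]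

variable (D) in
theorem normalPoly_ne_zero : D.normalPoly ≠ 0 := by
  obtain ⟨t, s, -, hs⟩ := D.exists_isCoverPoint_notMem Set.finite_empty
  obtain ⟨p, hp⟩ := hs.exists_evalXYT_normalPoly_ne_zero
  intro h
  exact hp (by simp [h, evalXYT])

theorem IsCoverPoint.evalXYT_normalPoly_eq_zero (h : D.IsCoverPoint t s) :
    evalXYT D.normalPoly (D.offsetPoint t s) t = 0 := by
  obtain ⟨hW, hs0, -⟩ := h
  rw [evalXYT_normalPoly]
  simp only [offsetPoint, offsetX, offsetY, Matrix.cons_val_zero, Matrix.cons_val_one]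
  field_simp
  ring

theorem IsCoverPoint.evalXYT_circlePoly_eq_zero (h : D.IsCoverPoint t s) :
    evalXYT D.circlePoly (D.offsetPoint t s) t = 0 := by
  have hsq := h.sq
  obtain ⟨hW, hs0, -⟩ := h
  rw [evalXYT_circlePoly]
  simp only [offsetPoint, offsetX, offsetY, Matrix.cons_val_zero, Matrix.cons_val_one]
  field_simp
  linear_combination -D.d ^ 2 * D.W.eval t ^ 2 * hsq

theorem IsCoverPoint.exists_offsetPoint_eq (h : D.IsCoverPoint t s) {p : Fin 2 → ℂ}
    (hnormal : evalXYT D.normalPoly p t = 0) (hcircle : evalXYT D.circlePoly p t = 0) :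
    ∃ s', D.IsCoverPoint t s' ∧ D.offsetPoint t s' = p := by
  have hsq := h.sq
  obtain ⟨hW, hs0, hs2⟩ := h
  have hd := D.d_ne_zero
  rw [evalXYT_normalPoly] at hnormal
  rw [evalXYT_circlePoly] at hcircle
  obtain ⟨l, hx, hy⟩ := exists_eq_mul_of_add_mul_eq_zero (hsq ▸ pow_ne_zero 2 hs0) hnormal
  have hl : l ^ 2 * s ^ 2 = D.d ^ 2 * D.W.eval t ^ 2 := by
    rw [hx, hy] at hcircle
    linear_combination hcircle + l ^ 2 * hsq
  have hl0 : l ≠ 0 := by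
    rintro rfl
    refine mul_ne_zero (pow_ne_zero 2 hd) (pow_ne_zero 2 hW) ?_
    rw [← hl]
    ring
  refine ⟨D.d * D.W.eval t / l, ⟨hW, div_ne_zero (mul_ne_zero hd hW) hl0, ?_⟩, ?_⟩
  · rw [← hs2, div_pow, mul_pow, ← hl]
    field_simp
  · ext i
    fin_cases i
    · simp only [offsetPoint, offsetX, Fin.zero_eta, Matrix.cons_val_zero]
      field_simp
      linear_combination -hx
    · simp only [offsetPoint, offsetY, Fin.mk_one, Matrix.cons_val_one, Matrix.cons_val_zero]
      field_simp
      linear_combination -hy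

variable (D)

/-- `p` is the offset point of some cover point. -/
def IsGenerated (p : Fin 2 → ℂ) : Prop := ∃ t s, D.IsCoverPoint t s ∧ D.offsetPoint t s = p

theorem finite_offsetPoint_of_finite {T : Set ℂ} (hT : T.Finite) :
    {p | ∃ t ∈ T, ∃ s, D.IsCoverPoint t s ∧ D.offsetPoint t s = p}.Finite := by
  have hfibre (t : ℂ) : {s | D.IsCoverPoint t s}.Finite :=
    ((Polynomial.finite_setOfPred_isRoot
      (Polynomial.X_pow_sub_C_ne_zero two_pos (D.S.eval t))).subset fun s hs => by
        simp [hs.2.2])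
  refine (hT.biUnion fun t _ => (hfibre t).image (D.offsetPoint t)).subset ?_
  rintro p ⟨t, ht, s, hs, rfl⟩
  exact Set.mem_biUnion ht ⟨s, hs, rfl⟩

theorem infinite_params_of_infinite_isGenerated {A : Set (Fin 2 → ℂ)}
    (h : {p | p ∈ A ∧ D.IsGenerated p}.Infinite) :
    {t | ∃ s, D.IsCoverPoint t s ∧ D.offsetPoint t s ∈ A}.Infinite := by
  refine fun hfin => h ((D.finite_offsetPoint_of_finite hfin).subset ?_)
  rintro p ⟨hp, t, s, hs, rfl⟩
  exact ⟨t, ⟨s, hs, hp⟩, s, hs, rfl⟩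

end

end OffsetData

/-- The primitive parts `P` and `Q` of the normal and circle polynomials of `D`, of which the
offset is computed as a resultant. -/
structure OffsetResultant (D : OffsetData) where
  P : Polynomial PolyXY
  Q : Polynomial PolyXY
  hP : IsPrimitivePartT D.normalPoly P
  hQ : IsPrimitivePartT D.circlePoly Q

namespace OffsetResultant

noncomputable section

variable {D : OffsetData} (R : OffsetResultant D)

/-- The resultant `Res_t(P, Q)`. -/
def H : PolyXY := Polynomial.resultant R.P R.Q

variable {R} {t s : ℂ}

theorem evalXYT_P_eq_zero_iff (h : D.IsCoverPoint t s) (p : Fin 2 → ℂ) :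
    evalXYT R.P p t = 0 ↔ evalXYT D.normalPoly p t = 0 :=
  R.hP.evalXYT_eq_zero_iff h.exists_evalXYT_normalPoly_ne_zero p

theorem evalXYT_Q_eq_zero_iff (h : D.IsCoverPoint t s) (p : Fin 2 → ℂ) :
    evalXYT R.Q p t = 0 ↔ evalXYT D.circlePoly p t = 0 :=
  R.hQ.evalXYT_eq_zero_iff h.exists_evalXYT_circlePoly_ne_zero p

-- A constant `Q` would make the curve lie on the circle of radius `d` about each zero of `Q`.
theorem natDegree_Q_ne_zero (h : D.IsCoverPoint t s) : R.Q.natDegree ≠ 0 := by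
  intro h0
  obtain ⟨r, hr⟩ := Polynomial.natDegree_eq_zero.1 h0
  have hQ := (evalXYT_Q_eq_zero_iff (R := R) h _).2 h.evalXYT_circlePoly_eq_zero
  rw [← hr, evalXYT_C] at hQ
  obtain ⟨c, hc⟩ := R.hQ.1
  have hzero := D.map_eval_circlePoly (D.offsetPoint t s)
  rw [hc, ← hr, Polynomial.map_mul, Polynomial.map_C, hQ, map_zero, mul_zero] at hzero
  apply D.no_circle (D.offsetPoint t s 0) (D.offsetPoint t s 1)
  linear_combination -hzero

theorem eval_offsetPoint_H (h : D.IsCoverPoint t s) : eval (D.offsetPoint t s) R.H = 0 := by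
  obtain ⟨a, b, -, -, hbezout⟩ := Polynomial.exists_mul_add_mul_eq_C_resultant R.P R.Q le_rfl
    le_rfl (Or.inr (natDegree_Q_ne_zero h))
  rw [← evalXYT_C _ t, H, ← hbezout, evalXYT_add, evalXYT_mul, evalXYT_mul,
    (evalXYT_P_eq_zero_iff h _).2 h.evalXYT_normalPoly_eq_zero,
    (evalXYT_Q_eq_zero_iff h _).2 h.evalXYT_circlePoly_eq_zero, zero_mul, zero_mul, add_zero]

variable (R)

theorem totalDegree_coeff_P_le (k : ℕ) : (R.P.coeff k).totalDegree ≤ 1 :=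
  R.hP.totalDegree_coeff_le D.normalPoly_ne_zero D.totalDegree_coeff_normalPoly_le k

/-- A product of polynomials of degree at most one, outside whose zero set all zeros of the
resultant are offset points. -/
def exceptional : PolyXY :=
  R.P.leadingCoeff * ∏ t ∈ D.finite_not_exists_isCoverPoint.toFinset, R.P.eval (C t)

theorem exceptional_ne_zero : R.exceptional ≠ 0 :=
  mul_ne_zero (Polynomial.leadingCoeff_ne_zero.2 R.hP.ne_zero)
    (Finset.prod_ne_zero_iff.2 fun t _ => R.hP.eval_C_ne_zero t)

theorem not_dvd_exceptional {f : PolyXY} (hf : Irreducible f) (hf1 : f.totalDegree ≠ 1) :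
    ¬ f ∣ R.exceptional := by
  intro h
  rcases hf.prime.dvd_or_dvd h with hlead | hprod
  · exact not_dvd_of_totalDegree_le_one hf hf1 (Polynomial.leadingCoeff_ne_zero.2 R.hP.ne_zero)
      (R.totalDegree_coeff_P_le _) hlead
  · obtain ⟨t, -, ht⟩ := (hf.prime.dvd_finsetProd_iff _).1 hprod
    exact not_dvd_of_totalDegree_le_one hf hf1 (R.hP.eval_C_ne_zero t)
      (totalDegree_eval_C_le R.totalDegree_coeff_P_le t) ht

variable {R} {p : Fin 2 → ℂ}

theorem eval_leadingCoeff_P_ne_zero (hp : eval p R.exceptional ≠ 0) :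
    eval p R.P.leadingCoeff ≠ 0 := by
  rw [exceptional, map_mul] at hp
  exact left_ne_zero_of_mul hp

theorem natDegree_map_P (hp : eval p R.exceptional ≠ 0) :
    (R.P.map (eval p)).natDegree = R.P.natDegree :=
  Polynomial.natDegree_map_of_leadingCoeff_ne_zero _ (eval_leadingCoeff_P_ne_zero hp)

theorem exists_offsetPoint_eq_of_common_root (hp : eval p R.exceptional ≠ 0)
    (hP : evalXYT R.P p t = 0) (hQ : evalXYT R.Q p t = 0) :
    ∃ s, D.IsCoverPoint t s ∧ D.offsetPoint t s = p := by
  have hcover : ∃ s, D.IsCoverPoint t s := by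
    by_contra hbad
    rw [exceptional, map_mul, map_prod] at hp
    refine Finset.prod_ne_zero_iff.1 (right_ne_zero_of_mul hp) t
      (D.finite_not_exists_isCoverPoint.mem_toFinset.2 hbad) ?_
    rw [eval_eval_C, hP]
  obtain ⟨s, hs⟩ := hcover
  exact hs.exists_offsetPoint_eq ((evalXYT_P_eq_zero_iff hs p).1 hP)
    ((evalXYT_Q_eq_zero_iff hs p).1 hQ)

theorem isGenerated_of_eval_H_eq_zero (hp : eval p R.exceptional ≠ 0) (h : eval p R.H = 0) :
    D.IsGenerated p := by
  have hne : R.P.map (eval p) ≠ 0 := by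
    rw [← Polynomial.leadingCoeff_ne_zero, Polynomial.leadingCoeff_map_of_leadingCoeff_ne_zero _
      (eval_leadingCoeff_P_ne_zero hp)]
    exact eval_leadingCoeff_P_ne_zero hp
  rw [H, ← Polynomial.resultant_map_map, ← natDegree_map_P hp,
    resultant_eq_zero_iff_exists_common_root hne Polynomial.natDegree_map_le] at h
  obtain ⟨t, hP, hQ⟩ := h
  exact ⟨t, exists_offsetPoint_eq_of_common_root hp hP hQ⟩

section Factors

variable {f : PolyXY} (hf : Irreducible f) (hfE : ¬ f ∣ R.exceptional) (hfH : f ∣ R.H)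
include hf hfE hfH

theorem finite_not_isGenerated : {p | p ∈ planeCurve f ∧ ¬ D.IsGenerated p}.Finite := by
  refine (finite_common_zeros hf hfE).subset ?_
  rintro p ⟨hp, hgen⟩
  refine ⟨hp, ?_⟩
  by_contra hE
  exact hgen (isGenerated_of_eval_H_eq_zero hE (planeCurve_subset_of_dvd hfH hp))

theorem infinite_isGenerated : {p | p ∈ planeCurve f ∧ D.IsGenerated p}.Infinite := by
  refine ((planeCurve_infinite hf).sdiff (finite_not_isGenerated hf hfE hfH)).mono ?_
  rintro p ⟨hp, hgen⟩
  exact ⟨hp, not_not.1 fun h => hgen ⟨hp, h⟩⟩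

end Factors

-- If `H = 0`, then almost all points of a line outside the curve `exceptional = 0` are generated.
theorem H_ne_zero : R.H ≠ 0 := by
  intro h0
  obtain ⟨p, hp⟩ : ∃ p, eval p R.exceptional ≠ 0 := by
    by_contra! h
    exact R.exceptional_ne_zero (MvPolynomial.funext fun p => by rw [h p, map_zero])
  have hline := irreducible_X_zero_sub_C (p 0)
  have hndvd : ¬ (X 0 - C (p 0) : PolyXY) ∣ R.exceptional := by
    rintro ⟨k, hk⟩
    exact hp (by simp [hk])
  have hdeg : (X 0 - C (p 0) : PolyXY).totalDegree ≤ 1 :=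
    (totalDegree_sub_C_le _ _).trans (totalDegree_X _).le
  exact D.infinite_params_of_infinite_isGenerated
    (infinite_isGenerated hline hndvd (h0 ▸ dvd_zero _))
    (D.finite_eval_offsetPoint_eq_zero_of_totalDegree_eq_one
      (hdeg.antisymm (totalDegree_pos_of_not_isUnit hline.ne_zero hline.not_isUnit)))

end

noncomputable section

variable {D : OffsetData} (R : OffsetResultant D)

/-- `f` is an irreducible factor of the resultant other than a linear one; such factors define the
components of the offset. -/
def IsNonlinearFactor (f : PolyXY) : Prop := Irreducible f ∧ f.totalDegree ≠ 1 ∧ f ∣ R.H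

/-- `f` and `g` represent all nonlinear irreducible factors of the resultant up to associates, with
`g = 1` if there is only one. -/
def AreNonlinearFactors (f g : PolyXY) : Prop :=
  R.IsNonlinearFactor f ∧ (g = 1 ∨ R.IsNonlinearFactor g ∧ ¬ Associated f g) ∧
    ∀ h, R.IsNonlinearFactor h → h ∣ f * g

variable {R} {f g h F : PolyXY} {t s : ℂ}

namespace IsNonlinearFactor

theorem finite_not_isGenerated (hf : R.IsNonlinearFactor f) :
    {p | p ∈ planeCurve f ∧ ¬ D.IsGenerated p}.Finite :=
  OffsetResultant.finite_not_isGenerated hf.1 (R.not_dvd_exceptional hf.1 hf.2.1) hf.2.2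

theorem infinite_isGenerated (hf : R.IsNonlinearFactor f) :
    {p | p ∈ planeCurve f ∧ D.IsGenerated p}.Infinite :=
  OffsetResultant.infinite_isGenerated hf.1 (R.not_dvd_exceptional hf.1 hf.2.1) hf.2.2

theorem of_associated (hf : R.IsNonlinearFactor f) (hgf : Associated g f) :
    R.IsNonlinearFactor g := by
  have hg := hgf.irreducible_iff.2 hf.1
  refine ⟨hg, fun hdeg => hf.2.1 ?_, hgf.dvd.trans hf.2.2⟩
  have hle := totalDegree_le_of_dvd_of_isDomain hgf.symm.dvd hg.ne_zero
  have hpos := totalDegree_pos_of_not_isUnit hf.1.ne_zero hf.1.not_isUnit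
  omega

theorem eval_eq_zero_or_neg (hf : R.IsNonlinearFactor f) (hs : D.IsCoverPoint t s) :
    eval (D.offsetPoint t s) f = 0 ∨ eval (D.offsetPoint t (-s)) f = 0 := by
  simpa only [evalXYT_C] using D.evalXYT_eq_zero_or_neg_of_infinite (g := Polynomial.C f) (by
    simp only [evalXYT_C]
    exact D.infinite_params_of_infinite_isGenerated hf.infinite_isGenerated) hs

theorem finite_eval_eq_zero_and (hf : R.IsNonlinearFactor f) (hg : R.IsNonlinearFactor g)
    (hfg : ¬ Associated f g) :
    {t | ∃ s, D.IsCoverPoint t s ∧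
      eval (D.offsetPoint t s) f = 0 ∧ eval (D.offsetPoint t s) g = 0}.Finite :=
  D.finite_offsetPoint_mem
    (finite_common_zeros hf.1 fun hdvd => hfg (hf.1.associated_of_dvd hg.1 hdvd))

-- Pigeonhole: each factor vanishes at one of the two offset points of almost every parameter.
theorem associated_or_associated (hf : R.IsNonlinearFactor f) (hg : R.IsNonlinearFactor g)
    (hh : R.IsNonlinearFactor h) (hfg : ¬ Associated f g) : Associated h f ∨ Associated h g := by
  by_contra! hne
  obtain ⟨t, s, ht, hs⟩ := D.exists_isCoverPoint_notMem
    (((hf.finite_eval_eq_zero_and hg hfg).union (hh.finite_eval_eq_zero_and hf hne.1)).union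
      (hh.finite_eval_eq_zero_and hg hne.2))
  simp only [Set.mem_union, Set.mem_ofPred_eq, not_or, not_exists, not_and] at ht
  obtain ⟨⟨hnot_fg, hnot_hf⟩, hnot_hg⟩ := ht
  rcases hf.eval_eq_zero_or_neg hs with hf0 | hf0 <;>
    rcases hg.eval_eq_zero_or_neg hs with hg0 | hg0 <;>
    rcases hh.eval_eq_zero_or_neg hs with hh0 | hh0
  · exact hnot_fg s hs hf0 hg0
  · exact hnot_fg s hs hf0 hg0
  · exact hnot_hf s hs hh0 hf0
  · exact hnot_hg _ hs.neg hh0 hg0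
  · exact hnot_hg s hs hh0 hg0
  · exact hnot_hf _ hs.neg hh0 hf0
  · exact hnot_fg _ hs.neg hf0 hg0
  · exact hnot_fg _ hs.neg hf0 hg0

end IsNonlinearFactor

-- Linear factors of `H` vanish at only finitely many offset points.
theorem eval_offsetPoint_eq_zero_of_forall_dvd (hF : ∀ f, R.IsNonlinearFactor f → f ∣ F)
    (hs : D.IsCoverPoint t s) : eval (D.offsetPoint t s) F = 0 := by
  classical
  rw [← evalXYT_C _ t]
  refine D.evalXYT_eq_zero_of_finite_ne_zero ?_ hs
  obtain ⟨L, hL, hass⟩ := UniqueFactorizationMonoid.exists_prime_factors R.H H_ne_zero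
  have hfin : (⋃ l ∈ {l ∈ L.toFinset | l.totalDegree = 1},
      {t | ∃ s, D.IsCoverPoint t s ∧ eval (D.offsetPoint t s) l = 0}).Finite := by
    refine Set.Finite.biUnion (Finset.finite_toSet _) fun l hl => ?_
    exact D.finite_eval_offsetPoint_eq_zero_of_totalDegree_eq_one (Finset.mem_filter.1 hl).2
  refine hfin.subset ?_
  rintro t ⟨s, hs, hne⟩
  rw [evalXYT_C] at hne
  have hzero : eval (D.offsetPoint t s) L.prod = 0 := by
    obtain ⟨k, hk⟩ := hass.symm.dvd
    rw [hk, map_mul, eval_offsetPoint_H hs, zero_mul]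
  rw [map_multiset_prod, Multiset.prod_eq_zero_iff, Multiset.mem_map] at hzero
  obtain ⟨l, hl, hl0⟩ := hzero
  have hl1 : l.totalDegree = 1 := by
    by_contra hl1
    obtain ⟨k, rfl⟩ := hF l ⟨(hL l hl).irreducible, hl1, (Multiset.dvd_prod hl).trans hass.dvd⟩
    exact hne (by rw [map_mul, hl0, zero_mul])
  exact Set.mem_biUnion (Finset.mem_coe.2 (Finset.mem_filter.2 ⟨Multiset.mem_toFinset.2 hl, hl1⟩))
    ⟨s, hs, hl0⟩

variable (R) in
theorem exists_areNonlinearFactors : ∃ f g, R.AreNonlinearFactors f g := by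
  obtain ⟨f, hf⟩ : ∃ f, R.IsNonlinearFactor f := by
    by_contra! h
    obtain ⟨t, s, -, hs⟩ := D.exists_isCoverPoint_notMem Set.finite_empty
    simpa using eval_offsetPoint_eq_zero_of_forall_dvd (F := 1) (fun f hf => absurd hf (h f)) hs
  by_cases hg : ∃ g, R.IsNonlinearFactor g ∧ ¬ Associated f g
  · obtain ⟨g, hg, hfg⟩ := hg
    refine ⟨f, g, hf, Or.inr ⟨hg, hfg⟩, fun h hh => ?_⟩
    rcases hf.associated_or_associated hg hh hfg with hass | hass
    · exact hass.dvd.trans (dvd_mul_right _ _)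
    · exact hass.dvd.trans (dvd_mul_left _ _)
  · push Not at hg
    exact ⟨f, 1, hf, Or.inl rfl, fun h hh => by simpa using (hg h hh).symm.dvd⟩

namespace AreNonlinearFactors

theorem mul_ne_zero (hfg : R.AreNonlinearFactors f g) : f * g ≠ 0 := by
  refine _root_.mul_ne_zero hfg.1.1.ne_zero ?_
  rcases hfg.2.1 with rfl | hg
  · exact one_ne_zero
  · exact hg.1.1.ne_zero

theorem eval_offsetPoint (hfg : R.AreNonlinearFactors f g) (hs : D.IsCoverPoint t s) :
    eval (D.offsetPoint t s) (f * g) = 0 :=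
  eval_offsetPoint_eq_zero_of_forall_dvd hfg.2.2 hs

theorem isNonlinearFactor_of_dvd (hfg : R.AreNonlinearFactors f g) (hh : Irreducible h)
    (hdvd : h ∣ f * g) : R.IsNonlinearFactor h := by
  rcases hh.prime.dvd_or_dvd hdvd with hf | hg
  · exact hfg.1.of_associated (hh.associated_of_dvd hfg.1.1 hf)
  · rcases hfg.2.1 with rfl | hg'
    · exact absurd (isUnit_of_dvd_one hg) hh.not_isUnit
    · exact hg'.1.of_associated (hh.associated_of_dvd hg'.1.1 hg)

theorem zariskiClosure_isGenerated (hfg : R.AreNonlinearFactors f g) :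
    zariskiClosure {p | D.IsGenerated p} = planeCurve (f * g) := by
  refine Set.Subset.antisymm (zariskiClosure_subset_planeCurve ?_) ?_
  · rintro p ⟨t, s, hs, rfl⟩
    exact hfg.eval_offsetPoint hs
  have hsub {k : PolyXY} (hk : R.IsNonlinearFactor k) :
      planeCurve k ⊆ zariskiClosure {p | D.IsGenerated p} :=
    planeCurve_subset_zariskiClosure hk.1 hk.infinite_isGenerated
  rw [planeCurve_mul]
  refine Set.union_subset (hsub hfg.1) ?_
  rcases hfg.2.1 with rfl | hg
  · rw [planeCurve_one]
    exact Set.empty_subset _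
  · exact hsub hg.1

end AreNonlinearFactors

end

end OffsetResultant

/-! ### Multiplicities along transversal lines -/

section Lines

noncomputable section

variable {σ R : Type*} [CommRing R]

/-- The restriction of polynomials to the line through `p` with direction `v`, as power series in
the coordinate of the line. -/
def lineHom (p v : σ → R) : MvPolynomial σ R →+* PowerSeries R :=
  eval₂Hom PowerSeries.C fun i => PowerSeries.C (p i) + PowerSeries.C (v i) * PowerSeries.X

variable (p v : σ → R)

theorem lineHom_C (r : R) : lineHom p v (C r) = PowerSeries.C r := by
  rw [lineHom, coe_eval₂Hom, eval₂_C]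

theorem lineHom_X (i : σ) :
    lineHom p v (X i) = PowerSeries.C (p i) + PowerSeries.C (v i) * PowerSeries.X := by
  rw [lineHom, coe_eval₂Hom, eval₂_X]

theorem constantCoeff_comp_lineHom : PowerSeries.constantCoeff.comp (lineHom p v) = eval p := by
  ext i <;> simp [lineHom_C, lineHom_X]

theorem constantCoeff_lineHom (f : MvPolynomial σ R) :
    PowerSeries.constantCoeff (lineHom p v f) = eval p f :=
  RingHom.congr_fun (constantCoeff_comp_lineHom p v) f

theorem constantCoeff_derivative_lineHom [Fintype σ] (f : MvPolynomial σ R) :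
    PowerSeries.constantCoeff (PowerSeries.derivative R (lineHom p v f)) =
      ∑ i, v i * eval p (pderiv i f) := by
  classical
  induction f using MvPolynomial.induction_on with
  | C a => simp [lineHom_C]
  | add f g hf hg => simp only [map_add, hf, hg, mul_add, Finset.sum_add_distrib]
  | mul_X f j hf =>
    have hj : PowerSeries.constantCoeff (PowerSeries.derivative R (lineHom p v (X j))) = v j := by
      simp [lineHom_X]
    simp only [map_mul, map_add, Derivation.leibniz, smul_eq_mul, constantCoeff_lineHom, hf, hj,
      pderiv_X, eval_X, mul_add, Finset.sum_add_distrib, Finset.mul_sum]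
    congr 1
    · rw [Finset.sum_eq_single j (fun i _ hi => by simp [hi.symm]) (by simp)]
      simp [mul_comm]
    · exact Finset.sum_congr rfl fun i _ => by ring

theorem eval_map_lineHom_map_C (a : Polynomial R) (τ : PowerSeries R) :
    ((a.map C).map (lineHom p v)).eval τ = Polynomial.aeval τ a := by
  have hC : (lineHom p v).comp C = algebraMap R (PowerSeries R) := RingHom.ext (lineHom_C p v)
  rw [Polynomial.map_map, hC, Polynomial.eval_map_algebraMap]

theorem constantCoeff_aeval (a : Polynomial R) (τ : PowerSeries R) :
    PowerSeries.constantCoeff (Polynomial.aeval τ a) = a.eval (PowerSeries.constantCoeff τ) := by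
  rw [Polynomial.aeval_def, Polynomial.hom_eval₂, ← Polynomial.eval₂_id]
  congr 1

theorem constantCoeff_derivative_aeval (a : Polynomial R) (τ : PowerSeries R) :
    PowerSeries.constantCoeff (PowerSeries.derivative R (Polynomial.aeval τ a)) =
      a.derivative.eval (PowerSeries.constantCoeff τ) *
        PowerSeries.constantCoeff (PowerSeries.derivative R τ) := by
  rw [Derivation.map_aeval, smul_eq_mul, map_mul, constantCoeff_aeval]

theorem order_eq_one_of_constantCoeff_derivative_ne_zero {a : PowerSeries R}
    (h : PowerSeries.constantCoeff a = 0)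
    (h' : PowerSeries.constantCoeff (PowerSeries.derivative R a) ≠ 0) : a.order = 1 := by
  refine PowerSeries.order_eq_nat (n := 1) |>.2 ⟨?_, fun i hi => ?_⟩
  · rw [← PowerSeries.coeff_zero_eq_constantCoeff_apply, PowerSeries.coeff_derivative] at h'
    simpa using h'
  · rwa [Nat.lt_one_iff.1 hi, PowerSeries.coeff_zero_eq_constantCoeff_apply]

end

end Lines

namespace OffsetData

variable {D : OffsetData} {t s : ℂ} {v : Fin 2 → ℂ} {τ : PowerSeries ℂ}

theorem eval_map_lineHom_circlePoly (p v : Fin 2 → ℂ) (τ : PowerSeries ℂ) :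
    (D.circlePoly.map (lineHom p v)).eval τ =
      (Polynomial.aeval τ D.W * lineHom p v (MvPolynomial.X 0) - Polynomial.aeval τ D.X) ^ 2 +
      (Polynomial.aeval τ D.W * lineHom p v (MvPolynomial.X 1) - Polynomial.aeval τ D.Y) ^ 2 -
        PowerSeries.C (D.d ^ 2) * Polynomial.aeval τ D.W ^ 2 := by
  simp only [circlePoly, RatParam.xT, RatParam.yT, Polynomial.map_sub, Polynomial.map_add,
    Polynomial.map_pow, Polynomial.map_mul, Polynomial.map_C, Polynomial.eval_sub,
    Polynomial.eval_add, Polynomial.eval_pow, Polynomial.eval_mul, Polynomial.eval_C, lineHom_C,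
    eval_map_lineHom_map_C]

theorem evalXYT_derivative_circlePoly (p : Fin 2 → ℂ) (t : ℂ) :
    evalXYT (Polynomial.derivative D.circlePoly) p t =
      2 * (D.W.eval t * p 0 - D.X.eval t) *
        (D.W.derivative.eval t * p 0 - D.X.derivative.eval t) +
      2 * (D.W.eval t * p 1 - D.Y.eval t) *
        (D.W.derivative.eval t * p 1 - D.Y.derivative.eval t) -
      D.d ^ 2 * (2 * D.W.eval t * D.W.derivative.eval t) := by
  rw [evalXYT, ← Polynomial.derivative_map, map_eval_circlePoly]
  simp [Polynomial.derivative_pow, -map_pow]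

theorem constantCoeff_derivative_circlePoly (p v : Fin 2 → ℂ)
    (hτ : PowerSeries.constantCoeff τ = t) :
    PowerSeries.constantCoeff
        (PowerSeries.derivative ℂ ((D.circlePoly.map (lineHom p v)).eval τ)) =
      2 * D.W.eval t * (v 0 * (D.W.eval t * p 0 - D.X.eval t) +
        v 1 * (D.W.eval t * p 1 - D.Y.eval t)) +
      evalXYT (Polynomial.derivative D.circlePoly) p t *
        PowerSeries.constantCoeff (PowerSeries.derivative ℂ τ) := by
  have hX (i : Fin 2) : PowerSeries.constantCoeff
      (PowerSeries.derivative ℂ (lineHom p v (MvPolynomial.X i))) = v i := by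
    simp [lineHom_X]
  rw [eval_map_lineHom_circlePoly, evalXYT_derivative_circlePoly]
  simp only [map_sub, map_add, Derivation.leibniz_pow, Derivation.leibniz, smul_eq_mul, map_mul,
    map_pow, constantCoeff_aeval, constantCoeff_derivative_aeval, constantCoeff_lineHom, hX, hτ,
    eval_X, PowerSeries.constantCoeff_C, PowerSeries.derivative_C, nsmul_eq_mul, map_zero,
    Nat.cast_ofNat, map_ofNat]
  ring

theorem IsCoverPoint.W_mul_offsetPoint_zero_sub_X (h : D.IsCoverPoint t s) :
    D.W.eval t * D.offsetPoint t s 0 - D.X.eval t = D.W.eval t * (D.d / s) * D.V.eval t := by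
  obtain ⟨hW, hs0, -⟩ := h
  simp only [offsetPoint, offsetX, Matrix.cons_val_zero]
  field_simp
  ring

theorem IsCoverPoint.W_mul_offsetPoint_one_sub_Y (h : D.IsCoverPoint t s) :
    D.W.eval t * D.offsetPoint t s 1 - D.Y.eval t = -(D.W.eval t * (D.d / s) * D.U.eval t) := by
  obtain ⟨hW, hs0, -⟩ := h
  simp only [offsetPoint, offsetY, Matrix.cons_val_one, Matrix.cons_val_fin_one]
  field_simp
  ring

-- The offset is part of the envelope of the circles.
theorem IsCoverPoint.evalXYT_derivative_circlePoly_eq_zero (h : D.IsCoverPoint t s) :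
    evalXYT (Polynomial.derivative D.circlePoly) (D.offsetPoint t s) t = 0 := by
  have hX := h.W_mul_offsetPoint_zero_sub_X
  have hY := h.W_mul_offsetPoint_one_sub_Y
  have hsq := h.sq
  have hds : D.d / s * s = D.d := div_mul_cancel₀ _ h.2.1
  have hU := D.eval_U t
  have hV := D.eval_V t
  rw [evalXYT_derivative_circlePoly]
  linear_combination
    2 * (D.W.derivative.eval t * D.offsetPoint t s 0 - D.X.derivative.eval t) * hX +
    2 * (D.d / s) * D.V.eval t * D.W.derivative.eval t * hX +
    2 * (D.W.derivative.eval t * D.offsetPoint t s 1 - D.Y.derivative.eval t) * hY -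
    2 * (D.d / s) * D.U.eval t * D.W.derivative.eval t * hY +
    2 * (D.d / s) * D.V.eval t * hU - 2 * (D.d / s) * D.U.eval t * hV -
    2 * D.W.eval t * D.W.derivative.eval t * (D.d / s) ^ 2 * hsq +
    2 * D.W.eval t * D.W.derivative.eval t * (D.d / s * s + D.d) * hds

theorem IsCoverPoint.order_circlePoly_eq_one (h : D.IsCoverPoint t s)
    (hv : D.V.eval t * v 0 - D.U.eval t * v 1 ≠ 0) (hτ : PowerSeries.constantCoeff τ = t) :
    ((D.circlePoly.map (lineHom (D.offsetPoint t s) v)).eval τ).order = 1 := by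
  apply order_eq_one_of_constantCoeff_derivative_ne_zero
  · have hzero := h.evalXYT_circlePoly_eq_zero
    rw [evalXYT_circlePoly] at hzero
    simpa only [eval_map_lineHom_circlePoly, map_sub, map_add, map_mul, map_pow,
      constantCoeff_aeval, constantCoeff_lineHom, hτ, eval_X, PowerSeries.constantCoeff_C]
      using hzero
  · have hderiv : 2 * D.W.eval t ^ 2 * (D.d / s) * (D.V.eval t * v 0 - D.U.eval t * v 1) ≠ 0 :=
      mul_ne_zero (mul_ne_zero (mul_ne_zero two_ne_zero (pow_ne_zero _ h.1))
        (div_ne_zero D.d_ne_zero h.2.1)) hv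
    rw [constantCoeff_derivative_circlePoly _ _ hτ, h.evalXYT_derivative_circlePoly_eq_zero,
      h.W_mul_offsetPoint_zero_sub_X, h.W_mul_offsetPoint_one_sub_Y]
    convert hderiv using 1
    ring

end OffsetData

namespace OffsetResultant

variable {D : OffsetData} (R : OffsetResultant D)

/-- `p` is a point of the curve `f = 0` in general position: the multiplicity of `f` as a factor of
`f ^ a * h = R.H` can be read off there, where `f * g = 0` is an equation of the offset. -/
structure IsGeneric (f g h : PolyXY) (p : Fin 2 → ℂ) : Prop where
  mem : eval p f = 0
  eval_exceptional_ne_zero : eval p R.exceptional ≠ 0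
  eval_left_ne_zero : eval p g ≠ 0
  eval_right_ne_zero : eval p h ≠ 0
  smooth : ∃ i, eval p (pderiv i f) ≠ 0
  not_isCritical : ∀ t s, D.IsCoverPoint t s → D.offsetPoint t s = p → ¬ D.IsCritical t s

variable {R} {f g h : PolyXY} {p v : Fin 2 → ℂ} {t s : ℂ} {a : ℕ}

theorem finite_not_isGeneric (hf : R.IsNonlinearFactor f) (hfg : ¬ f ∣ g) (hfh : ¬ f ∣ h) :
    {p | p ∈ planeCurve f ∧ ¬ R.IsGeneric f g h p}.Finite := by
  have hcrit := D.finite_offsetPoint_of_finite D.finite_isCritical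
  refine ((((hcrit.union (finite_common_zeros hf.1 (R.not_dvd_exceptional hf.1 hf.2.1))).union
    (finite_common_zeros hf.1 hfg)).union (finite_common_zeros hf.1 hfh)).union
    (finite_singular_points hf.1)).subset ?_
  rintro p ⟨hp, hgeneric⟩
  by_contra hnot
  simp only [Set.mem_union, not_or] at hnot
  obtain ⟨⟨⟨⟨hcrit, hexc⟩, hg⟩, hh⟩, hsing⟩ := hnot
  refine hgeneric ⟨hp, fun h0 => hexc ⟨hp, h0⟩, fun h0 => hg ⟨hp, h0⟩, fun h0 => hh ⟨hp, h0⟩, ?_,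
    fun t s hs hts hc => hcrit ⟨t, ⟨s, hs, hc⟩, s, hs, hts⟩⟩
  by_contra! h0
  exact hsing ⟨hp, h0⟩

namespace IsGeneric

theorem gradient_normal (hp : R.IsGeneric f g h (D.offsetPoint t s)) (hs : D.IsCoverPoint t s)
    (hzero : ∀ t s, D.IsCoverPoint t s → eval (D.offsetPoint t s) (f * g) = 0) :
    eval (D.offsetPoint t s) (pderiv 0 f) * D.U.eval t +
      eval (D.offsetPoint t s) (pderiv 1 f) * D.V.eval t = 0 := by
  obtain ⟨σ, hσ, rfl⟩ := hs.exists_isBranch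
  have hnormal := hσ.gradient_normal (hσ.2.mono fun u hu => hzero u _ hu)
    (hp.not_isCritical t _ hs rfl)
  simp only [Derivation.leibniz, smul_eq_mul, map_add, map_mul, hp.mem, zero_mul, zero_add]
    at hnormal
  apply mul_left_cancel₀ hp.eval_left_ne_zero
  linear_combination hnormal

theorem exists_transversal (hp : R.IsGeneric f g h p) :
    ∃ v : Fin 2 → ℂ, ∑ i, v i * eval p (pderiv i f) ≠ 0 := by
  obtain ⟨i, hi⟩ := hp.smooth
  exact ⟨Pi.single i 1, by simpa [Pi.single_apply] using hi⟩

theorem order_lineHom_H (hp : R.IsGeneric f g h p) (hH : R.H = f ^ a * h)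
    (hv : ∑ i, v i * eval p (pderiv i f) ≠ 0) : (lineHom p v R.H).order = a := by
  have hf : (lineHom p v f).order = 1 := order_eq_one_of_constantCoeff_derivative_ne_zero
    ((constantCoeff_lineHom p v f).trans hp.mem) (by rwa [constantCoeff_derivative_lineHom])
  have hh : (lineHom p v h).order = 0 :=
    not_imp_comm.1 PowerSeries.order_ne_zero_iff_constCoeff_eq_zero.1
      (by rw [constantCoeff_lineHom]; exact hp.eval_right_ne_zero)
  rw [hH, map_mul, map_pow, PowerSeries.order_mul, PowerSeries.order_pow, hf, hh, add_zero,
    nsmul_one]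

theorem common_root_iff (hp : R.IsGeneric f g h p) :
    evalXYT R.P p t = 0 ∧ evalXYT R.Q p t = 0 ↔
      ∃ s, D.IsCoverPoint t s ∧ D.offsetPoint t s = p := by
  refine ⟨fun hroot => exists_offsetPoint_eq_of_common_root hp.eval_exceptional_ne_zero hroot.1
    hroot.2, ?_⟩
  rintro ⟨s, hs, rfl⟩
  exact ⟨(evalXYT_P_eq_zero_iff hs _).2 hs.evalXYT_normalPoly_eq_zero,
    (evalXYT_Q_eq_zero_iff hs _).2 hs.evalXYT_circlePoly_eq_zero⟩

theorem evalXYT_derivative_P_ne_zero (hp : R.IsGeneric f g h (D.offsetPoint t s))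
    (hs : D.IsCoverPoint t s) :
    evalXYT (Polynomial.derivative R.P) (D.offsetPoint t s) t ≠ 0 := by
  intro h0
  obtain ⟨⟨c, hc⟩, -⟩ := R.hP
  refine hp.not_isCritical t s hs rfl (hs.isCritical_iff.2 ?_)
  rw [hc, Polynomial.derivative_mul, evalXYT_add, evalXYT_mul, evalXYT_mul, h0,
    (evalXYT_P_eq_zero_iff hs _).2 hs.evalXYT_normalPoly_eq_zero, mul_zero, mul_zero, add_zero]

theorem order_Q_eq_one (hp : R.IsGeneric f g h (D.offsetPoint t s)) (hs : D.IsCoverPoint t s)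
    (hzero : ∀ t s, D.IsCoverPoint t s → eval (D.offsetPoint t s) (f * g) = 0)
    (hv : ∑ i, v i * eval (D.offsetPoint t s) (pderiv i f) ≠ 0) {τ : PowerSeries ℂ}
    (hτ : PowerSeries.constantCoeff τ = t) :
    ((R.Q.map (lineHom (D.offsetPoint t s) v)).eval τ).order = 1 := by
  have hgrad := hp.gradient_normal hs hzero
  have htransversal : D.V.eval t * v 0 - D.U.eval t * v 1 ≠ 0 := by
    intro h0
    have hS := hs.eval_S_ne_zero
    rw [← hs.2.2, hs.sq] at hS
    apply hv
    rw [Fin.sum_univ_two]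
    apply mul_left_cancel₀ hS
    linear_combination (D.U.eval t * v 0 + D.V.eval t * v 1) * hgrad +
      (D.V.eval t * eval (D.offsetPoint t s) (pderiv 0 f) -
        D.U.eval t * eval (D.offsetPoint t s) (pderiv 1 f)) * h0
  obtain ⟨⟨c, hc⟩, -⟩ := R.hQ
  obtain ⟨q, hq⟩ := hs.exists_evalXYT_circlePoly_ne_zero
  have hcontent : (Polynomial.aeval τ c).order = 0 :=
    not_imp_comm.1 PowerSeries.order_ne_zero_iff_constCoeff_eq_zero.1
      (by rw [constantCoeff_aeval, hτ]; exact eval_content_ne_zero hc hq)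
  have horder := hs.order_circlePoly_eq_one htransversal hτ
  rwa [hc, Polynomial.map_mul, Polynomial.eval_mul, eval_map_lineHom_map_C, PowerSeries.order_mul,
    hcontent, zero_add] at horder

-- Restricted to a line transversal to `f = 0` at `p`, the resultant vanishes to order `a`, and the
-- lift of each of the simple common roots of `P` and `Q` contributes `1` to this order.
theorem encard_params (hp : R.IsGeneric f g h p) (hH : R.H = f ^ a * h)
    (hzero : ∀ t s, D.IsCoverPoint t s → eval (D.offsetPoint t s) (f * g) = 0) :
    {t | ∃ s, D.IsCoverPoint t s ∧ D.offsetPoint t s = p}.encard = a := by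
  obtain ⟨v, hv⟩ := hp.exists_transversal
  have hfin := D.finite_offsetPoint_eq p
  have hlead : PowerSeries.constantCoeff (lineHom p v R.P.leadingCoeff) ≠ 0 := by
    rw [constantCoeff_lineHom]
    exact eval_leadingCoeff_P_ne_zero hp.eval_exceptional_ne_zero
  have hdeg : (R.P.map (lineHom p v)).natDegree = R.P.natDegree :=
    Polynomial.natDegree_map_of_leadingCoeff_ne_zero _ (ne_zero_of_map hlead)
  have hmap (g : Polynomial PolyXY) (z : ℂ) :
      ((g.map (lineHom p v)).map PowerSeries.constantCoeff).eval z = evalXYT g p z := by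
    rw [Polynomial.map_map, constantCoeff_comp_lineHom, evalXYT]
  have horder := order_resultant_eq_card (p := R.P.map (lineHom p v))
    (q := R.Q.map (lineHom p v)) (k := R.Q.natDegree)
    (by rwa [Polynomial.leadingCoeff, hdeg, Polynomial.coeff_map])
    Polynomial.natDegree_map_le hfin.toFinset
    (fun z => by rw [hmap, hmap, hp.common_root_iff, Set.Finite.mem_toFinset, Set.mem_ofPred_eq])
    (fun z hz => by
      obtain ⟨s, hs, rfl⟩ := hfin.mem_toFinset.1 hz
      rw [Polynomial.derivative_map, hmap]
      exact hp.evalXYT_derivative_P_ne_zero hs)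
    (fun z hz τ hτ _ => by
      obtain ⟨s, hs, rfl⟩ := hfin.mem_toFinset.1 hz
      exact hp.order_Q_eq_one hs hzero hv hτ)
  rw [hdeg, Polynomial.resultant_map_map] at horder
  rw [hfin.encard_eq_coe_toFinset_card, ← horder]
  exact hp.order_lineHom_H hH hv

end IsGeneric

end OffsetResultant

/-! ### Unit normals and the number of generators -/

section Denominators

variable {σ K S : Type*} [Field K] [CommRing S] [Algebra K S]

-- The pair `(A, k)` does not depend on `φ`: the same numerator serves in the function field and at
-- every value of the parameter.
theorem exists_pow_mul_eval₂_div_eq (x : σ → S) (w : S) (f : MvPolynomial σ K) :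
    ∃ (A : S) (k : ℕ), ∀ {L : Type*} [Field L] (φ : S →+* L), φ w ≠ 0 →
      φ w ^ k * eval₂ (φ.comp (algebraMap K S)) (fun i => φ (x i) / φ w) f = φ A := by
  induction f using MvPolynomial.induction_on with
  | C a => exact ⟨algebraMap K S a, 0, fun φ _ => by simp⟩
  | add f g hf hg =>
    obtain ⟨A, k, hf⟩ := hf
    obtain ⟨B, l, hg⟩ := hg
    refine ⟨w ^ l * A + w ^ k * B, k + l, fun φ hw => ?_⟩
    rw [eval₂_add, map_add, map_mul, map_mul, map_pow, map_pow, ← hf φ hw, ← hg φ hw]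
    ring
  | mul_X f i hf =>
    obtain ⟨A, k, hf⟩ := hf
    refine ⟨A * x i, k + 1, fun φ hw => ?_⟩
    rw [eval₂_mul, eval₂_X, map_mul, ← hf φ hw]
    field_simp
    ring

theorem trdeg_fractionRing_polynomial :
    Algebra.trdeg K (FractionRing (Polynomial K)) = 1 := by
  have halg : Algebra.IsAlgebraic (Polynomial K) (FractionRing (Polynomial K)) :=
    IsLocalization.isAlgebraic _ (nonZeroDivisors (Polynomial K))
  rw [← trdeg_add_eq K (Polynomial K), Polynomial.trdeg_of_isDomain,
    trdeg_eq_zero, add_zero]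

end Denominators

theorem encard_biUnion_of_forall_encard_eq {α ι : Type*} {t : Set ι} {s : ι → Set α} {n : ℕ∞}
    (ht : t.Finite) (hs : t.PairwiseDisjoint s) (hn : ∀ i ∈ t, (s i).encard = n) :
    (⋃ i ∈ t, s i).encard = t.encard * n := by
  rw [ht.encard_biUnion hs, finsum_mem_congr rfl hn, finsum_mem_eq_finite_toFinset_sum _ ht,
    Finset.sum_const, nsmul_eq_mul, ht.encard_eq_coe_toFinset_card]

theorem mul_eq_mul_of_orthogonal {K : Type*} [Field K] {a b u v u' v' : K}
    (hab : a ≠ 0 ∨ b ≠ 0) (h : a * u + b * v = 0) (h' : a * u' + b * v' = 0) :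
    u * v' = v * u' := by
  rcases hab with ha | hb
  · exact mul_left_cancel₀ ha (by linear_combination v' * h - v * h')
  · exact mul_left_cancel₀ hb (by linear_combination u * h' - u' * h)

namespace OffsetData

noncomputable section

variable (D : OffsetData)

/-- The plane curve parametrized by `(X / W, Y / W)`. -/
def curve : Set (Fin 2 → ℂ) := zariskiClosure {p | ∃ t, D.W.eval t ≠ 0 ∧ p = D.point t}

/-- The parameters of a point of the curve. -/
def fibre (p : Fin 2 → ℂ) : Set ℂ := {t | D.W.eval t ≠ 0 ∧ D.point t = p}

theorem finite_fibre (p : Fin 2 → ℂ) : (D.fibre p).Finite := by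
  have hne : D.X - Polynomial.C (p 0) * D.W ≠ 0 := fun h => one_ne_zero
    (D.no_line 1 0 (p 0) (by simpa using sub_eq_zero.1 h)).1
  refine (Polynomial.finite_setOfPred_isRoot hne).subset ?_
  rintro t ⟨hW, rfl⟩
  simp [point, hW]

section CurveEquation

/-- The generic point of the curve, with coordinates in the function field of the parameter line. -/
def genericPoint (i : Fin 2) : FractionRing (Polynomial ℂ) :=
  algebraMap _ _ (![D.X, D.Y] i) / algebraMap _ _ D.W

theorem exists_numerator (f : PolyXY) : ∃ (A : Polynomial ℂ) (k : ℕ),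
    (∀ t, D.W.eval t ≠ 0 → D.W.eval t ^ k * eval (D.point t) f = A.eval t) ∧
      algebraMap _ (FractionRing (Polynomial ℂ)) D.W ^ k * aeval D.genericPoint f =
        algebraMap _ _ A := by
  obtain ⟨A, k, hA⟩ := exists_pow_mul_eval₂_div_eq ![D.X, D.Y] D.W f
  refine ⟨A, k, fun t hW => ?_, ?_⟩
  · have hcoeff : (Polynomial.evalRingHom t).comp (algebraMap ℂ (Polynomial ℂ)) = RingHom.id ℂ :=
      RingHom.ext fun a => Polynomial.eval_C
    have hcoord : (fun i => (![D.X, D.Y] i).eval t / D.W.eval t) = D.point t := by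
      ext i
      fin_cases i <;> rfl
    simpa only [hcoeff, Polynomial.coe_evalRingHom, hcoord, eval₂_id] using
      hA (Polynomial.evalRingHom t) hW
  · exact hA _ (mt (IsFractionRing.to_map_eq_zero_iff).1 D.W_ne_zero)

theorem exists_curve_equation :
    ∃ f : PolyXY, f ≠ 0 ∧ ∀ t, D.W.eval t ≠ 0 → eval (D.point t) f = 0 := by
  have hdep : ¬ AlgebraicIndependent ℂ D.genericPoint := fun h => by
    simpa [trdeg_fractionRing_polynomial] using h.cardinalMk_le_trdeg
  rw [algebraicIndependent_iff] at hdep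
  push Not at hdep
  obtain ⟨f, hf, hne⟩ := hdep
  obtain ⟨A, k, hpoint, hgeneric⟩ := D.exists_numerator f
  rw [hf, mul_zero, eq_comm, IsFractionRing.to_map_eq_zero_iff] at hgeneric
  refine ⟨f, hne, fun t ht => ?_⟩
  simpa [hgeneric, ht] using hpoint t ht

variable {D} {f : PolyXY} {t : ℂ}

theorem eval_point_eq_zero_of_infinite
    (hf : {t | D.W.eval t ≠ 0 ∧ eval (D.point t) f = 0}.Infinite) (ht : D.W.eval t ≠ 0) :
    eval (D.point t) f = 0 := by
  obtain ⟨A, k, hA, -⟩ := D.exists_numerator f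
  have hA0 : A = 0 := Polynomial.eq_zero_of_infinite_isRoot _ (hf.mono fun u hu => by
    rw [Set.mem_ofPred_eq, Polynomial.IsRoot.def, ← hA u hu.1, hu.2, mul_zero])
  simpa [hA0, ht] using hA t ht

variable (D)

theorem vanishingIdeal_image_isPrime :
    (vanishingIdeal ℂ {p | ∃ t, D.W.eval t ≠ 0 ∧ p = D.point t}).IsPrime := by
  have hW : {t | D.W.eval t ≠ 0}.Infinite :=
    (Polynomial.finite_setOfPred_isRoot D.W_ne_zero).infinite_compl
  have hmem {f : PolyXY} (hf : {t | D.W.eval t ≠ 0 ∧ eval (D.point t) f = 0}.Infinite) :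
      f ∈ vanishingIdeal ℂ {p | ∃ t, D.W.eval t ≠ 0 ∧ p = D.point t} := by
    rintro _ ⟨t, ht, rfl⟩
    exact eval_point_eq_zero_of_infinite hf ht
  refine ⟨?_, fun {f g} hfg => ?_⟩
  · rw [Ideal.ne_top_iff_one]
    intro hone
    obtain ⟨t, ht⟩ := hW.nonempty
    simpa using hone (D.point t) ⟨t, ht, rfl⟩
  · by_contra! hne
    refine hW ((Set.not_infinite.1 (mt hmem hne.1)).union (Set.not_infinite.1 (mt hmem hne.2))
      |>.subset fun t ht => ?_)
    have h0 : eval (D.point t) (f * g) = 0 := hfg _ ⟨t, ht, rfl⟩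
    rw [map_mul, mul_eq_zero] at h0
    exact h0.imp (⟨ht, ·⟩) (⟨ht, ·⟩)

theorem exists_irreducible_curve_equation :
    ∃ f : PolyXY, Irreducible f ∧ ∀ t, D.W.eval t ≠ 0 → eval (D.point t) f = 0 := by
  obtain ⟨g, hg, hzero⟩ := D.exists_curve_equation
  obtain ⟨f, hf, -, hsub⟩ := exists_irreducible_factor_mem_vanishingIdeal hg
    D.vanishingIdeal_image_isPrime (by rintro _ ⟨t, ht, rfl⟩; exact hzero t ht)
  exact ⟨f, hf, fun t ht => hsub ⟨t, ht, rfl⟩⟩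

variable {D}

theorem gradient_curve_normal (hf : ∀ t, D.W.eval t ≠ 0 → eval (D.point t) f = 0)
    (ht : D.W.eval t ≠ 0) :
    eval (D.point t) (pderiv 0 f) * D.U.eval t + eval (D.point t) (pderiv 1 f) * D.V.eval t =
      0 := by
  have hderiv := hasDerivAt_eval_mvPolynomial f
    ((D.X.hasDerivAt t).fun_div (D.W.hasDerivAt t) ht)
    ((D.Y.hasDerivAt t).fun_div (D.W.hasDerivAt t) ht)
  have hconst : (fun u => eval (D.point u) f) =ᶠ[𝓝 t] fun _ => 0 := by
    filter_upwards [D.W.continuous.continuousAt.eventually_ne ht] with u hu using hf u hu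
  have hchain := hderiv.unique ((hasDerivAt_const t (0 : ℂ)).congr_of_eventuallyEq hconst)
  rw [← eval_U, ← eval_V] at hchain
  change eval (D.point t) _ * _ + eval (D.point t) _ * _ = 0 at hchain
  field_simp at hchain
  rwa [mul_zero] at hchain

end CurveEquation

section UnitNormals

/-- The unit normal vector of the curve at the cover point `(t, s)`. -/
def unitNormal (t s : ℂ) : Fin 2 → ℂ := ![D.V.eval t / s, -(D.U.eval t / s)]

theorem offsetPoint_eq (t s : ℂ) : D.offsetPoint t s = D.point t + D.d • D.unitNormal t s := by
  ext i
  fin_cases i <;> simp [offsetPoint, offsetX, offsetY, point, unitNormal] <;> ring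

theorem unitNormal_neg (t s : ℂ) : D.unitNormal t (-s) = -D.unitNormal t s := by
  ext i
  fin_cases i <;> simp [unitNormal, div_neg]

variable {D} {t s t' s' : ℂ}

theorem IsCoverPoint.unitNormal_ne_zero (h : D.IsCoverPoint t s) : D.unitNormal t s ≠ 0 := by
  intro h0
  have hV := congrFun h0 0
  have hU := congrFun h0 1
  simp only [unitNormal, Matrix.cons_val_zero, Matrix.cons_val_one, Pi.zero_apply, neg_eq_zero,
    Matrix.cons_val_fin_one, div_eq_zero_iff, h.2.1, or_false] at hV hU
  refine h.eval_S_ne_zero ?_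
  rw [← h.2.2, h.sq, hV, hU]
  ring

theorem IsCoverPoint.exists_velocity_eq_mul (h : D.IsCoverPoint t s)
    (hparallel : D.U.eval t * D.V.eval t' = D.V.eval t * D.U.eval t') :
    ∃ l, D.U.eval t' = l * D.U.eval t ∧ D.V.eval t' = l * D.V.eval t := by
  have hs := h.2.1
  refine ⟨(D.U.eval t * D.U.eval t' + D.V.eval t * D.V.eval t') / s ^ 2, ?_, ?_⟩
  · field_simp
    linear_combination D.U.eval t' * h.sq - D.V.eval t * hparallel
  · field_simp
    linear_combination D.V.eval t' * h.sq + D.U.eval t * hparallel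

theorem unitNormal_eq_or_eq_neg (h : D.IsCoverPoint t s) (h' : D.IsCoverPoint t' s')
    (hparallel : D.U.eval t * D.V.eval t' = D.V.eval t * D.U.eval t') :
    D.unitNormal t' s' = D.unitNormal t s ∨ D.unitNormal t' s' = -D.unitNormal t s := by
  obtain ⟨l, hU, hV⟩ := h.exists_velocity_eq_mul hparallel
  have hsq : s' ^ 2 = (l * s) ^ 2 := by
    rw [h'.sq, hU, hV]
    linear_combination -l ^ 2 * h.sq
  have hl : l ≠ 0 := by
    rintro rfl
    exact h'.2.1 (by simpa using hsq)
  refine (sq_eq_sq_iff_eq_or_eq_neg.1 hsq).imp (fun hs' => ?_) fun hs' => ?_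
  · simp only [unitNormal, hs', hU, hV, mul_div_mul_left _ _ hl]
  · rw [hs', unitNormal_neg]
    simp only [unitNormal, hU, hV, mul_div_mul_left _ _ hl]

theorem exists_unitNormal_eq (h : D.IsCoverPoint t s) (h' : D.IsCoverPoint t' s')
    (hparallel : D.U.eval t * D.V.eval t' = D.V.eval t * D.U.eval t') :
    ∃ r, D.IsCoverPoint t' r ∧ D.unitNormal t' r = D.unitNormal t s := by
  rcases unitNormal_eq_or_eq_neg h h' hparallel with heq | heq
  · exact ⟨s', h', heq⟩
  · exact ⟨-s', h'.neg, by rw [unitNormal_neg, heq, neg_neg]⟩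

theorem parallel_of_unitNormal_eq (h : D.IsCoverPoint t s) (h' : D.IsCoverPoint t' s')
    (heq : D.unitNormal t' s' = D.unitNormal t s) :
    D.U.eval t * D.V.eval t' = D.V.eval t * D.U.eval t' := by
  have hs := h.2.1
  have hs' := h'.2.1
  have hV := congrFun heq 0
  have hU := congrFun heq 1
  simp only [unitNormal, Matrix.cons_val_zero, Matrix.cons_val_one, Matrix.cons_val_fin_one,
    neg_inj] at hV hU
  field_simp at hV hU
  exact mul_left_cancel₀ hs (by linear_combination D.U.eval t * hV - D.V.eval t * hU)

theorem IsCoverPoint.finite_parallel (h : D.IsCoverPoint t s) :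
    {t' | D.U.eval t * D.V.eval t' = D.V.eval t * D.U.eval t'}.Finite := by
  have hne : Polynomial.C (-D.V.eval t) * D.U + Polynomial.C (D.U.eval t) * D.V ≠ 0 := by
    intro h0
    obtain ⟨hV, hU⟩ := D.eq_zero_of_C_mul_U_add_C_mul_V_eq_zero h0
    refine h.eval_S_ne_zero ?_
    rw [← h.2.2, h.sq, hU, neg_eq_zero.1 hV]
    ring
  refine (Polynomial.finite_setOfPred_isRoot hne).subset fun t' ht' => ?_
  simp only [Set.mem_ofPred_eq] at ht'
  simp [ht']

end UnitNormals

section TracingIndex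

/-- The points of the curve that generate the offset point `p`. -/
def generators (p : Fin 2 → ℂ) : Set (Fin 2 → ℂ) :=
  {z | ∃ t s, D.IsCoverPoint t s ∧ D.offsetPoint t s = p ∧ z = D.point t}

/-- The parametrization has tracing index `n`: all but finitely many points of the curve have
exactly `n` parameters. -/
def HasTracingIndex (n : ℕ) : Prop := {p | p ∈ D.curve ∧ (D.fibre p).encard ≠ n}.Finite

/-- The point of the parameter `t` has `n` parameters, and each of them generates the same offset
points as `t`. -/
def IsRegularParam (n : ℕ) (t : ℂ) : Prop :=
  (D.fibre (D.point t)).encard = n ∧ ∀ s, D.IsCoverPoint t s → ∀ u ∈ D.fibre (D.point t),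
    ∃ r, D.IsCoverPoint u r ∧ D.offsetPoint u r = D.offsetPoint t s

variable {D} {n : ℕ} {p : Fin 2 → ℂ}

variable (D) in
theorem mem_curve {t : ℂ} (ht : D.W.eval t ≠ 0) : D.point t ∈ D.curve :=
  subset_zariskiClosure _ ⟨t, ht, rfl⟩

variable (D) in
theorem finite_param_mem {T : Set (Fin 2 → ℂ)} (hT : T.Finite) :
    {t | D.W.eval t ≠ 0 ∧ D.point t ∈ T}.Finite :=
  (hT.biUnion fun p _ => D.finite_fibre p).subset fun _ ht => Set.mem_biUnion ht.2 ⟨ht.1, rfl⟩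

theorem HasTracingIndex.finite_params (hn : D.HasTracingIndex n) :
    {t | D.W.eval t ≠ 0 ∧ (D.fibre (D.point t)).encard ≠ n}.Finite :=
  (D.finite_param_mem hn).subset fun _ ht => ⟨ht.1, D.mem_curve ht.1, ht.2⟩

theorem HasTracingIndex.ne_zero (hn : D.HasTracingIndex n) : n ≠ 0 := by
  rintro rfl
  obtain ⟨t, s, ht, hs⟩ := D.exists_isCoverPoint_notMem hn.finite_params
  refine ht ⟨hs.1, ?_⟩
  rw [Nat.cast_zero, Set.encard_ne_zero]
  exact ⟨t, hs.1, rfl⟩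

-- At a smooth point of the curve all parameters have the same tangent.
theorem HasTracingIndex.finite_not_isRegularParam (hn : D.HasTracingIndex n) :
    {t | D.W.eval t ≠ 0 ∧ ¬ D.IsRegularParam n t}.Finite := by
  obtain ⟨f, hf, hzero⟩ := D.exists_irreducible_curve_equation
  refine ((hn.finite_params.union (D.finite_param_mem (finite_singular_points hf))).union
    (D.finite_param_mem (D.finite_not_exists_isCoverPoint.image D.point))).subset ?_
  rintro t ⟨hW, hregular⟩
  by_contra hgood
  simp only [Set.mem_union, Set.mem_ofPred_eq, not_or, not_and, not_forall] at hgood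
  obtain ⟨⟨hcard, hsmooth⟩, hcover⟩ := hgood
  refine hregular ⟨not_not.1 (hcard hW), fun s hs u hu => ?_⟩
  obtain ⟨r, hr⟩ : ∃ r, D.IsCoverPoint u r := by
    by_contra hu'
    exact hcover hW ⟨u, hu', hu.2⟩
  have hgradient : eval (D.point t) (pderiv 0 f) ≠ 0 ∨ eval (D.point t) (pderiv 1 f) ≠ 0 := by
    simpa [Fin.exists_fin_two] using hsmooth hW (hzero t hW)
  have hnormal := gradient_curve_normal hzero hu.1
  rw [hu.2] at hnormal
  obtain ⟨r, hr, heq⟩ := exists_unitNormal_eq hs hr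
    (mul_eq_mul_of_orthogonal hgradient (gradient_curve_normal hzero hW) hnormal)
  exact ⟨r, hr, by rw [offsetPoint_eq, offsetPoint_eq, heq, hu.2]⟩

end TracingIndex

section OppositeNormals

/-- Any two cover points over `p` have the same curve point or opposite normals. -/
def HasOppositeNormals (p : Fin 2 → ℂ) : Prop :=
  ∀ t s t' s', D.IsCoverPoint t s → D.IsCoverPoint t' s' → D.offsetPoint t s = p →
    D.offsetPoint t' s' = p → D.point t' = D.point t ∨ D.unitNormal t' s' = -D.unitNormal t s

variable {D} {n : ℕ} {p : Fin 2 → ℂ}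

theorem params_eq_biUnion_fibre
    (hregular : ∀ t s, D.IsCoverPoint t s → D.offsetPoint t s = p → D.IsRegularParam n t) :
    {t | ∃ s, D.IsCoverPoint t s ∧ D.offsetPoint t s = p} = ⋃ z ∈ D.generators p, D.fibre z := by
  ext t
  simp only [Set.mem_iUnion, Set.mem_ofPred_eq]
  constructor
  · rintro ⟨s, hs, hp⟩
    exact ⟨D.point t, ⟨t, s, hs, hp, rfl⟩, hs.1, rfl⟩
  · rintro ⟨z, ⟨u, s, hs, hp, rfl⟩, ht⟩
    obtain ⟨r, hr, hr'⟩ := (hregular u s hs hp).2 s hs t ht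
    exact ⟨r, hr, hr'.trans hp⟩

variable (D) in
theorem finite_generators (p : Fin 2 → ℂ) : (D.generators p).Finite := by
  refine ((D.finite_offsetPoint_eq p).image D.point).subset ?_
  rintro z ⟨t, s, hs, hp, rfl⟩
  exact ⟨t, ⟨s, hs, hp⟩, rfl⟩

theorem encard_params
    (hregular : ∀ t s, D.IsCoverPoint t s → D.offsetPoint t s = p → D.IsRegularParam n t) :
    {t | ∃ s, D.IsCoverPoint t s ∧ D.offsetPoint t s = p}.encard =
      (D.generators p).encard * n := by
  rw [params_eq_biUnion_fibre hregular]
  refine encard_biUnion_of_forall_encard_eq (D.finite_generators p) (fun z _ z' _ hne => ?_) ?_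
  · exact Set.disjoint_left.2 fun u hz hz' => hne (hz.2.symm.trans hz'.2)
  · rintro z ⟨t, s, hs, hp, rfl⟩
    exact (hregular t s hs hp).1

-- A second generator can only be the reflection `p + d N` of the first one `p - d N`.
theorem HasOppositeNormals.encard_generators (hopposite : D.HasOppositeNormals p)
    (hp : D.IsGenerated p) : (D.generators p).encard = 1 ∨ (D.generators p).encard = 2 := by
  obtain ⟨t, s, hs, hq⟩ := hp
  have hne : (D.generators p).Nonempty := ⟨D.point t, t, s, hs, hq, rfl⟩
  have hsub : D.generators p ⊆ {D.point t, p + D.d • D.unitNormal t s} := by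
    rintro z ⟨t', s', hs', hq', rfl⟩
    refine (hopposite t s t' s' hs hs' hq hq').imp_right fun hneg => ?_
    rw [Set.mem_singleton_iff, ← hq', offsetPoint_eq, hneg, smul_neg, neg_add_cancel_right]
  rcases hne.subset_pair_iff_eq.1 hsub with heq | heq | heq
  · exact Or.inl (by rw [heq, Set.encard_singleton])
  · exact Or.inl (by rw [heq, Set.encard_singleton])
  · rw [heq]
    rcases eq_or_ne (D.point t) (p + D.d • D.unitNormal t s) with hpair | hpair
    · exact Or.inl (by rw [hpair, Set.pair_eq_singleton, Set.encard_singleton])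
    · exact Or.inr (Set.encard_pair hpair)

end OppositeNormals

end

end OffsetData

section Algebra

theorem exists_mem_add_notMem_of_finite {M : Type*} [AddCommGroup M] [IsAddTorsionFree M]
    {A : Set M} (hA : A.Finite) (hne : A.Nonempty) {w : M} (hw : w ≠ 0) :
    ∃ z ∈ A, z + w ∉ A := by
  by_contra! hadd
  obtain ⟨z, hz⟩ := hne
  have hmem (k : ℕ) : z + k • w ∈ A := by
    induction k with
    | zero => simpa using hz
    | succ k ih => rw [succ_nsmul, ← add_assoc]; exact hadd _ ih
  have hinj : Function.Injective fun k : ℕ => k • w :=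
    injective_nsmul_iff_not_isOfFinAddOrder.2 (not_isOfFinAddOrder_of_isAddTorsionFree hw)
  exact Set.infinite_of_injective_forall_mem ((add_right_injective z).comp hinj) hmem hA

theorem isRelPrime_of_forall_irreducible {α : Type*} [CommMonoidWithZero α] [WfDvdMonoid α]
    {a b : α} (ha : a ≠ 0) (h : ∀ l, Irreducible l → l ∣ a → ¬ l ∣ b) : IsRelPrime a b := by
  intro k hka hkb
  by_contra hk
  obtain ⟨l, hl, hlk⟩ := WfDvdMonoid.exists_irreducible_factor hk (ne_zero_of_dvd_ne_zero ha hka)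
  exact h l hl (hlk.trans hka) (hlk.trans hkb)

theorem associated_of_mul_eq_mul {α : Type*} [CommMonoidWithZero α] [IsCancelMulZero α]
    [DecompositionMonoid α] {a b c d : α} (h : a * b = c * d) (had : IsRelPrime a d)
    (hcb : IsRelPrime c b) : Associated a c :=
  associated_of_dvd_dvd (had.dvd_of_dvd_mul_right ⟨b, h.symm⟩) (hcb.dvd_of_dvd_mul_right ⟨d, h⟩)

variable {σ k : Type*} [Field k]

theorem exists_eq_C_mul_of_associated {f g : MvPolynomial σ k} (h : Associated f g) :
    ∃ c : k, c ≠ 0 ∧ g = C c * f := by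
  obtain ⟨u, rfl⟩ := h
  obtain ⟨c, hc, hu⟩ := isUnit_iff_eq_C_of_isReduced.1 u.isUnit
  exact ⟨c, hc.ne_zero, by rw [hu, mul_comm]⟩

theorem totalDegree_eq_one_of_dvd_prod {L : Multiset PolyXY} (hL : ∀ l ∈ L, l.totalDegree = 1)
    {f : PolyXY} (hf : Irreducible f) (h : f ∣ L.prod) : f.totalDegree = 1 := by
  obtain ⟨l, hl, hfl⟩ := hf.prime.exists_mem_multiset_dvd h
  by_contra hne
  refine not_dvd_of_totalDegree_le_one hf hne ?_ (hL l hl).le hfl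
  rintro rfl
  simpa using hL 0 hl

theorem mul_dvd_of_planeCurve_subset {f g h : PolyXY} (hf : Irreducible f)
    (hg : Irreducible g ∨ g = 1) (hfg : ¬ f ∣ g)
    (hsub : planeCurve f ∪ planeCurve g ⊆ planeCurve h) : f * g ∣ h := by
  have hfh := dvd_of_planeCurve_subset hf (Set.subset_union_left.trans hsub)
  rcases hg with hg | rfl
  · exact ((hf.isRelPrime_iff_not_dvd).2 hfg).mul_dvd hfh
      (dvd_of_planeCurve_subset hg (Set.subset_union_right.trans hsub))
  · rwa [mul_one]

end Algebra

namespace OffsetData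

variable {D : OffsetData} {t s : ℂ}

theorem HasOppositeNormals.exists_reflection
    (hopposite : D.HasOppositeNormals (D.offsetPoint t s)) (hs : D.IsCoverPoint t s)
    (htwo : (D.generators (D.offsetPoint t s)).encard = 2) :
    ∃ t' s', D.IsCoverPoint t' s' ∧ D.unitNormal t' s' = D.unitNormal t s ∧
      D.point t' = D.point t + (2 * D.d) • D.unitNormal t s := by
  obtain ⟨_, ⟨t', s', hs', heq, rfl⟩, hne⟩ := Set.exists_ne_of_one_lt_encard
    (by rw [htwo]; norm_num) (D.point t)
  have hneg := (hopposite t s t' s' hs hs' rfl heq).resolve_left hne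
  refine ⟨t', -s', hs'.neg, by rw [unitNormal_neg, hneg, neg_neg], ?_⟩
  rw [offsetPoint_eq, offsetPoint_eq, hneg] at heq
  linear_combination (norm := module) heq

-- If almost every offset point had two generators, then translation by a fixed multiple of a
-- general unit normal `N` would map the finite set of curve points with unit normal `N` to itself.
variable (D) in
theorem infinite_not_two_generators : {p | D.IsGenerated p ∧
    ¬ ((D.generators p).encard = 2 ∧ D.HasOppositeNormals p)}.Infinite := by
  intro hfin
  have hparallel := (D.finite_offsetPoint_mem hfin).biUnion' fun t ht =>
    IsCoverPoint.finite_parallel ht.choose_spec.1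
  obtain ⟨t₀, s₀, ht₀, hs₀⟩ := D.exists_isCoverPoint_notMem hparallel
  let A : Set (Fin 2 → ℂ) :=
    {z | ∃ t s, D.IsCoverPoint t s ∧ D.unitNormal t s = D.unitNormal t₀ s₀ ∧ z = D.point t}
  have hA : A.Finite := by
    refine (hs₀.finite_parallel.image D.point).subset ?_
    rintro z ⟨t, s, hs, hN, rfl⟩
    exact ⟨t, parallel_of_unitNormal_eq hs₀ hs hN, rfl⟩
  have hw : (2 * D.d) • D.unitNormal t₀ s₀ ≠ 0 :=
    smul_ne_zero (mul_ne_zero two_ne_zero D.d_ne_zero) hs₀.unitNormal_ne_zero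
  obtain ⟨z, ⟨t, s, hs, hN, rfl⟩, hz⟩ :=
    exists_mem_add_notMem_of_finite hA ⟨_, t₀, s₀, hs₀, rfl, rfl⟩ hw
  obtain ⟨htwo, hopposite⟩ : (D.generators (D.offsetPoint t s)).encard = 2 ∧
      D.HasOppositeNormals (D.offsetPoint t s) := by
    by_contra hbad
    exact ht₀ (Set.mem_biUnion ⟨s, hs, ⟨t, s, hs, rfl⟩, hbad⟩
      (parallel_of_unitNormal_eq hs hs₀ hN.symm))
  obtain ⟨t', s', hs', hN', hpoint⟩ := hopposite.exists_reflection hs htwo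
  exact hz ⟨t', s', hs', hN'.trans hN, by rw [hpoint, hN]⟩

end OffsetData

namespace OffsetResultant

noncomputable section

variable {D : OffsetData} (R : OffsetResultant D)

/-- `f` occurs exactly `n * k` times in the resultant, and all but finitely many points of the
curve `f = 0` have exactly `k` generators, on opposite sides of the curve. -/
structure HasSheets (n k : ℕ) (f : PolyXY) : Prop where
  emultiplicity_eq : emultiplicity f R.H = (n * k : ℕ)
  finite_exceptions : {p | p ∈ planeCurve f ∧
    ¬ ((D.generators p).encard = k ∧ D.HasOppositeNormals p)}.Finite

/-- `f` and `g` represent all nonlinear factors of the resultant, with `1` and `k` sheets; here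
`g = 1` stands for a missing second factor. -/
structure IsSheetDecomposition (n k : ℕ) (f g : PolyXY) : Prop where
  areNonlinearFactors : R.AreNonlinearFactors f g
  hasSheets_left : R.HasSheets n 1 f
  hasSheets_right : g ≠ 1 → R.HasSheets n k g
  sheets_eq : k = 1 ∨ k = 2 ∧ g ≠ 1

variable {R} {n k a : ℕ} {f g h F G : PolyXY} {p : Fin 2 → ℂ}

theorem IsGeneric.hasOppositeNormals
    (hzero : ∀ t s, D.IsCoverPoint t s → eval (D.offsetPoint t s) (f * g) = 0)
    (hp : R.IsGeneric f g h p) : D.HasOppositeNormals p := by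
  rintro t s t' s' hs hs' rfl heq
  have hnormal' := (heq ▸ hp : R.IsGeneric f g h (D.offsetPoint t' s')).gradient_normal hs' hzero
  rw [heq] at hnormal'
  have hparallel := mul_eq_mul_of_orthogonal (Fin.exists_fin_two.1 hp.smooth)
    (hp.gradient_normal hs hzero) hnormal'
  refine (OffsetData.unitNormal_eq_or_eq_neg hs hs' hparallel).imp_left fun hN => ?_
  rw [OffsetData.offsetPoint_eq, OffsetData.offsetPoint_eq, hN] at heq
  exact add_right_cancel heq

variable (R) in
theorem exists_eq_pow_mul_and_not_dvd (hf : Irreducible f) :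
    ∃ (a : ℕ) (h : PolyXY), emultiplicity f R.H = a ∧ R.H = f ^ a * h ∧ ¬ f ∣ h := by
  have hfin : FiniteMultiplicity f R.H := FiniteMultiplicity.of_not_isUnit hf.not_isUnit H_ne_zero
  obtain ⟨h, hH, hfh⟩ := hfin.exists_eq_pow_mul_and_not_dvd
  exact ⟨_, h, hfin.emultiplicity_eq_multiplicity, hH, hfh⟩

namespace IsNonlinearFactor

-- At a generic point the multiplicity of `f` counts the parameters; these form fibres of size `n`
-- over the one or two generators.
theorem finite_emultiplicity_ne (hf : R.IsNonlinearFactor f) (hn : D.HasTracingIndex n)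
    (hfg : ¬ f ∣ g)
    (hzero : ∀ t s, D.IsCoverPoint t s → eval (D.offsetPoint t s) (f * g) = 0) :
    {p | p ∈ planeCurve f ∧ ¬ (D.HasOppositeNormals p ∧ ∃ k : ℕ, (k = 1 ∨ k = 2) ∧
      (D.generators p).encard = k ∧ emultiplicity f R.H = (n * k : ℕ))}.Finite := by
  obtain ⟨a, h, ha, hH, hfh⟩ := R.exists_eq_pow_mul_and_not_dvd hf.1
  refine ((finite_not_isGeneric hf hfg hfh).union (hf.finite_not_isGenerated.union
    (D.finite_offsetPoint_of_finite hn.finite_not_isRegularParam))).subset ?_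
  rintro p ⟨hp, hbad⟩
  by_contra hgood
  simp only [Set.mem_union, Set.mem_ofPred_eq, hp, true_and, not_or, not_not] at hgood
  obtain ⟨hgeneric, hgenerated, hirregular⟩ := hgood
  have hopposite := hgeneric.hasOppositeNormals hzero
  have hregular (t s : ℂ) (hs : D.IsCoverPoint t s) (hts : D.offsetPoint t s = p) :
      D.IsRegularParam n t := by
    by_contra hreg
    exact hirregular ⟨t, ⟨hs.1, hreg⟩, s, hs, hts⟩
  have hcount : emultiplicity f R.H = (D.generators p).encard * n := by
    rw [ha, ← hgeneric.encard_params hH hzero, OffsetData.encard_params hregular]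
  refine hbad ⟨hopposite, ?_⟩
  rcases hopposite.encard_generators hgenerated with hone | htwo
  · exact ⟨1, Or.inl rfl, by simpa using hone, by rw [hcount, hone]; simp⟩
  · exact ⟨2, Or.inr rfl, by simpa using htwo, by rw [hcount, htwo, mul_comm]; simp⟩

theorem exists_hasSheets (hf : R.IsNonlinearFactor f) (hn : D.HasTracingIndex n) (hfg : ¬ f ∣ g)
    (hzero : ∀ t s, D.IsCoverPoint t s → eval (D.offsetPoint t s) (f * g) = 0) :
    ∃ k, (k = 1 ∨ k = 2) ∧ R.HasSheets n k f := by
  have hfin := hf.finite_emultiplicity_ne hn hfg hzero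
  obtain ⟨p, hp, hgood⟩ := ((planeCurve_infinite hf.1).sdiff hfin).nonempty
  obtain ⟨-, k, hk, -, hmult⟩ := not_not.1 (not_and.1 hgood hp)
  refine ⟨k, hk, hmult, hfin.subset ?_⟩
  rintro q ⟨hq, hbad⟩
  refine ⟨hq, ?_⟩
  rintro ⟨hopposite, k', -, hcard, hmult'⟩
  have hkk : k' = k :=
    Nat.eq_of_mul_eq_mul_left (Nat.pos_of_ne_zero hn.ne_zero)
      (by exact_mod_cast hmult'.symm.trans hmult)
  exact hbad ⟨hkk ▸ hcard, hopposite⟩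

end IsNonlinearFactor

theorem HasSheets.finite_encard_ne (hf : R.HasSheets n k f) :
    {p | p ∈ planeCurve f ∧ (D.generators p).encard ≠ k}.Finite :=
  hf.finite_exceptions.subset fun _ hp => ⟨hp.1, fun hgood => hp.2 hgood.1⟩

theorem HasSheets.exists_eq_pow_mul (hf : R.HasSheets n k f) : ∃ h, R.H = f ^ (n * k) * h :=
  pow_dvd_of_le_emultiplicity hf.emultiplicity_eq.ge

theorem HasSheets.not_dvd_of_eq_pow_mul (hf : R.HasSheets n k f)
    (hH : R.H = f ^ (n * k) * h) : ¬ f ∣ h := by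
  rintro ⟨h', rfl⟩
  refine (emultiplicity_eq_coe.1 hf.emultiplicity_eq).2 ⟨h', ?_⟩
  rw [hH, pow_succ, mul_assoc]

namespace AreNonlinearFactors

theorem not_dvd (hfg : R.AreNonlinearFactors f g) : ¬ f ∣ g := by
  rcases hfg.2.1 with rfl | hg
  · exact fun hdvd => hfg.1.1.not_isUnit (isUnit_of_dvd_one hdvd)
  · exact fun hdvd => hg.2 (hfg.1.1.associated_of_dvd hg.1.1 hdvd)

theorem symm (hfg : R.AreNonlinearFactors f g) (hg : g ≠ 1) : R.AreNonlinearFactors g f := by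
  have hg' := hfg.2.1.resolve_left hg
  exact ⟨hg'.1, Or.inr ⟨hfg.1, fun hass => hg'.2 hass.symm⟩,
    fun k hk => mul_comm f g ▸ hfg.2.2 k hk⟩

theorem exists_hasSheets (hfg : R.AreNonlinearFactors f g) (hn : D.HasTracingIndex n) :
    ∃ k, (k = 1 ∨ k = 2) ∧ R.HasSheets n k f :=
  hfg.1.exists_hasSheets hn hfg.not_dvd fun _ _ hs => hfg.eval_offsetPoint hs

theorem not_hasSheets_two (hfg : R.AreNonlinearFactors f g) (hf : R.HasSheets n 2 f)
    (hg : g ≠ 1 → R.HasSheets n 2 g) : False := by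
  have hfin : {p | p ∈ planeCurve g ∧
      ¬ ((D.generators p).encard = 2 ∧ D.HasOppositeNormals p)}.Finite := by
    by_cases hg1 : g = 1
    · simp [hg1, planeCurve_one]
    · exact (hg hg1).finite_exceptions
  refine D.infinite_not_two_generators ((hf.finite_exceptions.union hfin).subset ?_)
  rintro p ⟨⟨t, s, hs, rfl⟩, hbad⟩
  have hmem : D.offsetPoint t s ∈ planeCurve (f * g) := hfg.eval_offsetPoint hs
  rw [planeCurve_mul] at hmem
  exact hmem.imp (fun hf => ⟨hf, hbad⟩) fun hg => ⟨hg, hbad⟩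

end AreNonlinearFactors

variable (R) in
theorem exists_isSheetDecomposition (hn : D.HasTracingIndex n) :
    ∃ k f g, R.IsSheetDecomposition n k f g := by
  obtain ⟨f, g, hfg⟩ := R.exists_areNonlinearFactors
  obtain ⟨k, hk, hf⟩ := hfg.exists_hasSheets hn
  by_cases hg1 : g = 1
  · obtain rfl := hk.resolve_right (by
      rintro rfl
      exact hfg.not_hasSheets_two hf fun h => absurd hg1 h)
    exact ⟨1, f, g, hfg, hf, fun h => absurd hg1 h, Or.inl rfl⟩
  have hgf := hfg.symm hg1
  obtain ⟨l, hl, hg⟩ := hgf.exists_hasSheets hn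
  rcases hk with rfl | rfl
  · exact ⟨l, f, g, hfg, hf, fun _ => hg, hl.imp_right fun h => ⟨h, hg1⟩⟩
  · obtain rfl := hl.resolve_right (by
      rintro rfl
      exact hfg.not_hasSheets_two hf fun _ => hg)
    exact ⟨2, g, f, hgf, hg, fun _ => hf, Or.inr ⟨rfl, hfg.1.1.ne_one⟩⟩

namespace IsSheetDecomposition

theorem finite_encard_right_ne (h : R.IsSheetDecomposition n k f g) :
    {p | p ∈ planeCurve g ∧ (D.generators p).encard ≠ k}.Finite := by
  by_cases hg : g = 1
  · simp [hg, planeCurve_one]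
  · exact (h.hasSheets_right hg).finite_encard_ne

theorem exists_eq_mul (h : R.IsSheetDecomposition n k f g) :
    ∃ K, R.H = f ^ n * g ^ (n * k) * K ∧ ¬ f ∣ K ∧ (g ≠ 1 → ¬ g ∣ K) := by
  have hrel : IsRelPrime (f ^ n) (g ^ (n * k)) :=
    ((h.areNonlinearFactors.1.1.isRelPrime_iff_not_dvd).2 h.areNonlinearFactors.not_dvd).pow
  have hf : f ^ n ∣ R.H := by simpa [dvd_def] using h.hasSheets_left.exists_eq_pow_mul
  have hg : g ^ (n * k) ∣ R.H := by
    by_cases hg : g = 1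
    · simp [hg]
    · exact (h.hasSheets_right hg).exists_eq_pow_mul
  obtain ⟨K, hK⟩ := hrel.mul_dvd hf hg
  refine ⟨K, hK, fun hfK => ?_, fun hg hgK => ?_⟩
  · exact h.hasSheets_left.not_dvd_of_eq_pow_mul (h := g ^ (n * k) * K)
      (by rw [hK, mul_one, mul_assoc]) (hfK.mul_left _)
  · exact (h.hasSheets_right hg).not_dvd_of_eq_pow_mul (h := f ^ n * K)
      (by rw [hK, mul_left_comm, mul_assoc]) (hgK.mul_left _)

theorem exists_linear_cofactor (h : R.IsSheetDecomposition n k f g) :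
    ∃ K, R.H = f ^ n * g ^ (n * k) * K ∧ ∀ l, Irreducible l → l ∣ K → l.totalDegree = 1 := by
  obtain ⟨K, hK, hf, hg⟩ := h.exists_eq_mul
  refine ⟨K, hK, fun l hl hlK => ?_⟩
  by_contra hdeg
  have hnonlinear : R.IsNonlinearFactor l := ⟨hl, hdeg, hK ▸ hlK.mul_left _⟩
  rcases hl.prime.dvd_or_dvd (h.areNonlinearFactors.2.2 l hnonlinear) with hlf | hlg
  · exact hf ((hl.associated_of_dvd h.areNonlinearFactors.1.1 hlf).symm.dvd.trans hlK)
  · rcases h.areNonlinearFactors.2.1 with rfl | hg'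
    · exact hl.not_isUnit (isUnit_of_dvd_one hlg)
    · exact hg hg'.1.1.ne_one ((hl.associated_of_dvd hg'.1.1 hlg).symm.dvd.trans hlK)

theorem planeCurve_eq (h : R.IsSheetDecomposition n k f g) (hn : n ≠ 0) :
    planeCurve (f ^ n * g ^ (n * k)) = planeCurve (f * g) := by
  have hk : k ≠ 0 := by
    rcases h.sheets_eq with hk | hk <;> omega
  rw [planeCurve_mul, planeCurve_mul, planeCurve_pow _ hn, planeCurve_pow _ (mul_ne_zero hn hk)]

-- An irreducible factor of `F` vanishes only on the offset, so it is nonlinear.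
theorem totalDegree_ne_one_of_dvd (h : R.IsSheetDecomposition n k f g)
    (hF : planeCurve F = planeCurve (f * g)) {l : PolyXY} (hl : Irreducible l) (hlF : l ∣ F) :
    l.totalDegree ≠ 1 :=
  (h.areNonlinearFactors.isNonlinearFactor_of_dvd hl (dvd_of_planeCurve_subset hl
    ((planeCurve_subset_of_dvd hlF).trans hF.subset))).2.1

theorem associated (h : R.IsSheetDecomposition n k f g) (hn : n ≠ 0) (hFG : R.H = F * G)
    (hF : planeCurve F = planeCurve (f * g))
    (hG : ∀ l, Irreducible l → l ∣ G → l.totalDegree = 1) :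
    Associated F (f ^ n * g ^ (n * k)) := by
  obtain ⟨K, hK, hlinear⟩ := h.exists_linear_cofactor
  have hH := H_ne_zero (R := R)
  exact associated_of_mul_eq_mul (hFG.symm.trans hK)
    (isRelPrime_of_forall_irreducible (left_ne_zero_of_mul (hFG ▸ hH)) fun l hl hlF hlK =>
      h.totalDegree_ne_one_of_dvd hF hl hlF (hlinear l hl hlK))
    (isRelPrime_of_forall_irreducible (left_ne_zero_of_mul (hK ▸ hH)) fun l hl hlM hlG =>
      h.totalDegree_ne_one_of_dvd (h.planeCurve_eq hn) hl hlM (hG l hl hlG))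

end IsSheetDecomposition

end

end OffsetResultant

theorem exists_multiset_of_forall_irreducible_dvd {K : PolyXY} (hK : K ≠ 0)
    (h : ∀ l, Irreducible l → l ∣ K → l.totalDegree = 1) :
    ∃ (c : ℂ) (L : Multiset PolyXY), c ≠ 0 ∧ (∀ l ∈ L, l.totalDegree = 1) ∧ K = C c * L.prod := by
  obtain ⟨L, hL, hass⟩ := WfDvdMonoid.exists_factors K hK
  obtain ⟨c, hc, rfl⟩ := exists_eq_C_mul_of_associated hass
  exact ⟨c, L, hc, fun l hl => h l (hL l hl) ((Multiset.dvd_prod hl).mul_left _), rfl⟩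

namespace OffsetData

noncomputable section

variable (D : OffsetData)

/-- The offset to the curve at distance `d`. -/
def offset : Set (Fin 2 → ℂ) := zariskiClosure {p | D.IsGenerated p}

/-- A simple component of the offset: almost every point is generated by just one point. -/
def IsSimpleComponent (Z : Set (Fin 2 → ℂ)) : Prop :=
  IsIrredComponent D.offset Z ∧ {q | q ∈ Z ∧ (D.generators q).encard ≠ 1}.Finite

/-- A special component of the offset: a component that is not simple. -/
def IsSpecialComponent (Z : Set (Fin 2 → ℂ)) : Prop :=
  IsIrredComponent D.offset Z ∧ ¬ D.IsSimpleComponent Z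

/-- The offset has a special component. -/
def HasSpecialComponent : Prop := ∃ Z, D.IsSpecialComponent Z

/-- `H = F * G`, where `{F = 0}` is the offset and `G` is a product of linear factors. -/
def IsOffsetFactorization (H F G : PolyXY) : Prop :=
  H = F * G ∧ planeCurve F = D.offset ∧
    ∃ L : Multiset PolyXY, (∀ l ∈ L, l.totalDegree = 1) ∧ G = L.prod

/-- `f₁`, `f₂` are irreducible equations of the components of the offset, with `f₂ = 1` if there is
only one; a special component is represented by `f₂`. -/
def AreComponentEquations (f₁ f₂ : PolyXY) : Prop :=
  Irreducible f₁ ∧ (Irreducible f₂ ∨ f₂ = 1) ∧ planeCurve f₁ ≠ planeCurve f₂ ∧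
    planeCurve f₁ ∪ planeCurve f₂ = D.offset ∧
    ∀ Z, D.IsSpecialComponent Z → planeCurve f₂ = Z

variable {D} in
theorem AreComponentEquations.not_dvd {f₁ f₂ : PolyXY} (h : D.AreComponentEquations f₁ f₂) :
    ¬ f₁ ∣ f₂ := by
  intro hdvd
  rcases h.2.1 with hf₂ | rfl
  · exact h.2.2.1 ((associated_iff_planeCurve_eq h.1 hf₂).1 (h.1.associated_of_dvd hf₂ hdvd))
  · exact h.1.not_isUnit (isUnit_of_dvd_one hdvd)

end

end OffsetData

namespace OffsetResultant

namespace IsSheetDecomposition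

variable {D : OffsetData} {R : OffsetResultant D} {n k : ℕ} {f g f₁ f₂ F G : PolyXY}
  {Z : Set (Fin 2 → ℂ)}

theorem offset_eq (h : R.IsSheetDecomposition n k f g) : D.offset = planeCurve (f * g) :=
  h.areNonlinearFactors.zariskiClosure_isGenerated

theorem irreducible_right (h : R.IsSheetDecomposition n k f g) (hg : g ≠ 1) : Irreducible g :=
  (h.areNonlinearFactors.2.1.resolve_left hg).1.1

theorem planeCurve_ne (h : R.IsSheetDecomposition n k f g) : planeCurve f ≠ planeCurve g :=
  fun heq => h.areNonlinearFactors.not_dvd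
    (dvd_of_planeCurve_subset h.areNonlinearFactors.1.1 heq.subset)

theorem eq_planeCurve_of_isIrredComponent (h : R.IsSheetDecomposition n k f g)
    (hZ : IsIrredComponent D.offset Z) : Z = planeCurve f ∨ Z = planeCurve g := by
  rw [h.offset_eq] at hZ
  obtain ⟨l, hl, hdvd, rfl⟩ := hZ.exists_irreducible_factor h.areNonlinearFactors.mul_ne_zero
  refine (hl.prime.dvd_or_dvd hdvd).imp (fun hlf => ?_) fun hlg => ?_
  · exact (associated_iff_planeCurve_eq hl h.areNonlinearFactors.1.1).1
      (hl.associated_of_dvd h.areNonlinearFactors.1.1 hlf)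
  · have hg := h.irreducible_right fun hg1 => hl.not_isUnit (isUnit_of_dvd_one (hg1 ▸ hlg))
    exact (associated_iff_planeCurve_eq hl hg).1 (hl.associated_of_dvd hg hlg)

theorem isSpecialComponent_right (h : R.IsSheetDecomposition n 2 f g) :
    D.IsSpecialComponent (planeCurve g) := by
  have hg := h.irreducible_right (h.sheets_eq.resolve_left (by norm_num)).2
  refine ⟨h.offset_eq ▸ isIrredComponent_planeCurve hg h.areNonlinearFactors.mul_ne_zero
    (dvd_mul_left _ _), fun hsimple => planeCurve_infinite hg ?_⟩
  refine (hsimple.2.union h.finite_encard_right_ne).subset fun p hp => ?_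
  by_cases hone : (D.generators p).encard = 1
  · exact Or.inr ⟨hp, by rw [hone]; norm_num⟩
  · exact Or.inl ⟨hp, hone⟩

theorem isSpecialComponent_iff (h : R.IsSheetDecomposition n k f g) :
    D.IsSpecialComponent Z ↔ k = 2 ∧ Z = planeCurve g := by
  refine ⟨?_, by rintro ⟨rfl, rfl⟩; exact h.isSpecialComponent_right⟩
  rintro ⟨hZ, hnot⟩
  rcases h.eq_planeCurve_of_isIrredComponent hZ with rfl | rfl
  · exact absurd ⟨hZ, by simpa using h.hasSheets_left.finite_encard_ne⟩ hnot
  refine ⟨(h.sheets_eq.resolve_left ?_).1, rfl⟩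
  rintro rfl
  exact hnot ⟨hZ, by simpa using h.finite_encard_right_ne⟩

theorem hasSpecialComponent_iff (h : R.IsSheetDecomposition n k f g) :
    D.HasSpecialComponent ↔ k = 2 := by
  simp only [OffsetData.HasSpecialComponent, h.isSpecialComponent_iff, exists_and_left,
    exists_eq, and_true]

theorem areComponentEquations (h : R.IsSheetDecomposition n k f g) :
    D.AreComponentEquations f g :=
  ⟨h.areNonlinearFactors.1.1, h.areNonlinearFactors.2.1.symm.imp_left fun hg => hg.1.1,
    h.planeCurve_ne, by rw [h.offset_eq, planeCurve_mul],
    fun _ hZ => (h.isSpecialComponent_iff.1 hZ).2.symm⟩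

theorem exists_isOffsetFactorization (h : R.IsSheetDecomposition n k f g) (hn : n ≠ 0) :
    ∃ F G, D.IsOffsetFactorization R.H F G := by
  obtain ⟨K, hK, hlinear⟩ := h.exists_linear_cofactor
  obtain ⟨c, L, hc, hL, rfl⟩ := exists_multiset_of_forall_irreducible_dvd
    (right_ne_zero_of_mul (hK ▸ H_ne_zero)) hlinear
  exact ⟨C c * (f ^ n * g ^ (n * k)), L.prod, by rw [hK]; ring,
    by rw [planeCurve_C_mul hc, h.planeCurve_eq hn, h.offset_eq], L, hL, rfl⟩

theorem associated_of_isOffsetFactorization (h : R.IsSheetDecomposition n k f g) (hn : n ≠ 0)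
    (hFG : D.IsOffsetFactorization R.H F G) : Associated (f ^ n * g ^ (n * k)) F := by
  obtain ⟨hH, hF, L, hL, rfl⟩ := hFG
  exact (h.associated hn hH (hF.trans h.offset_eq) fun l =>
    totalDegree_eq_one_of_dvd_prod hL).symm

theorem associated_mul (h : R.IsSheetDecomposition n k f g)
    (hf : D.AreComponentEquations f₁ f₂) : Associated (f₁ * f₂) (f * g) := by
  have hunion : planeCurve f₁ ∪ planeCurve f₂ = planeCurve f ∪ planeCurve g := by
    rw [hf.2.2.2.1, h.offset_eq, planeCurve_mul]
  have hg := h.areComponentEquations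
  refine associated_of_dvd_dvd (mul_dvd_of_planeCurve_subset hf.1 hf.2.1 hf.not_dvd ?_)
    (mul_dvd_of_planeCurve_subset hg.1 hg.2.1 hg.not_dvd ?_)
  · rw [hunion, planeCurve_mul]
  · rw [← hunion, planeCurve_mul]

theorem associated_right (h : R.IsSheetDecomposition n 2 f g)
    (hf : D.AreComponentEquations f₁ f₂) : Associated f₂ g := by
  have hg := h.irreducible_right (h.sheets_eq.resolve_left (by norm_num)).2
  have hcurve : planeCurve f₂ = planeCurve g := hf.2.2.2.2 _ h.isSpecialComponent_right
  refine (associated_iff_planeCurve_eq (hf.2.1.resolve_right ?_) hg).2 hcurve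
  rintro rfl
  exact planeCurve_infinite hg (by simp [← hcurve, planeCurve_one])

theorem associated_pow_mul_pow (h : R.IsSheetDecomposition n k f g)
    (hf : D.AreComponentEquations f₁ f₂) :
    Associated (f₁ ^ n * f₂ ^ (n * k)) (f ^ n * g ^ (n * k)) := by
  have hmul := h.associated_mul hf
  rcases h.sheets_eq with rfl | ⟨rfl, hg⟩
  · simpa only [mul_one, mul_pow] using hmul.pow_pow (n := n)
  · have hright := h.associated_right hf
    have hleft : Associated f₁ f := hmul.of_mul_right hright (hright.symm.irreducible
      (h.irreducible_right hg)).ne_zero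
    exact hleft.pow_pow.mul_mul hright.pow_pow

end IsSheetDecomposition

end OffsetResultant

theorem theorem3_general (D : OffsetData) (n : ℕ) (hn : D.HasTracingIndex n)
    (P Q : Polynomial PolyXY)
    (hP : IsPrimitivePartT D.normalPoly P) (hQ : IsPrimitivePartT D.circlePoly Q) :
    (∃ F G : PolyXY, D.IsOffsetFactorization (Polynomial.resultant P Q) F G) ∧
    (∃ f₁ f₂ : PolyXY, D.AreComponentEquations f₁ f₂) ∧
    ∀ F G f₁ f₂ : PolyXY,
      D.IsOffsetFactorization (Polynomial.resultant P Q) F G →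
      D.AreComponentEquations f₁ f₂ →
      (¬ D.HasSpecialComponent → ∃ c : ℂ, c ≠ 0 ∧ F = C c * (f₁ ^ n * f₂ ^ n)) ∧
      (D.HasSpecialComponent → ∃ c : ℂ, c ≠ 0 ∧ F = C c * (f₁ ^ n * f₂ ^ (2 * n))) := by
  let R : OffsetResultant D := ⟨P, Q, hP, hQ⟩
  obtain ⟨k, f, g, h⟩ := R.exists_isSheetDecomposition hn
  refine ⟨h.exists_isOffsetFactorization hn.ne_zero, ⟨f, g, h.areComponentEquations⟩,
    fun F G f₁ f₂ hFG hf => ?_⟩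
  have hassociated : Associated (f₁ ^ n * f₂ ^ (n * k)) F :=
    (h.associated_pow_mul_pow hf).trans (h.associated_of_isOffsetFactorization hn.ne_zero hFG)
  rw [h.hasSpecialComponent_iff]
  refine ⟨fun hk => ?_, ?_⟩
  · obtain rfl := h.sheets_eq.resolve_right fun hk' => hk hk'.1
    exact exists_eq_C_mul_of_associated (by rwa [mul_one] at hassociated)
  · rintro rfl
    exact exists_eq_C_mul_of_associated (by rwa [mul_comm n 2] at hassociated)

/-! ### Rational parametrizations -/

section LowDegree

theorem irreducible_of_totalDegree_eq_one_of_field {σ K : Type*} [Field K] {f : MvPolynomial σ K}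
    (hf : f.totalDegree = 1) : Irreducible f := by
  refine irreducible_of_totalDegree_eq_one hf fun x hx => isUnit_iff_ne_zero.2 ?_
  rintro rfl
  have hzero : f = 0 := ext _ _ fun m => zero_dvd_iff.1 (hx m)
  rw [hzero, totalDegree_zero] at hf
  exact zero_ne_one hf

theorem exists_linear_form {f : PolyXY} (hf : f.totalDegree = 1) : ∃ a b c : ℂ,
    (a ≠ 0 ∨ b ≠ 0) ∧ f = C a * X 0 + C b * X 1 + C c := by
  obtain ⟨a, ha⟩ := exists_pderiv_eq_C_of_totalDegree_le_one hf.le 0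
  obtain ⟨b, hb⟩ := exists_pderiv_eq_C_of_totalDegree_le_one hf.le 1
  have hconst := eq_C_of_forall_pderiv_eq_zero (f := f - C a * X 0 - C b * X 1)
    (Fin.forall_fin_two.2 ⟨by simp [ha], by simp [hb]⟩)
  refine ⟨a, b, _, ?_, by linear_combination hconst⟩
  by_contra! hzero
  have hf' := eq_C_of_forall_pderiv_eq_zero (f := f)
    (Fin.forall_fin_two.2 ⟨by rw [ha, hzero.1, C_0], by rw [hb, hzero.2, C_0]⟩)
  rw [hf', totalDegree_C] at hf
  exact zero_ne_one hf

theorem totalDegree_linear_form {a b : ℂ} (hab : a ≠ 0 ∨ b ≠ 0) (c : ℂ) :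
    (C a * X 0 + C b * X 1 + C c : PolyXY).totalDegree = 1 := by
  have hterm (a : ℂ) (i : Fin 2) : (C a * X i : PolyXY).totalDegree ≤ 1 := by
    simpa using totalDegree_mul (C a) (X i : PolyXY)
  have hle : (C a * X 0 + C b * X 1 + C c : PolyXY).totalDegree ≤ 1 :=
    (totalDegree_add _ _).trans (max_le ((totalDegree_add _ _).trans
      (max_le (hterm a 0) (hterm b 1))) (by simp))
  obtain ⟨i, hi⟩ : ∃ i, pderiv i (C a * X 0 + C b * X 1 + C c : PolyXY) ≠ 0 := by
    rcases hab with ha | hb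
    · exact ⟨0, by simpa [pderiv_C_mul] using ha⟩
    · exact ⟨1, by simpa [pderiv_C_mul] using hb⟩
  exact hle.antisymm ((Nat.zero_le _).trans_lt (totalDegree_pderiv_lt i hi))

/-- The circle of centre `(a, b)` and radius `r`. -/
noncomputable def circleXY (a b r : ℂ) : PolyXY := (X 0 - C a) ^ 2 + (X 1 - C b) ^ 2 - C (r ^ 2)

theorem totalDegree_circleXY_le (a b r : ℂ) : (circleXY a b r).totalDegree ≤ 2 := by
  have hsq (a : ℂ) (i : Fin 2) : ((X i - C a) ^ 2 : PolyXY).totalDegree ≤ 2 :=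
    (totalDegree_pow _ 2).trans
      (Nat.mul_le_mul_left 2 ((totalDegree_sub_C_le _ _).trans (totalDegree_X _).le))
  exact (totalDegree_sub_C_le _ _).trans
    ((totalDegree_add _ _).trans (max_le (hsq a 0) (hsq b 1)))

theorem circleXY_ne_zero (a b : ℂ) {r : ℂ} (hr : r ≠ 0) : circleXY a b r ≠ 0 := by
  intro h
  have hcenter := congrArg (eval ![a, b]) h
  simp [circleXY, hr] at hcenter

end LowDegree

namespace RatParam

noncomputable section

variable (φ : RatParam)

/-- A polynomial with rational coefficients as a complex polynomial. -/
def toC (a : Polynomial ℚ) : Polynomial ℂ := a.map (algebraMap ℚ ℂ)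

theorem eval_toC (a : Polynomial ℚ) (t : ℂ) : (toC a).eval t = Polynomial.aeval t a :=
  Polynomial.eval_map_algebraMap _ _

theorem toC_W_ne_zero : toC φ.W ≠ 0 :=
  (Polynomial.map_ne_zero_iff (algebraMap ℚ ℂ).injective).2 φ.W_ne_zero

theorem map_conj_toC (a : Polynomial ℚ) : (toC a).map (starRingEnd ℂ) = toC a := by
  rw [toC, Polynomial.map_map, Subsingleton.elim ((starRingEnd ℂ).comp _) (algebraMap ℚ ℂ)]

/-- The points `φ(t)`, of which the curve is the Zariski closure. -/
def image : Set (Fin 2 → ℂ) := {p | ∃ t : ℂ, Polynomial.aeval t φ.W ≠ 0 ∧ p = φ.point t}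

variable {φ}

theorem curve_eq_planeCurve {f : PolyXY} (hf : Irreducible f) (hsub : φ.image ⊆ planeCurve f)
    (hinf : φ.image.Infinite) : φ.curve = planeCurve f :=
  (zariskiClosure_subset_planeCurve hsub).antisymm
    (planeCurve_subset_zariskiClosure hf (by rwa [Set.inter_eq_self_of_subset_right hsub]))

theorem infinite_params {A : Set (Fin 2 → ℂ)} (h : (A ∩ φ.image).Infinite) :
    {t : ℂ | Polynomial.aeval t φ.W ≠ 0 ∧ φ.point t ∈ A}.Infinite := by
  intro hfin
  refine h ((hfin.image φ.point).subset ?_)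
  rintro _ ⟨hA, t, hW, rfl⟩
  exact ⟨t, ⟨hW, hA⟩, rfl⟩

theorem eval_point_linear_form_eq_zero_iff (a b c : ℂ) {t : ℂ} (hW : Polynomial.aeval t φ.W ≠ 0) :
    eval (φ.point t) (C a * MvPolynomial.X 0 + C b * MvPolynomial.X 1 + C c) = 0 ↔
      (Polynomial.C a * toC φ.X + Polynomial.C b * toC φ.Y + Polynomial.C c * toC φ.W).eval t
        = 0 := by
  simp only [map_add, map_mul, eval_C, eval_X, point, Matrix.cons_val_zero, Matrix.cons_val_one,
    Polynomial.eval_add, Polynomial.eval_mul, Polynomial.eval_C, eval_toC]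
  field_simp
  rw [mul_zero]

namespace IsAdmissible

theorem image_infinite (h : φ.IsAdmissible) : φ.image.Infinite := fun hfin =>
  h.1 (zariskiClosure_finite hfin)

theorem no_real_line (h : φ.IsAdmissible) {a b c : ℝ}
    (heq : Polynomial.C (a : ℂ) * toC φ.X + Polynomial.C (b : ℂ) * toC φ.Y +
      Polynomial.C (c : ℂ) * toC φ.W = 0) : a = 0 ∧ b = 0 := by
  by_contra hne
  have hab : a ≠ 0 ∨ b ≠ 0 := not_and_or.1 hne
  have hirr := irreducible_of_totalDegree_eq_one_of_field
    (totalDegree_linear_form (a := a) (b := b) (by exact_mod_cast hab) c)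
  refine h.2.1 a b c hab ((curve_eq_planeCurve hirr ?_ h.image_infinite).trans ?_)
  · rintro _ ⟨t, hW, rfl⟩
    exact (eval_point_linear_form_eq_zero_iff _ _ _ hW).2 (by rw [heq, Polynomial.eval_zero])
  · ext p
    simp [planeCurve]

-- As `X`, `Y`, `W` have real coefficients, the real and imaginary parts of a complex linear
-- relation between them are real linear relations.
theorem no_line (h : φ.IsAdmissible) {a b c : ℂ}
    (heq : Polynomial.C a * toC φ.X + Polynomial.C b * toC φ.Y + Polynomial.C c * toC φ.W = 0) :
    a = 0 ∧ b = 0 := by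
  have hcoeff (k : ℕ) : a * ((φ.X.coeff k : ℝ) : ℂ) + b * ((φ.Y.coeff k : ℝ) : ℂ) +
      c * ((φ.W.coeff k : ℝ) : ℂ) = 0 := by
    simpa [toC] using congrArg (Polynomial.coeff · k) heq
  have hreal (a b c : ℝ) (habc : ∀ k, a * (φ.X.coeff k : ℝ) + b * (φ.Y.coeff k : ℝ) +
      c * (φ.W.coeff k : ℝ) = 0) : a = 0 ∧ b = 0 := by
    refine h.no_real_line (c := c) (Polynomial.ext fun k => ?_)
    simpa [toC] using congrArg Complex.ofReal (habc k)
  have hre := hreal a.re b.re c.re fun k => by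
    simpa only [Complex.add_re, Complex.re_mul_ofReal, Complex.zero_re] using
      congrArg Complex.re (hcoeff k)
  have him := hreal a.im b.im c.im fun k => by
    simpa only [Complex.add_im, Complex.im_mul_ofReal, Complex.zero_im] using
      congrArg Complex.im (hcoeff k)
  exact ⟨Complex.ext hre.1 him.1, Complex.ext hre.2 him.2⟩

theorem finite_line (h : φ.IsAdmissible) {f : PolyXY} (hf : f.totalDegree = 1) :
    (planeCurve f ∩ φ.image).Finite := by
  by_contra hinf
  obtain ⟨a, b, c, hab, rfl⟩ := exists_linear_form hf
  obtain ⟨ha, hb⟩ := h.no_line (Polynomial.eq_zero_of_infinite_isRoot _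
    ((infinite_params hinf).mono fun t ht =>
      (eval_point_linear_form_eq_zero_iff a b c ht.1).1 ht.2))
  exact hab.elim (· ha) (· hb)

theorem irreducible_of_totalDegree_le_two (h : φ.IsAdmissible) {f : PolyXY} (hf : f ≠ 0)
    (hdeg : f.totalDegree ≤ 2) (hsub : φ.image ⊆ planeCurve f) : Irreducible f := by
  refine ⟨fun hunit => ?_, fun a b hab => ?_⟩
  · obtain ⟨p, hp⟩ := h.image_infinite.nonempty
    simpa [planeCurve_one] using planeCurve_subset_of_dvd (g := 1) hunit.dvd (hsub hp)
  by_contra! hne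
  obtain ⟨ha, hb⟩ := mul_ne_zero_iff.1 (hab ▸ hf)
  have hapos := totalDegree_pos_of_not_isUnit ha hne.1
  have hbpos := totalDegree_pos_of_not_isUnit hb hne.2
  rw [hab, totalDegree_mul_of_isDomain ha hb] at hdeg
  refine h.image_infinite (((h.finite_line (f := a) (by omega)).union
    (h.finite_line (f := b) (by omega))).subset fun p hp => ?_)
  have hmem := hsub hp
  rw [hab, planeCurve_mul] at hmem
  exact hmem.imp (⟨·, hp⟩) (⟨·, hp⟩)

theorem no_real_circle (h : φ.IsAdmissible) {r : ℝ} (hr : 0 < r) (a b : ℝ) :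
    (toC φ.X - Polynomial.C (a : ℂ) * toC φ.W) ^ 2 +
      (toC φ.Y - Polynomial.C (b : ℂ) * toC φ.W) ^ 2 ≠
        Polynomial.C ((r : ℂ) ^ 2) * toC φ.W ^ 2 := by
  intro heq
  have hsub : φ.image ⊆ planeCurve (circleXY a b r) := by
    rintro _ ⟨t, hW, rfl⟩
    have heval := congrArg (Polynomial.eval t) heq
    simp only [Polynomial.eval_add, Polynomial.eval_sub, Polynomial.eval_pow, Polynomial.eval_mul,
      Polynomial.eval_C, eval_toC] at heval
    simp only [planeCurve, circleXY, Set.mem_ofPred_eq, map_add, map_sub, map_pow, eval_C, eval_X,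
      point, Matrix.cons_val_zero, Matrix.cons_val_one]
    field_simp
    linear_combination heval
  have hirr := h.irreducible_of_totalDegree_le_two
    (circleXY_ne_zero a b (by exact_mod_cast hr.ne')) (totalDegree_circleXY_le a b r) hsub
  refine h.2.2 a b r hr ((curve_eq_planeCurve hirr hsub h.image_infinite).trans ?_)
  ext p
  simp [planeCurve, circleXY, sub_eq_zero]

-- Subtracting the conjugate equation leaves a linear relation, which forces the centre to be real.
theorem no_circle (h : φ.IsAdmissible) {r : ℝ} (hr : 0 < r) (a b : ℂ) :
    (toC φ.X - Polynomial.C a * toC φ.W) ^ 2 + (toC φ.Y - Polynomial.C b * toC φ.W) ^ 2 ≠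
      Polynomial.C ((r : ℂ) ^ 2) * toC φ.W ^ 2 := by
  intro heq
  have hconj := congrArg (Polynomial.map (starRingEnd ℂ)) heq
  simp only [Polynomial.map_add, Polynomial.map_pow, Polynomial.map_sub, Polynomial.map_mul,
    Polynomial.map_C, map_conj_toC, map_pow, Complex.conj_ofReal] at hconj
  set a' := starRingEnd ℂ a with ha'
  set b' := starRingEnd ℂ b with hb'
  obtain ⟨ha, hb⟩ := h.no_line (a := 2 * (a' - a)) (b := 2 * (b' - b))
    (c := a ^ 2 - a' ^ 2 + b ^ 2 - b' ^ 2) (by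
      apply mul_right_cancel₀ φ.toC_W_ne_zero
      simp only [Polynomial.C_mul, Polynomial.C_sub, Polynomial.C_add, Polynomial.C_pow]
        at heq hconj ⊢
      rw [show Polynomial.C (2 : ℂ) = 2 from rfl]
      linear_combination heq - hconj)
  have hre {z : ℂ} (hz : 2 * (starRingEnd ℂ z - z) = 0) : (z.re : ℂ) = z :=
    Complex.conj_eq_iff_re.1 (sub_eq_zero.1 ((mul_eq_zero.1 hz).resolve_left two_ne_zero))
  rw [← hre ha, ← hre hb] at heq
  exact h.no_real_circle hr _ _ heq

end IsAdmissible

section OffsetData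

variable (h : φ.IsAdmissible) {d : ℝ} (hd : 0 < d)

/-- An admissible parametrization and a positive distance as data over the complex numbers. -/
def offsetData : OffsetData where
  X := toC φ.X
  Y := toC φ.Y
  W := toC φ.W
  d := d
  W_ne_zero := φ.toC_W_ne_zero
  d_ne_zero := by exact_mod_cast hd.ne'
  no_line a b c heq := h.no_line (c := -c) (by rw [heq, Polynomial.C_neg]; ring)
  no_circle := h.no_circle hd

theorem offsetData_U : (offsetData h hd).U = toC φ.U := by
  simp [OffsetData.U, offsetData, U, toC, Polynomial.derivative_map]

theorem offsetData_V : (offsetData h hd).V = toC φ.V := by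
  simp [OffsetData.V, offsetData, V, toC, Polynomial.derivative_map]

theorem offsetData_point (t : ℂ) : (offsetData h hd).point t = φ.point t := by
  simp only [OffsetData.point, point, offsetData, eval_toC]

theorem liftT_eq (a : Polynomial ℚ) : liftT a = (toC a).map C := by
  rw [liftT, toC, Polynomial.map_map, IsScalarTower.algebraMap_eq ℚ ℂ PolyXY]
  rfl

theorem normalPoly_eq : φ.normalPoly = (offsetData h hd).normalPoly := by
  rw [normalPoly, OffsetData.normalPoly, offsetData_U, offsetData_V]
  simp only [liftT_eq, offsetData]

theorem circlePoly_eq : φ.circlePoly d = (offsetData h hd).circlePoly := by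
  rw [circlePoly, OffsetData.circlePoly]
  simp only [liftT_eq, offsetData]

theorem paramGenerates_iff (t : ℂ) (p : Fin 2 → ℂ) : φ.ParamGenerates d t p ↔
    ∃ s, (offsetData h hd).IsCoverPoint t s ∧ (offsetData h hd).offsetPoint t s = p := by
  simp only [ParamGenerates, OffsetData.IsCoverPoint, OffsetData.offsetPoint, OffsetData.offsetX,
    OffsetData.offsetY, OffsetData.S, offsetData_U, offsetData_V, Polynomial.eval_add,
    Polynomial.eval_pow, eval_toC, eq_comm (a := p), and_assoc, exists_and_left]
  simp only [offsetData, eval_toC, point, Matrix.cons_val_zero, Matrix.cons_val_one]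

theorem offset_eq : φ.offset d = (offsetData h hd).offset := by
  simp only [offset, OffsetData.offset, OffsetData.IsGenerated, paramGenerates_iff h hd]

theorem generators_eq (p : Fin 2 → ℂ) : φ.generators d p = (offsetData h hd).generators p := by
  ext z
  simp only [generators, OffsetData.generators, Set.mem_ofPred_eq, paramGenerates_iff h hd,
    offsetData_point, ← exists_and_right, and_assoc]

theorem hasTracingIndex_iff {n : ℕ} :
    φ.HasTracingIndex n ↔ (offsetData h hd).HasTracingIndex n := by
  simp only [HasTracingIndex, OffsetData.HasTracingIndex, curve, OffsetData.curve, fibre,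
    OffsetData.fibre, offsetData_point]
  simp only [offsetData, eval_toC]

theorem isSpecialComponent_iff (Z : Set (Fin 2 → ℂ)) :
    φ.IsSpecialComponent d Z ↔ (offsetData h hd).IsSpecialComponent Z := by
  simp only [IsSpecialComponent, IsSimpleComponent, OffsetData.IsSpecialComponent,
    OffsetData.IsSimpleComponent, offset_eq h hd, generators_eq h hd]

theorem hasSpecialComponent_iff :
    φ.HasSpecialComponent d ↔ (offsetData h hd).HasSpecialComponent :=
  exists_congr (isSpecialComponent_iff h hd)

theorem isOffsetFactorization_iff (H F G : PolyXY) :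
    φ.IsOffsetFactorization d H F G ↔ (offsetData h hd).IsOffsetFactorization H F G := by
  rw [IsOffsetFactorization, OffsetData.IsOffsetFactorization, offset_eq h hd]

theorem areComponentEquations_iff (f₁ f₂ : PolyXY) :
    φ.AreComponentEquations d f₁ f₂ ↔ (offsetData h hd).AreComponentEquations f₁ f₂ := by
  simp only [AreComponentEquations, OffsetData.AreComponentEquations, offset_eq h hd,
    isSpecialComponent_iff h hd]

end OffsetData

end

end RatParam

theorem theorem3 (φ : RatParam) (hφ : φ.IsAdmissible) (d : ℝ) (hd : 0 < d)
    (n : ℕ) (hn : φ.HasTracingIndex n)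
    (P Q : Polynomial PolyXY)
    (hP : IsPrimitivePartT φ.normalPoly P) (hQ : IsPrimitivePartT (φ.circlePoly d) Q) :
    (∃ F G : PolyXY, φ.IsOffsetFactorization d (Polynomial.resultant P Q) F G) ∧
    (∃ f₁ f₂ : PolyXY, φ.AreComponentEquations d f₁ f₂) ∧
    ∀ F G f₁ f₂ : PolyXY,
      φ.IsOffsetFactorization d (Polynomial.resultant P Q) F G →
      φ.AreComponentEquations d f₁ f₂ →
      (¬ φ.HasSpecialComponent d →
        ∃ c : ℂ, c ≠ 0 ∧ F = MvPolynomial.C c * (f₁ ^ n * f₂ ^ n)) ∧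
      (φ.HasSpecialComponent d →
        ∃ c : ℂ, c ≠ 0 ∧ F = MvPolynomial.C c * (f₁ ^ n * f₂ ^ (2 * n))) := by
  simpa only [RatParam.isOffsetFactorization_iff hφ hd, RatParam.areComponentEquations_iff hφ hd,
    RatParam.hasSpecialComponent_iff hφ hd] using theorem3_general (RatParam.offsetData hφ hd) n
      ((RatParam.hasTracingIndex_iff hφ hd).1 hn) P Q (RatParam.normalPoly_eq hφ hd ▸ hP)
      (RatParam.circlePoly_eq hφ hd ▸ hQ)
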